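/- Conventions. Let $\Sigma$ be a (connected, not necessarily compact) Riemann surface with complex structure $I$. A special Kähler structure on an open subset of $\Sigma$ is a pair $(g,\nabla)$ consisting of a Kähler metric $g$, with Kähler form $\omega(\cdot,\cdot)=g(I\cdot,\cdot)$, and a torsion-free flat connection $\nabla$ on the tangent bundle with $\nabla\omega=0$ and $(\nabla_XI)Y=(\nabla_YI)X$ for all vector fields $X,Y$. Its associated cubic form is $\Xi=-\omega(\pi,\nabla\pi)$, where $\pi$ is the projection of the complexified tangent bundle onto its $(1,0)$-part. Locally there are conjugate special holomorphic coordinates $Z,W$, i.e. holomorphic functions such that $d\,\mathrm{Re}\,Z$ and $d\,\mathrm{Re}\,W$ are $\nabla$-parallel and $\omega=-d\,\mathrm{Re}\,Z\wedge d\,\mathrm{Re}\,W$; the associated hyperbolic metric is the pull-back of $(\mathrm{Im}\,\tau)^{-2}|d\tau|^2$ by the period map $\tau=dW/dZ$. A hyperbolic metric is a conformal metric of Gaussian curvature $-1$. In a local holomorphic coordinate $z=re^{i\theta}$ centred at $p$, put $\rho=\log r$. A hyperbolic metric has a cusp at $p$ if it is $\frac{C+o(1)}{(r\log r)^2}|dz|^2$,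 and a conical singularity of order $\alpha>-1$ at $p$ if it is $r^{2\alpha}(C+o(1))|dz|^2$, with a constant $C>0$. It represents a divisor $D=\sum_{j=1}^n(\alpha_j-1)p_j$ with $0\le\alpha_j\ne1$ if it is a smooth hyperbolic metric on $\Sigma\setminus\operatorname{supp}D$, with a cusp at $p_j$ if $\alpha_j=0$ and a conical singularity of order $\alpha_j-1$ at $p_j$ if $\alpha_j>0$. Let $\omega_\nabla$ be the connection form of $\nabla$ in the frame $(\partial_x,\partial_y)$, let $\mathbb 1$ be the identity matrix, and let $J=\begin{pmatrix}0&-1\\1&0\end{pmatrix}$. The structure $(g,\nabla)$ has a conical singularity of order $\frac12\beta$, $\beta\in\mathbb R$, at $p$ if $g=r^\beta(C+o(1))|dz|^2$ with $C>0$ and $\omega_\nabla=\frac\beta2(\mathbb 1\,d\rho+J\,d\theta)+o(1)\,d\rho+o(1)\,d\theta$. It has a logarithmic singularity of order $\frac12k$, $k\in\mathbb Z$, at $p$ if, for some $b\in\mathbb C\setminus\{0\}$ and with $q=\frac b{|b|}e^{ik\theta}$, one has $g=-|b|\,r^k\log r\,(1+o(1))|dz|^2$ and $$\omega_\nabla=\tfrac12\left(kJ+\begin{pmatrix}\mathrm{Im}\,q&-1+\mathrm{Re}\,q\\1+\mathrm{Re}\,q&-\mathrm{Im}\,q\end{pmatrix}\rho^{-1}\right)d\theta+\tfrac12\left(k\mathbb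 1+\begin{pmatrix}1-\mathrm{Re}\,q&\mathrm{Im}\,q\\\mathrm{Im}\,q&1+\mathrm{Re}\,q\end{pmatrix}\rho^{-1}\right)d\rho+o(\rho^{-1})\,d\rho+o(\rho^{-1})\,d\theta .$$ Theorem. (1) Let $\Sigma_0\subset\Sigma$ be open. For any holomorphic cubic form $\Xi$ and any smooth hyperbolic metric $\tilde g$ on $\Sigma_0$ there is a unique special Kähler structure $(g,\nabla)$ on $\Sigma_0\setminus\Xi^{-1}(0)$ whose associated hyperbolic metric and associated cubic form are $\tilde g$ and $\Xi$ respectively. In a local holomorphic coordinate with $\tilde g=e^{2v}|dz|^2$ and $\Xi=\Xi_0\,dz^3$ one has $g=4|\Xi_0|e^{-v}|dz|^2$. (2) Let $\Xi\not\equiv0$ be a meromorphic cubic form on $\Sigma$ with divisor $(\Xi)=\sum_p\operatorname{ord}_p\Xi\cdot p$, and let $\tilde g$ be a hyperbolic metric representing a divisor $D$. Then there is a unique special Kähler structure $(g,\nabla)$ on $\Sigma_0:=\Sigma\setminus(\operatorname{supp}(\Xi)\cup\operatorname{supp}D)$ with associated hyperbolic metric $\tilde g$ and associated cubic form $\Xi$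 on $\Sigma_0$; it is given by the formula in (1), and the following holds: (i) a cusp $p$ of $\tilde g$ is a logarithmic singularity of $(g,\nabla)$ of order $\frac12(\operatorname{ord}_p\Xi+1)$; (ii) a conical singularity $p$ of $\tilde g$ of order $\alpha$ is a conical singularity of $(g,\nabla)$ of order $\frac12(\operatorname{ord}_p\Xi-\alpha)$; (iii) $(g,\nabla)$ has a conical singularity of order $\frac12\operatorname{ord}_p\Xi$ at every point $p\in\operatorname{supp}(\Xi)\setminus\operatorname{supp}D$. -/

import Mathlib

open Filter Topology
open scoped Manifold ContDiff

noncomputable section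

namespace SpecialKahler

/-- A local holomorphic coordinate on the Riemann surface `X`: a chart of the maximal holomorphic
atlas. -/
abbrev HolChart (X : Type*) [TopologicalSpace X] [ChartedSpace ℂ X] :=
  {φ : OpenPartialHomeomorph X ℂ // φ ∈ IsManifold.maximalAtlas 𝓘(ℂ) ω X}

variable {X : Type*} [TopologicalSpace X] [ChartedSpace ℂ X]

/-- The preferred chart at `p`, as a local holomorphic coordinate. -/
def chartOf [IsManifold 𝓘(ℂ) ω X] (p : X) : HolChart X :=
  ⟨chartAt ℂ p, IsManifold.chart_mem_maximalAtlas p⟩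

/-- The part of the range of the coordinate `φ` that corresponds to the subset `U` of `X`. -/
def chartDomain (φ : HolChart X) (U : Set X) : Set ℂ :=
  φ.1.target ∩ φ.1.symm ⁻¹' U

/-- The change of coordinates from `φ` to `ψ`. -/
def transition (φ ψ : HolChart X) : ℂ → ℂ := fun z => ψ.1 (φ.1.symm z)

/-! ### Tensors in local coordinates

A tensor field (or a connection) on an open subset `U` of `X` is given by its coefficients in all
local holomorphic coordinates, subject to the transformation law on overlaps.  Values of the
coefficients at points that do not correspond to points of `U` are irrelevant. -/

/-- `Ξ`, with local expressions `Ξ φ dz ^ 3`, is a section of the cube of the canonical bundle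
over `U` (without any regularity). -/
def IsCubicFormOn (U : Set X) (Ξ : HolChart X → ℂ → ℂ) : Prop :=
  ∀ φ ψ : HolChart X, ∀ z ∈ chartDomain φ (U ∩ ψ.1.source),
    Ξ φ z = Ξ ψ (transition φ ψ z) * deriv (transition φ ψ) z ^ 3

/-- `Ξ` is a holomorphic cubic form on `U`. -/
structure IsHolomorphicCubicFormOn (U : Set X) (Ξ : HolChart X → ℂ → ℂ) : Prop where
  isCubicForm : IsCubicFormOn U Ξ
  holomorphic : ∀ φ : HolChart X, DifferentiableOn ℂ (Ξ φ) (chartDomain φ U)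

/-- `Ξ` is a meromorphic cubic form on the whole surface `X`.  The coefficients are in normal form:
they have the correct value at every regular point, and the value `0` at the poles. -/
structure IsMeromorphicCubicForm (Ξ : HolChart X → ℂ → ℂ) : Prop where
  isCubicForm : IsCubicFormOn Set.univ Ξ
  meromorphic : ∀ φ : HolChart X, MeromorphicNFOn (Ξ φ) φ.1.target

/-- The zero set of a cubic form. -/
def zeroSet [IsManifold 𝓘(ℂ) ω X] (Ξ : HolChart X → ℂ → ℂ) : Set X :=
  {p | Ξ (chartOf p) (chartAt ℂ p p) = 0}

/-- The order of a (not identically vanishing) meromorphic cubic form at `p`. -/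
def ord [IsManifold 𝓘(ℂ) ω X] (Ξ : HolChart X → ℂ → ℂ) (p : X) : ℤ :=
  (meromorphicOrderAt (Ξ (chartOf p)) (chartAt ℂ p p)).untop₀

/-- The support of the divisor of a meromorphic cubic form. -/
def divisorSupport [IsManifold 𝓘(ℂ) ω X] (Ξ : HolChart X → ℂ → ℂ) : Set X :=
  {p | ord Ξ p ≠ 0}

/-- `g`, with local expressions `g φ |dz| ^ 2`, is a smooth Riemannian metric on `U` for which the
complex structure is orthogonal.  In complex dimension one this is the same as a Kähler metric,
because every 2-form is closed. -/
structure IsConformalMetricOn (U : Set X) (g : HolChart X → ℂ → ℝ) : Prop where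
  smooth : ∀ φ : HolChart X, ContDiffOn ℝ ∞ (g φ) (chartDomain φ U)
  pos : ∀ φ : HolChart X, ∀ z ∈ chartDomain φ U, 0 < g φ z
  transform : ∀ φ ψ : HolChart X, ∀ z ∈ chartDomain φ (U ∩ ψ.1.source),
    g φ z = g ψ (transition φ ψ z) * ‖deriv (transition φ ψ) z‖ ^ 2

/-- The Gaussian curvature at `z` of the metric `lam |dz| ^ 2` on an open subset of `ℂ`. -/
def gaussCurvature (lam : ℂ → ℝ) (z : ℂ) : ℝ :=
  -(Laplacian.laplacian (fun w => Real.log (lam w)) z) / (2 * lam z)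

/-- `g` is a smooth hyperbolic metric (Gaussian curvature `-1`) on `U`. -/
structure IsHyperbolicMetricOn (U : Set X) (g : HolChart X → ℂ → ℝ) : Prop where
  isConformalMetric : IsConformalMetricOn U g
  curvature : ∀ φ : HolChart X, ∀ z ∈ chartDomain φ U, gaussCurvature (g φ) z = -1

/-- `Γ` is a smooth connection on the tangent bundle of `U`.  For the vector field `W` whose
coordinate expression in `φ` is the constant `w`, and for a tangent vector with coordinate
expression `v`, the coordinate expression of `∇_v W` at `z` is `Γ φ z v w`. -/
structure IsConnectionOn (U : Set X) (Γ : HolChart X → ℂ → (ℂ →L[ℝ] ℂ →L[ℝ] ℂ)) : Prop where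
  smooth : ∀ φ : HolChart X, ContDiffOn ℝ ∞ (Γ φ) (chartDomain φ U)
  transform : ∀ φ ψ : HolChart X, ∀ z ∈ chartDomain φ (U ∩ ψ.1.source), ∀ v w : ℂ,
    deriv (transition φ ψ) z * Γ φ z v w =
      Γ ψ (transition φ ψ z) (deriv (transition φ ψ) z * v) (deriv (transition φ ψ) z * w) +
        deriv (deriv (transition φ ψ)) z * v * w

/-- The Kähler form `ω(v, w) = g(I v, w)` of the metric `lam |dz| ^ 2`, where `lam` is the value of
the conformal factor at the point under consideration; that is, `lam dx ∧ dy`. -/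
def kahlerForm (lam : ℝ) (v w : ℂ) : ℝ := lam * (v.re * w.im - v.im * w.re)

/-- `(g, Γ)` is a special Kähler structure on `U` (with the complex structure of `X`): `g` is a
Kähler metric and `Γ` is a torsion-free flat symplectic connection on the tangent bundle such that
`(∇_v I) w = (∇_w I) v`. -/
structure IsSpecialKahlerOn (U : Set X) (g : HolChart X → ℂ → ℝ)
    (Γ : HolChart X → ℂ → (ℂ →L[ℝ] ℂ →L[ℝ] ℂ)) : Prop where
  isKahlerMetric : IsConformalMetricOn U g
  isConnection : IsConnectionOn U Γ
  torsion_free : ∀ φ : HolChart X, ∀ z ∈ chartDomain φ U, ∀ v w : ℂ, Γ φ z v w = Γ φ z w v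
  flat : ∀ φ : HolChart X, ∀ z ∈ chartDomain φ U, ∀ u v w : ℂ,
    fderiv ℝ (Γ φ) z u v w - fderiv ℝ (Γ φ) z v u w
      + Γ φ z u (Γ φ z v w) - Γ φ z v (Γ φ z u w) = 0
  symplectic : ∀ φ : HolChart X, ∀ z ∈ chartDomain φ U, ∀ u v w : ℂ,
    kahlerForm (fderiv ℝ (g φ) z u) v w =
      kahlerForm (g φ z) (Γ φ z u v) w + kahlerForm (g φ z) v (Γ φ z u w)
  special : ∀ φ : HolChart X, ∀ z ∈ chartDomain φ U, ∀ v w : ℂ,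
    Γ φ z v (Complex.I * w) - Complex.I * Γ φ z v w =
      Γ φ z w (Complex.I * v) - Complex.I * Γ φ z w v

/-! ### The associated cubic form and the associated hyperbolic metric -/

/-- The number `-ω(∂_z, ∇_{∂_z} ∂_z)`, where `∂_z = (∂_x - i ∂_y) / 2` and where `ω` and `∇` are
extended complex linearly to the complexified tangent space.  This is the coefficient of `dz ^ 3` in
`-ω(π, ∇ π)`, where `π` is the projection of the complexified tangent bundle onto its
`(1, 0)`-part. -/
def cubicCoeff (lam : ℝ) (G : ℂ →L[ℝ] ℂ →L[ℝ] ℂ) : ℂ :=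
  -(1 / 8) * ∑ a : Fin 2, ∑ b : Fin 2, ∑ c : Fin 2,
    (-Complex.I) ^ (a.val + b.val + c.val) *
      (kahlerForm lam (Complex.I ^ a.val) (G (Complex.I ^ b.val) (Complex.I ^ c.val)) : ℂ)

/-- `Ξ` is the cubic form associated with the special Kähler structure `(g, Γ)` on `U`. -/
def IsAssociatedCubicForm (U : Set X) (g : HolChart X → ℂ → ℝ)
    (Γ : HolChart X → ℂ → (ℂ →L[ℝ] ℂ →L[ℝ] ℂ)) (Ξ : HolChart X → ℂ → ℂ) : Prop :=
  ∀ φ : HolChart X, ∀ z ∈ chartDomain φ U, Ξ φ z = cubicCoeff (g φ z) (Γ φ z)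

/-- `(Z, W)` is a pair of conjugate special holomorphic coordinates, on the open subset `N` of `ℂ`,
for the metric `lam |dz| ^ 2` and the connection `G`: the real 1-forms `d Re Z` and `d Re W` are
parallel, and `(Re Z, -Re W)` are Darboux coordinates for the Kähler form. -/
structure IsConjugatePair (lam : ℂ → ℝ) (G : ℂ → (ℂ →L[ℝ] ℂ →L[ℝ] ℂ)) (N : Set ℂ)
    (Z W : ℂ → ℂ) : Prop where
  holomorphic_fst : DifferentiableOn ℂ Z N
  holomorphic_snd : DifferentiableOn ℂ W N
  parallel_fst : ∀ z ∈ N, ∀ u v : ℂ,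
    (deriv (deriv Z) z * u * v).re - (deriv Z z * G z u v).re = 0
  parallel_snd : ∀ z ∈ N, ∀ u v : ℂ,
    (deriv (deriv W) z * u * v).re - (deriv W z * G z u v).re = 0
  darboux : ∀ z ∈ N, ∀ u v : ℂ,
    kahlerForm (lam z) u v =
      -((deriv Z z * u).re * (deriv W z * v).re - (deriv Z z * v).re * (deriv W z * u).re)

/-- The period map `τ = dW / dZ` of a pair of conjugate special holomorphic coordinates. -/
def periodMap (Z W : ℂ → ℂ) : ℂ → ℂ := fun z => deriv W z / deriv Z z

/-- `gt` is the hyperbolic metric associated with the special Kähler structure `(g, Γ)` on `U`: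
near every point it is the pull-back, by a period map `τ`, of the metric `(Im τ) ^ (-2) |dτ| ^ 2` on
the upper half-plane. -/
def IsAssociatedHyperbolicMetric (U : Set X) (g : HolChart X → ℂ → ℝ)
    (Γ : HolChart X → ℂ → (ℂ →L[ℝ] ℂ →L[ℝ] ℂ)) (gt : HolChart X → ℂ → ℝ) : Prop :=
  ∀ φ : HolChart X, ∀ z₀ ∈ chartDomain φ U, ∃ N : Set ℂ, IsOpen N ∧ z₀ ∈ N ∧
    N ⊆ chartDomain φ U ∧ ∃ Z W : ℂ → ℂ, IsConjugatePair (g φ) (Γ φ) N Z W ∧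
      ∀ z ∈ N, 0 < (periodMap Z W z).im ∧
        gt φ z = ‖deriv (periodMap Z W) z‖ ^ 2 / (periodMap Z W z).im ^ 2

/-- `(g, Γ)` is a special Kähler structure on `U` whose associated hyperbolic metric is `gt` and
whose associated cubic form is `Ξ`. -/
structure IsSpecialKahlerWith (U : Set X) (gt : HolChart X → ℂ → ℝ) (Ξ : HolChart X → ℂ → ℂ)
    (g : HolChart X → ℂ → ℝ) (Γ : HolChart X → ℂ → (ℂ →L[ℝ] ℂ →L[ℝ] ℂ)) : Prop where
  isSpecialKahler : IsSpecialKahlerOn U g Γ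
  hyperbolicMetric : IsAssociatedHyperbolicMetric U g Γ gt
  cubicForm : IsAssociatedCubicForm U g Γ Ξ

/-- The pairs `(g, Γ)` and `(g', Γ')` are equal on `U`. -/
def AgreeOn (U : Set X) (g : HolChart X → ℂ → ℝ) (Γ : HolChart X → ℂ → (ℂ →L[ℝ] ℂ →L[ℝ] ℂ))
    (g' : HolChart X → ℂ → ℝ) (Γ' : HolChart X → ℂ → (ℂ →L[ℝ] ℂ →L[ℝ] ℂ)) : Prop :=
  ∀ φ : HolChart X, ∀ z ∈ chartDomain φ U, g φ z = g' φ z ∧ Γ φ z = Γ' φ z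

/-! ### Isolated singularities

All conditions are imposed in every local holomorphic coordinate around `p`, with
`r = ‖z - φ p‖`; they hold in one coordinate if and only if they hold in all of them. -/

/-- The hyperbolic metric `gt` has a conical singularity of order `α > -1` at `p`. -/
def HasConicalPoint (gt : HolChart X → ℂ → ℝ) (p : X) (α : ℝ) : Prop :=
  -1 < α ∧ ∀ φ : HolChart X, p ∈ φ.1.source → ∃ C : ℝ, 0 < C ∧
    Tendsto (fun z => gt φ z / ‖z - φ.1 p‖ ^ (2 * α)) (𝓝[≠] (φ.1 p)) (𝓝 C)

/-- The hyperbolic metric `gt` has a cusp singularity at `p`. -/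
def HasCusp (gt : HolChart X → ℂ → ℝ) (p : X) : Prop :=
  ∀ φ : HolChart X, p ∈ φ.1.source → ∃ C : ℝ, 0 < C ∧
    Tendsto (fun z => gt φ z * (‖z - φ.1 p‖ * Real.log ‖z - φ.1 p‖) ^ 2) (𝓝[≠] (φ.1 p)) (𝓝 C)

/-- `gt` is a hyperbolic metric on `X` that represents the divisor `D`: it is smooth outside of the
support of `D`, it has a cusp where `D` is `-1`, and a conical singularity of order `D p` at the
other points `p` of the support. -/
structure RepresentsDivisor (gt : HolChart X → ℂ → ℝ) (D : X →₀ ℝ) : Prop where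
  isHyperbolic : IsHyperbolicMetricOn {p | D p ≠ 0}ᶜ gt
  neg_one_le : ∀ p, -1 ≤ D p
  cusp : ∀ p, D p = -1 → HasCusp gt p
  conical : ∀ p, D p ≠ 0 → -1 < D p → HasConicalPoint gt p (D p)

/-- The connection 1-form with respect to the frame `(∂_x, ∂_y)`, evaluated at the tangent vector
`v`: the `j`-th column consists of the components of `∇_v ∂_j`. -/
def connectionForm (G : ℂ →L[ℝ] ℂ →L[ℝ] ℂ) (v : ℂ) : Matrix (Fin 2) (Fin 2) ℝ :=
  !![(G v 1).re, (G v Complex.I).re; (G v 1).im, (G v Complex.I).im]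

/-- The coefficient of `dρ`, `ρ = log r`, in the connection 1-form, in polar coordinates around
`c`: the value of the form at `r ∂_r`. -/
def radialPart (G : ℂ → (ℂ →L[ℝ] ℂ →L[ℝ] ℂ)) (c z : ℂ) : Matrix (Fin 2) (Fin 2) ℝ :=
  connectionForm (G z) (z - c)

/-- The coefficient of `dθ` in the connection 1-form, in polar coordinates around `c`: the value of
the form at `∂_θ`. -/
def angularPart (G : ℂ → (ℂ →L[ℝ] ℂ →L[ℝ] ℂ)) (c z : ℂ) : Matrix (Fin 2) (Fin 2) ℝ :=
  connectionForm (G z) (Complex.I * (z - c))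

/-- The rotation by a quarter turn. -/
def rotation : Matrix (Fin 2) (Fin 2) ℝ := !![0, -1; 1, 0]

/-- `(g, Γ)` has a conical singularity of order `s = β / 2` at `p`: it is asymptotic to the flat
cone with metric `r ^ β |dz| ^ 2` (up to a positive constant factor) and connection form
`(β / 2) (1 dρ + rotation dθ)`.  The error terms of the coefficients of `dρ` and `dθ` are `o(1)`. -/
def HasConicalSingularity (g : HolChart X → ℂ → ℝ) (Γ : HolChart X → ℂ → (ℂ →L[ℝ] ℂ →L[ℝ] ℂ))
    (p : X) (s : ℝ) : Prop :=
  ∀ φ : HolChart X, p ∈ φ.1.source →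
    (∃ C : ℝ, 0 < C ∧
      Tendsto (fun z => g φ z / ‖z - φ.1 p‖ ^ (2 * s)) (𝓝[≠] (φ.1 p)) (𝓝 C)) ∧
    Tendsto (fun z => radialPart (Γ φ) (φ.1 p) z) (𝓝[≠] (φ.1 p)) (𝓝 (s • 1)) ∧
    Tendsto (fun z => angularPart (Γ φ) (φ.1 p) z) (𝓝[≠] (φ.1 p)) (𝓝 (s • rotation))

/-- The number `(b / |b|) e ^ (i k θ)`, where `θ` is the argument of `ζ`. -/
def logPhase (k : ℤ) (b ζ : ℂ) : ℂ := (b / (‖b‖ : ℂ)) * (ζ / (‖ζ‖ : ℂ)) ^ k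

/-- The conformal factor `-|b| r ^ k log r` of the logarithmic model metric. -/
def logModelMetric (k : ℤ) (b ζ : ℂ) : ℝ := -‖b‖ * ‖ζ‖ ^ k * Real.log ‖ζ‖

/-- The coefficient of `dρ` in the connection form of the logarithmic model. -/
def logModelRadial (k : ℤ) (b ζ : ℂ) : Matrix (Fin 2) (Fin 2) ℝ :=
  (1 / 2 : ℝ) • ((k : ℝ) • (1 : Matrix (Fin 2) (Fin 2) ℝ) + (Real.log ‖ζ‖)⁻¹ •
    !![1 - (logPhase k b ζ).re, (logPhase k b ζ).im;
       (logPhase k b ζ).im, 1 + (logPhase k b ζ).re])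

/-- The coefficient of `dθ` in the connection form of the logarithmic model. -/
def logModelAngular (k : ℤ) (b ζ : ℂ) : Matrix (Fin 2) (Fin 2) ℝ :=
  (1 / 2 : ℝ) • ((k : ℝ) • rotation + (Real.log ‖ζ‖)⁻¹ •
    !![(logPhase k b ζ).im, -1 + (logPhase k b ζ).re;
       1 + (logPhase k b ζ).re, -(logPhase k b ζ).im])

/-- `(g, Γ)` has a logarithmic singularity of order `s = k / 2`, `k ∈ ℤ`, at `p`: in every local
coordinate it is asymptotic to the logarithmic model with exponent `k` for some `b ≠ 0`.  The error
terms of the coefficients of `dρ` and `dθ` are `o(1 / |log r|)`. -/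
def HasLogSingularity (g : HolChart X → ℂ → ℝ) (Γ : HolChart X → ℂ → (ℂ →L[ℝ] ℂ →L[ℝ] ℂ))
    (p : X) (s : ℝ) : Prop :=
  ∃ k : ℤ, s = (k : ℝ) / 2 ∧ ∀ φ : HolChart X, p ∈ φ.1.source → ∃ b : ℂ, b ≠ 0 ∧
    Tendsto (fun z => g φ z / logModelMetric k b (z - φ.1 p)) (𝓝[≠] (φ.1 p)) (𝓝 1) ∧
    Tendsto (fun z => Real.log ‖z - φ.1 p‖ •
      (radialPart (Γ φ) (φ.1 p) z - logModelRadial k b (z - φ.1 p))) (𝓝[≠] (φ.1 p)) (𝓝 0) ∧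
    Tendsto (fun z => Real.log ‖z - φ.1 p‖ •
      (angularPart (Γ φ) (φ.1 p) z - logModelAngular k b (z - φ.1 p))) (𝓝[≠] (φ.1 p)) (𝓝 0)

end SpecialKahler

end

noncomputable section

namespace SpecialKahler

open scoped ComplexConjugate
open Complex (I)

/-! ### Wirtinger calculus -/

/-! In a holomorphic coordinate write `g = λ|dz|²` and `g̃ = h|dz|²`. Vanishing torsion together
with the condition on `∇I` leaves exactly the connections `∇_v w = a v w + d v̄ w̄` on constant
fields (`exists_eq_bilin`). For these, `∇ω = 0` says `a = ∂ log λ`, and the associated cubic form is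
`Ξ = -(i/2) λ d̄`, so `g` and `Ξ` determine `∇`.

Uniqueness: if `Z`, `W` are conjugate special coordinates and `p = Z'`, parallelism and the Darboux
condition give `Im τ = λ/|p|²` and `p² τ' = 4Ξ`. Hence the associated hyperbolic metric is `4|d|² =
16|Ξ|²/λ²`, which forces `λ = 4|Ξ| h^(-1/2)` (`IsConjugatePair.factor_eq`).

Existence: define `λ`, `a`, `d` by these formulas. Flatness amounts to `∂d = -a d`, true because
`λd` is antiholomorphic, and `∂̄a = -|d|² = -h/4`, which is the curvature equation of `h` because
`log|Ξ|` is harmonic. To see that `h` is the associated hyperbolic metric, Liouville's theorem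
(`exists_developing_map`) supplies a local `τ` with `h = |τ'|²/(Im τ)²`; with `p` a square root of
`4Ξ/τ'`, primitives of `p` and `τp` are conjugate special coordinates. All formulas transform
correctly under changes of coordinate, so the structure is global.

Singularities: with `L = log h` one has `a = Ξ'/(2Ξ) - ∂L/2` and `|d| = √h/2`. What is missing is
the gradient of `L` at a cusp or cone, of which only the leading size is given. In the coordinate `s
= log(z - c)` the puncture becomes a left half plane; after subtraction of the model the remainder
`u` converges and `Δu` is small by Liouville's equation, so an interior gradient estimate obtained
from the maximum principle makes `∂u` small (`tendsto_mul_dz_of_conical`, `tendsto_mul_dz_of_cusp`).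
At a cusp the same principle also forces the constant `C` to be 1, without which the logarithmic
model would have the wrong coefficients. -/

/-- The real-linear map `v ↦ a v + b v̄`. -/
def wirtingerMap (a b : ℂ) : ℂ →L[ℝ] ℂ :=
  a • ContinuousLinearMap.id ℝ ℂ + b • (Complex.conjCLE : ℂ →L[ℝ] ℂ)

@[simp] theorem wirtingerMap_apply (a b v : ℂ) : wirtingerMap a b v = a * v + b * conj v := by
  simp [wirtingerMap]

theorem wirtingerMap_injective {a b a' b' : ℂ} (h : wirtingerMap a b = wirtingerMap a' b') :
    a = a' ∧ b = b' := by
  have h1 := congrArg (fun T => T 1) h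
  have h2 := congrArg (fun T => T I) h
  simp only [wirtingerMap_apply, map_one, mul_one, Complex.conj_I] at h1 h2
  have h3 : a - b = a' - b' := by
    have := congrArg (fun t => -I * t) h2
    linear_combination this + ((a - b) - (a' - b')) * Complex.I_mul_I
  constructor
  · linear_combination (h1 + h3) / 2
  · linear_combination (h1 - h3) / 2

/-- `f` is real differentiable at `z` with Wirtinger derivatives `a = ∂f` and `b = ∂̄f`. -/
def HasWirtingerAt (f : ℂ → ℂ) (a b z : ℂ) : Prop := HasFDerivAt f (wirtingerMap a b) z

theorem _root_.HasFDerivAt.hasWirtingerAt {f : ℂ → ℂ} {T : ℂ →L[ℝ] ℂ} {a b z : ℂ}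
    (h : HasFDerivAt f T z) (hT : ∀ v, T v = a * v + b * conj v) : HasWirtingerAt f a b z := by
  have : T = wirtingerMap a b := ContinuousLinearMap.ext fun v => by simp [hT]
  rw [HasWirtingerAt, ← this]
  exact h

/-- The Wirtinger derivative `∂f`. -/
def dz (f : ℂ → ℂ) (z : ℂ) : ℂ := (fderiv ℝ f z 1 - I * fderiv ℝ f z I) / 2

/-- The Wirtinger derivative `∂̄f`. -/
def dzbar (f : ℂ → ℂ) (z : ℂ) : ℂ := (fderiv ℝ f z 1 + I * fderiv ℝ f z I) / 2

theorem realLinear_eq_wirtingerMap (T : ℂ →L[ℝ] ℂ) :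
    T = wirtingerMap ((T 1 - I * T I) / 2) ((T 1 + I * T I) / 2) := by
  refine ContinuousLinearMap.ext fun v => ?_
  have hv : v = v.re • (1 : ℂ) + v.im • I := by
    simp [Complex.re_add_im]
  have hc : conj v = (v.re : ℂ) - v.im * I := by
    apply Complex.ext <;> simp
  have hv' : v = (v.re : ℂ) + v.im * I := (Complex.re_add_im v).symm
  have h1 : T v = v.re * T 1 + v.im * T I := by
    conv_lhs => rw [hv]
    rw [map_add, map_smul, map_smul, Complex.real_smul, Complex.real_smul]
  rw [h1, wirtingerMap_apply, hc]
  conv_rhs => rw [hv']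
  simp only [Complex.add_re, Complex.ofReal_re, Complex.mul_re, Complex.I_re, mul_zero,
    Complex.ofReal_im, Complex.I_im, mul_one, sub_self, add_zero, Complex.add_im, Complex.mul_im,
    zero_add]
  linear_combination (v.im * T I) * Complex.I_mul_I

theorem HasWirtingerAt.of_fderiv {f : ℂ → ℂ} {z : ℂ} (h : DifferentiableAt ℝ f z) :
    HasWirtingerAt f (dz f z) (dzbar f z) z := by
  have := h.hasFDerivAt
  rw [realLinear_eq_wirtingerMap (fderiv ℝ f z)] at this
  exact this

namespace HasWirtingerAt

variable {f g : ℂ → ℂ} {a b a' b' z : ℂ}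

theorem differentiableAt (h : HasWirtingerAt f a b z) : DifferentiableAt ℝ f z :=
  HasFDerivAt.differentiableAt h

theorem unique (h : HasWirtingerAt f a b z) (h' : HasWirtingerAt f a' b' z) :
    a = a' ∧ b = b' :=
  wirtingerMap_injective (HasFDerivAt.unique h h')

theorem dz_eq (h : HasWirtingerAt f a b z) : dz f z = a :=
  ((of_fderiv h.differentiableAt).unique h).1

theorem dzbar_eq (h : HasWirtingerAt f a b z) : dzbar f z = b :=
  ((of_fderiv h.differentiableAt).unique h).2

theorem congr_deriv (h : HasWirtingerAt f a b z) (ha : a = a') (hb : b = b') :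
    HasWirtingerAt f a' b' z := ha ▸ hb ▸ h

theorem congr_of_eventuallyEq (h : HasWirtingerAt f a b z) (hg : g =ᶠ[𝓝 z] f) :
    HasWirtingerAt g a b z := HasFDerivAt.congr_of_eventuallyEq h hg

theorem const (c z : ℂ) : HasWirtingerAt (fun _ => c) 0 0 z := by
  have := hasFDerivAt_const (𝕜 := ℝ) c z
  exact this.hasWirtingerAt fun v => by simp

theorem add (h : HasWirtingerAt f a b z) (h' : HasWirtingerAt g a' b' z) :
    HasWirtingerAt (fun w => f w + g w) (a + a') (b + b') z := by
  have := HasFDerivAt.fun_add h h'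
  exact this.hasWirtingerAt fun v => by simp; ring

theorem neg (h : HasWirtingerAt f a b z) : HasWirtingerAt (fun w => -f w) (-a) (-b) z := by
  have := HasFDerivAt.fun_neg h
  exact this.hasWirtingerAt fun v => by simp; ring

theorem sub (h : HasWirtingerAt f a b z) (h' : HasWirtingerAt g a' b' z) :
    HasWirtingerAt (fun w => f w - g w) (a - a') (b - b') z := by
  have := HasFDerivAt.fun_sub h h'
  exact this.hasWirtingerAt fun v => by simp; ring

theorem mul (h : HasWirtingerAt f a b z) (h' : HasWirtingerAt g a' b' z) :
    HasWirtingerAt (fun w => f w * g w) (a * g z + f z * a') (b * g z + f z * b') z := by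
  have := HasFDerivAt.mul h h'
  exact this.hasWirtingerAt fun v => by simp; ring

theorem const_mul (c : ℂ) (h : HasWirtingerAt f a b z) :
    HasWirtingerAt (fun w => c * f w) (c * a) (c * b) z :=
  ((const c z).mul h).congr_deriv (by ring) (by ring)

theorem star (h : HasWirtingerAt f a b z) :
    HasWirtingerAt (fun w => conj (f w)) (conj b) (conj a) z := by
  have := (Complex.conjCLE : ℂ →L[ℝ] ℂ).hasFDerivAt.comp z h
  exact this.hasWirtingerAt fun v => by simp; ring

theorem comp_hasDerivAt {F : ℂ → ℂ} {F' : ℂ} (hF : HasDerivAt F F' (f z))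
    (h : HasWirtingerAt f a b z) : HasWirtingerAt (fun w => F (f w)) (F' * a) (F' * b) z := by
  have h0 : HasFDerivAt F _ (f z) := hF.complexToReal_fderiv
  have := h0.comp z h
  exact this.hasWirtingerAt fun v => by simp; ring

theorem inv (h : HasWirtingerAt f a b z) (h0 : f z ≠ 0) :
    HasWirtingerAt (fun w => (f w)⁻¹) (-a / f z ^ 2) (-b / f z ^ 2) z :=
  (comp_hasDerivAt (hasDerivAt_inv h0) h).congr_deriv (by ring) (by ring)

theorem comp_holomorphic {F : ℂ → ℂ} {F' : ℂ} (h : HasWirtingerAt f a b (F z))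
    (hF : HasDerivAt F F' z) :
    HasWirtingerAt (fun w => f (F w)) (a * F') (b * starRingEnd ℂ F') z := by
  have h0 : HasFDerivAt F _ z := hF.complexToReal_fderiv
  have := HasFDerivAt.comp z h h0
  exact this.hasWirtingerAt fun v => by simp; ring

theorem of_hasDerivAt {F : ℂ → ℂ} {F' : ℂ} (hF : HasDerivAt F F' z) : HasWirtingerAt F F' 0 z := by
  have h0 : HasFDerivAt F _ z := hF.complexToReal_fderiv
  exact h0.hasWirtingerAt fun v => by simp

theorem hasDerivAt (h : HasWirtingerAt f a 0 z) : HasDerivAt f a z := by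
  rw [hasDerivAt_iff_hasFDerivAt]
  refine hasFDerivAt_of_restrictScalars ℝ h (ContinuousLinearMap.ext fun v => ?_)
  simp [mul_comm]

end HasWirtingerAt

/-- Conjugation exchanges the two Wirtinger derivatives, and a real function is its own conjugate;
so `∂̄f` never needs a separate computation for real `f`. -/
theorem conj_dz_of_real {f : ℂ → ℂ} {a b z : ℂ} (hf : ∀ᶠ w in 𝓝 z, conj (f w) = f w)
    (h : HasWirtingerAt f a b z) : b = conj a :=
  (h.unique (h.star.congr_of_eventuallyEq (hf.mono fun _ h => h.symm))).2

theorem _root_.ContDiffOn.dz {f : ℂ → ℂ} {U : Set ℂ} (hU : IsOpen U) (hf : ContDiffOn ℝ ∞ f U) :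
    ContDiffOn ℝ ∞ (dz f) U := by
  have h : ContDiffOn ℝ ∞ (fderiv ℝ f) U := hf.fderiv_of_isOpen hU (by simp)
  have h1 := h.clm_apply (contDiffOn_const (c := (1 : ℂ)))
  have h2 := h.clm_apply (contDiffOn_const (c := I))
  exact (h1.sub (contDiffOn_const.mul h2)).div_const 2

theorem fderiv_fderiv_apply {F : Type*} [NormedAddCommGroup F] [NormedSpace ℝ F]
    {f : ℂ → F} {z : ℂ} (hf : ContDiffAt ℝ 2 f z) (v : ℂ) :
    HasFDerivAt (fun y => fderiv ℝ f y v) ((fderiv ℝ (fderiv ℝ f) z).flip v) z := by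
  have h : DifferentiableAt ℝ (fderiv ℝ f) z :=
    (hf.fderiv_right (m := 1) (by norm_num)).differentiableAt one_ne_zero
  have := h.hasFDerivAt.clm_apply (hasFDerivAt_const v z)
  simpa using this

/-- Symmetry of the second derivative. The commutation is also what yields the reality condition in
Liouville's theorem. -/
theorem dz_dzbar_comm {f : ℂ → ℂ} {z : ℂ} (hf : ContDiffAt ℝ 2 f z) :
    dz (dzbar f) z = dzbar (dz f) z ∧
    dzbar (dz f) z = (fderiv ℝ (fderiv ℝ f) z 1 1 + fderiv ℝ (fderiv ℝ f) z I I) / 4 := by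
  have h1 := fderiv_fderiv_apply hf 1
  have h2 := fderiv_fderiv_apply hf I
  have hs : fderiv ℝ (fderiv ℝ f) z 1 I = fderiv ℝ (fderiv ℝ f) z I 1 :=
    (hf.isSymmSndFDerivAt (by simp)).eq 1 I
  have e1 : HasFDerivAt (dz f) _ z := (h1.sub (h2.const_mul I)).mul_const (2⁻¹ : ℂ)
  have e2 : HasFDerivAt (dzbar f) _ z := (h1.add (h2.const_mul I)).mul_const (2⁻¹ : ℂ)
  have hI := Complex.I_mul_I
  constructor
  · simp only [dz, dzbar, e1.fderiv, e2.fderiv]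
    simp [hs]; ring
  · rw [dzbar, e1.fderiv]
    simp [hs]; ring_nf; simp; ring

theorem laplacian_eq_dzbar_dz {f : ℂ → ℝ} {z : ℂ} (hf : ContDiffAt ℝ 2 f z) :
    ((Laplacian.laplacian f z : ℝ) : ℂ) = 4 * dzbar (dz (fun w => (f w : ℂ))) z := by
  have h : ((Laplacian.laplacian f z : ℝ) : ℂ) = Laplacian.laplacian (fun w => (f w : ℂ)) z :=
    (hf.laplacian_CLM_comp_left (l := Complex.ofRealCLM)).symm
  have hf' : ContDiffAt ℝ 2 (fun w => (f w : ℂ)) z :=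
    Complex.ofRealCLM.contDiff.contDiffAt.comp z hf
  rw [h, (dz_dzbar_comm hf').2, InnerProductSpace.laplacian_eq_iteratedFDeriv_complexPlane]
  simp [iteratedFDeriv_two_apply]
  ring

/-! ### A holomorphic linear differential equation -/

theorem norm_le_of_hasDerivAt_ball {F f : ℂ → ℂ} {z₀ : ℂ} {r C : ℝ}
    (hF : ∀ z ∈ Metric.ball z₀ r, HasDerivAt F (f z) z) (h0 : F z₀ = 0)
    (hC : ∀ z ∈ Metric.ball z₀ r, ‖f z‖ ≤ C) {z : ℂ} (hz : z ∈ Metric.ball z₀ r) :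
    ‖F z‖ ≤ C * r := by
  have hr : 0 < r := Metric.pos_of_mem_ball hz
  have hz₀ : z₀ ∈ Metric.ball z₀ r := Metric.mem_ball_self hr
  have := (convex_ball z₀ r).norm_image_sub_le_of_norm_hasDerivWithin_le
    (fun x hx => (hF x hx).hasDerivWithinAt) hC hz₀ hz
  rw [h0, sub_zero] at this
  have hC0 : 0 ≤ C := (norm_nonneg _).trans (hC z₀ hz₀)
  exact this.trans (mul_le_mul_of_nonneg_left (by simpa [dist_eq_norm] using
    (Metric.mem_ball.1 hz).le) hC0)

/-- Picard iteration for `y'' + q y = 0`, written as a series: each term is a double primitive of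
`-q` times the preceding one. Two integrations over a ball of radius `r` cost a factor `M r² ≤ 1/2`,
so the series and its first two derivatives are dominated by geometric ones. -/
theorem exists_second_order_holomorphic_solution {q : ℂ → ℂ} {z₀ : ℂ} {r M : ℝ} (hr : 0 < r)
    (hq : DifferentiableOn ℂ q (Metric.ball z₀ r)) (hM : ∀ z ∈ Metric.ball z₀ r, ‖q z‖ ≤ M)
    (hMr : M * r * r ≤ 1 / 2) (s : ℂ) :
    ∃ y y' : ℂ → ℂ, y z₀ = 1 ∧ y' z₀ = s ∧ (∀ z ∈ Metric.ball z₀ r, HasDerivAt y (y' z) z) ∧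
      ∀ z ∈ Metric.ball z₀ r, HasDerivAt y' (-(q z * y z)) z := by
  set B := Metric.ball z₀ r with hB
  have hBo : IsOpen B := Metric.isOpen_ball
  have hz₀ : z₀ ∈ B := Metric.mem_ball_self hr
  have hM0 : 0 ≤ M := (norm_nonneg _).trans (hM z₀ hz₀)
  -- The holomorphy of `f` is placed inside the existential so that the choice of primitives gives
  -- operators defined on all functions, which can be iterated before holomorphy of the iterates is
  -- known.
  have step : ∀ f : ℂ → ℂ, ∃ w g : ℂ → ℂ, DifferentiableOn ℂ f B →
      w z₀ = 0 ∧ g z₀ = 0 ∧ (∀ z ∈ B, HasDerivAt w (-(q z * f z)) z) ∧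
        (∀ z ∈ B, HasDerivAt g (w z) z) := by
    intro f
    by_cases hf : DifferentiableOn ℂ f B
    · obtain ⟨w, hw0, hw⟩ := ((hq.mul hf).neg.isExactOn_ball).with_val_at z₀ 0
      have hwd : DifferentiableOn ℂ w B := fun z hz =>
        (hw z hz).differentiableAt.differentiableWithinAt
      obtain ⟨g, hg0, hg⟩ := (hwd.isExactOn_ball).with_val_at z₀ 0
      exact ⟨w, g, fun _ => ⟨hw0, hg0, hw, hg⟩⟩
    · exact ⟨0, 0, fun h => absurd h hf⟩
  choose w g hwg using step
  -- These are the terms of the series, not its partial sums. The term of index 0 carries the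
  -- initial data; all later terms vanish at `z₀` together with their derivatives.
  let u : ℕ → ℂ → ℂ := fun n => Nat.rec (fun z => 1 + s * (z - z₀)) (fun _ f => g f) n
  let u' : ℕ → ℂ → ℂ := fun n => Nat.casesOn n (fun _ => s) (fun k => w (u k))
  let u'' : ℕ → ℂ → ℂ := fun n => Nat.casesOn n (fun _ => 0) (fun k z => -(q z * u k z))
  have hu0 : ∀ z, HasDerivAt (u 0) s z := fun z => by
    change HasDerivAt (fun z => 1 + s * (z - z₀)) s z
    simpa using (((hasDerivAt_id z).sub_const z₀).const_mul s).const_add 1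
  have hud : ∀ n, DifferentiableOn ℂ (u n) B := by
    intro n
    induction n with
    | zero => exact fun z _ => (hu0 z).differentiableAt.differentiableWithinAt
    | succ k ih => exact fun z hz =>
        ((hwg (u k) ih).2.2.2 z hz).differentiableAt.differentiableWithinAt
  have hu : ∀ n, ∀ z ∈ B, HasDerivAt (u n) (u' n z) z := by
    rintro (_ | k) z hz
    · exact hu0 z
    · exact (hwg (u k) (hud k)).2.2.2 z hz
  have hu' : ∀ n, ∀ z ∈ B, HasDerivAt (u' n) (u'' n z) z := by
    rintro (_ | k) z hz
    · exact hasDerivAt_const z s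
    · exact (hwg (u k) (hud k)).2.2.1 z hz
  set K : ℝ := 1 + ‖s‖ * r with hK
  have hK0 : 0 ≤ K := by positivity
  have bu : ∀ n, ∀ z ∈ B, ‖u n z‖ ≤ K * (1 / 2) ^ n := by
    intro n
    induction n with
    | zero =>
      intro z hz
      have h1 : ‖z - z₀‖ ≤ r := by simpa [dist_eq_norm] using (Metric.mem_ball.1 hz).le
      calc ‖1 + s * (z - z₀)‖ ≤ ‖(1 : ℂ)‖ + ‖s * (z - z₀)‖ := norm_add_le _ _
        _ ≤ K * (1 / 2) ^ 0 := by
          rw [norm_mul, norm_one, pow_zero, mul_one, hK]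
          gcongr
    | succ k ih =>
      intro z hz
      obtain ⟨h1, h2, h3, h4⟩ := hwg (u k) (hud k)
      have e1 : ∀ z ∈ B, ‖w (u k) z‖ ≤ M * (K * (1 / 2) ^ k) * r := fun z hz =>
        norm_le_of_hasDerivAt_ball h3 h1 (fun z hz => by
          rw [norm_neg, norm_mul]
          exact mul_le_mul (hM z hz) (ih z hz) (norm_nonneg _) hM0) hz
      have e2 := norm_le_of_hasDerivAt_ball h4 h2 e1 hz
      calc ‖u (k + 1) z‖ ≤ M * (K * (1 / 2) ^ k) * r * r := e2
        _ = (M * r * r) * (K * (1 / 2) ^ k) := by ring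
        _ ≤ 1 / 2 * (K * (1 / 2) ^ k) := by gcongr
        _ = K * (1 / 2) ^ (k + 1) := by ring
  -- The factor 2 pays for the index shift: the second derivative of term `k + 1` is controlled by
  -- term `k`.
  have bu'' : ∀ n, ∀ z ∈ B, ‖u'' n z‖ ≤ (2 * M * K) * (1 / 2) ^ n := by
    rintro (_ | k) z hz
    · change ‖(0 : ℂ)‖ ≤ _
      rw [norm_zero]
      positivity
    · calc ‖u'' (k + 1) z‖ = ‖q z‖ * ‖u k z‖ := by simp [u'']
        _ ≤ M * (K * (1 / 2) ^ k) := mul_le_mul (hM z hz) (bu k z hz) (norm_nonneg _) hM0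
        _ = (2 * M * K) * (1 / 2) ^ (k + 1) := by ring
  have bu' : ∀ n, ∀ z ∈ B, ‖u' n z‖ ≤ (‖s‖ + 2 * M * K * r) * (1 / 2) ^ n := by
    rintro (_ | k) z hz
    · change ‖s‖ ≤ _
      rw [pow_zero, mul_one]
      have : 0 ≤ 2 * M * K * r := by positivity
      linarith
    · have e := norm_le_of_hasDerivAt_ball (hu' (k + 1)) (hwg (u k) (hud k)).1 (bu'' (k + 1)) hz
      refine e.trans ?_
      have : 0 ≤ ‖s‖ * (1 / 2 : ℝ) ^ (k + 1) := by positivity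
      nlinarith
  have hgeo : Summable fun n : ℕ => ((1 : ℝ) / 2) ^ n := summable_geometric_two
  have hconn : IsPreconnected B := (convex_ball z₀ r).isPreconnected
  have hu00 : ∀ n, n ≠ 0 → u n z₀ = 0 := by
    rintro (_ | k) hk
    · exact absurd rfl hk
    · exact (hwg (u k) (hud k)).2.1
  have hu'00 : ∀ n, n ≠ 0 → u' n z₀ = 0 := by
    rintro (_ | k) hk
    · exact absurd rfl hk
    · exact (hwg (u k) (hud k)).1
  refine ⟨fun z => ∑' n, u n z, fun z => ∑' n, u' n z, ?_, ?_, ?_, ?_⟩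
  · change ∑' n, u n z₀ = 1
    rw [tsum_eq_single 0 hu00]; simp [u]
  · change ∑' n, u' n z₀ = s
    rw [tsum_eq_single 0 hu'00]
    rfl
  · intro z hz
    exact hasDerivAt_tsum_of_isPreconnected (hgeo.mul_left _) hBo hconn hu bu' hz₀
      (Summable.of_norm_bounded (hgeo.mul_left K) fun n => bu n z₀ hz₀) hz
  · intro z hz
    have h := hasDerivAt_tsum_of_isPreconnected (hgeo.mul_left _) hBo hconn hu' bu'' hz₀
      (Summable.of_norm_bounded (hgeo.mul_left _) fun n => bu' n z₀ hz₀) hz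
    have hs : Summable fun n => u'' n z :=
      Summable.of_norm_bounded (hgeo.mul_left _) fun n => bu'' n z hz
    have e : ∑' n, u'' n z = -(q z * ∑' n, u n z) := by
      rw [hs.tsum_eq_zero_add, ← tsum_mul_left, ← tsum_neg]
      simp [u'']
    rwa [e] at h

/-! ### Liouville's theorem: developing maps of hyperbolic metrics -/

/-- Holomorphy gives `∂̄f = 0`, and for real `f` this is the conjugate of `∂f`. -/
theorem _root_.HasDerivAt.eq_zero_of_real {f : ℂ → ℂ} {f' z : ℂ} (h : HasDerivAt f f' z)
    (hf : ∀ᶠ w in 𝓝 z, conj (f w) = f w) : f' = 0 := by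
  simpa using (conj_dz_of_real hf (.of_hasDerivAt h)).symm

theorem hasWirtingerAt_ofReal {f : ℂ → ℝ} {z : ℂ} (h : DifferentiableAt ℝ f z) :
    HasWirtingerAt (fun w => (f w : ℂ)) (dz (fun w => (f w : ℂ)) z)
      (conj (dz (fun w => (f w : ℂ)) z)) z := by
  have h1 : DifferentiableAt ℝ (fun w => (f w : ℂ)) z :=
    Complex.ofRealCLM.differentiableAt.comp z h
  have h2 := HasWirtingerAt.of_fderiv h1
  exact h2.congr_deriv rfl (conj_dz_of_real (.of_forall fun w => Complex.conj_ofReal _) h2)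

theorem HasWirtingerAt.eqOn_ball_of_zero {f : ℂ → ℂ} {z₀ : ℂ} {r : ℝ}
    (h : ∀ z ∈ Metric.ball z₀ r, HasWirtingerAt f 0 0 z) {z : ℂ} (hz : z ∈ Metric.ball z₀ r) :
    f z = f z₀ := by
  have h0 : wirtingerMap 0 0 = 0 := ContinuousLinearMap.ext fun v => by simp
  refine (convex_ball z₀ r).is_const_of_fderivWithin_eq_zero (𝕜 := ℝ)
    (fun w hw => (h w hw).differentiableAt.differentiableWithinAt) (fun w hw => ?_) hz
    (Metric.mem_ball_self (Metric.pos_of_mem_ball hz))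
  rw [fderivWithin_of_isOpen Metric.isOpen_ball hw, HasFDerivAt.fderiv (h w hw), h0]

section Liouville

variable {L : ℂ → ℝ} {U : Set ℂ}

theorem dzbar_dz_of_liouville (hU : IsOpen U) (hL : ContDiffOn ℝ ∞ L U)
    (hΔ : ∀ z ∈ U, Laplacian.laplacian L z = 2 * Real.exp (L z)) {z : ℂ} (hz : z ∈ U) :
    dzbar (dz fun w => (L w : ℂ)) z = Complex.exp (L z) / 2 := by
  have h := laplacian_eq_dzbar_dz ((hL.contDiffAt (hU.mem_nhds hz)).of_le (by norm_cast))
  rw [hΔ z hz] at h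
  push_cast at h
  linear_combination -h / 4

/-- The Schwarzian derivative of the metric `e ^ L |dz| ^ 2` (up to a factor). -/
def metricSchwarzian (L : ℂ → ℝ) (z : ℂ) : ℂ :=
  dz (dz fun w => (L w : ℂ)) z / 2 - (dz (fun w => (L w : ℂ)) z) ^ 2 / 4

theorem contDiffOn_ofReal (hL : ContDiffOn ℝ ∞ L U) : ContDiffOn ℝ ∞ (fun w => (L w : ℂ)) U :=
  Complex.ofRealCLM.contDiff.comp_contDiffOn hL

/-- With `l = ∂L`, Liouville's equation reads `∂̄l = e^L/2`. Hence `∂̄(∂l)/2 = ∂(e^L/2)/2 = e^L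
l/4`, which cancels `∂̄(l²/4)`. -/
theorem differentiableOn_metricSchwarzian (hU : IsOpen U) (hL : ContDiffOn ℝ ∞ L U)
    (hΔ : ∀ z ∈ U, Laplacian.laplacian L z = 2 * Real.exp (L z)) :
    DifferentiableOn ℂ (metricSchwarzian L) U := by
  intro z hz
  have hLc := contDiffOn_ofReal hL
  have hl := hLc.dz hU
  have hll := hl.dz hU
  have dat : ∀ {f : ℂ → ℂ}, ContDiffOn ℝ ∞ f U → DifferentiableAt ℝ f z := fun h =>
    (h.contDiffAt (hU.mem_nhds hz)).differentiableAt (by simp)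
  have w0 := hasWirtingerAt_ofReal
    ((hL.contDiffAt (hU.mem_nhds hz)).differentiableAt (by simp))
  have w1 := HasWirtingerAt.of_fderiv (dat hl)
  have w2 := HasWirtingerAt.of_fderiv (dat hll)
  have e1 := dzbar_dz_of_liouville hU hL hΔ hz
  have e2 : dzbar (dz (dz fun w => (L w : ℂ))) z
      = Complex.exp (L z) * dz (fun w => (L w : ℂ)) z / 2 := by
    rw [← (dz_dzbar_comm ((hl.contDiffAt (hU.mem_nhds hz)).of_le (by norm_cast))).1]
    have h := (HasWirtingerAt.comp_hasDerivAt (Complex.hasDerivAt_exp _) w0).const_mul (1 / 2)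
    have h' : dzbar (dz fun w => (L w : ℂ)) =ᶠ[𝓝 z] fun w => 1 / 2 * Complex.exp (L w) := by
      filter_upwards [hU.mem_nhds hz] with w hw
      rw [dzbar_dz_of_liouville hU hL hΔ hw]; ring
    rw [(h.congr_of_eventuallyEq h').dz_eq]; ring
  have key : HasWirtingerAt (fun z => 1 / 2 * dz (dz fun w => (L w : ℂ)) z
      + (-1 / 4) * (dz (fun w => (L w : ℂ)) z * dz (fun w => (L w : ℂ)) z)) _ _ z :=
    (w2.const_mul (1 / 2)).add ((w1.mul w1).const_mul (-1 / 4))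
  have key' := key.congr_deriv rfl (b' := 0) (by rw [e1, e2]; ring)
  refine (key'.hasDerivAt.congr_of_eventuallyEq (.of_forall fun w => ?_)).differentiableAt.differentiableWithinAt
  simp only [metricSchwarzian]; ring

end Liouville

section Liouville

variable {L : ℂ → ℝ}

/-- A smooth solution of Liouville's equation near `z₀` has the form
`e ^ (-L / 2) = |y| ^ 2 m (1 - |F / 2 m| ^ 2)` with `y`, `F` holomorphic and `F' = y ^ (-2)`. -/
theorem exists_liouville_representation {z₀ : ℂ} {R : ℝ} (hR : 0 < R)
    (hL : ContDiffOn ℝ ∞ L (Metric.ball z₀ R))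
    (hΔ : ∀ z ∈ Metric.ball z₀ R, Laplacian.laplacian L z = 2 * Real.exp (L z)) :
    ∃ r, 0 < r ∧ r ≤ R ∧ ∃ y F : ℂ → ℂ, ∀ z ∈ Metric.ball z₀ r, y z ≠ 0 ∧
      HasDerivAt F ((y z ^ 2)⁻¹) z ∧
      (Real.exp (-L z / 2) : ℂ) / (y z * conj (y z)) =
        Real.exp (-L z₀ / 2) - F z * conj (F z) / (4 * Real.exp (-L z₀ / 2)) := by
  have hBo : IsOpen (Metric.ball z₀ R) := Metric.isOpen_ball
  have hz₀R : z₀ ∈ Metric.ball z₀ R := Metric.mem_ball_self hR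
  set q := metricSchwarzian L with hqdef
  have hq := differentiableOn_metricSchwarzian hBo hL hΔ
  rw [← hqdef] at hq
  have hqc : ContinuousAt q z₀ := (hq.differentiableAt (hBo.mem_nhds hz₀R)).continuousAt
  obtain ⟨δ, hδ, hδq⟩ := Metric.eventually_nhds_iff_ball.1
    (hqc.norm.eventually (gt_mem_nhds (lt_add_one ‖q z₀‖)))
  set M := ‖q z₀‖ + 1 with hM
  have hM0 : 0 < M := by positivity
  set r := min (min δ R) (min 1 (1 / (2 * M))) with hr
  have hr0 : 0 < r := by positivity
  have hrδ : r ≤ δ := (min_le_left _ _).trans (min_le_left _ _)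
  have hrR : r ≤ R := (min_le_left _ _).trans (min_le_right _ _)
  have hr1 : r ≤ 1 := (min_le_right _ _).trans (min_le_left _ _)
  have hrM : r ≤ 1 / (2 * M) := (min_le_right _ _).trans (min_le_right _ _)
  have hMr : M * r * r ≤ 1 / 2 := by
    calc M * r * r ≤ M * (1 / (2 * M)) * 1 := by gcongr
      _ = 1 / 2 := by field_simp
  set l := dz fun w => (L w : ℂ) with hl
  -- The function `e^(-L/2)` satisfies the same equation `∂²h = -q h`. The initial slope `-l(z₀)/2`
  -- is its logarithmic derivative at `z₀`, so that `e^(-L/2)/|y|²` has vanishing gradient there.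
  obtain ⟨y, y', hy0, hy'0, hy, hy'⟩ := exists_second_order_holomorphic_solution hr0
    (hq.mono (Metric.ball_subset_ball hrR))
    (fun z hz => (hδq z (Metric.ball_subset_ball hrδ hz)).le) hMr (-l z₀ / 2)
  have hz₀r : z₀ ∈ Metric.ball z₀ r := Metric.mem_ball_self hr0
  obtain ⟨ε, hε, hεy⟩ := Metric.eventually_nhds_iff_ball.1
    ((hy z₀ hz₀r).continuousAt.eventually_ne (by rw [hy0]; exact one_ne_zero))
  set ρ := min ε r with hρ
  have hρ0 : 0 < ρ := by positivity
  have hρr : ρ ≤ r := min_le_right _ _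
  set B := Metric.ball z₀ ρ with hB
  have hBopen : IsOpen B := Metric.isOpen_ball
  have hBr : B ⊆ Metric.ball z₀ r := Metric.ball_subset_ball hρr
  have hBR : B ⊆ Metric.ball z₀ R := hBr.trans (Metric.ball_subset_ball hrR)
  have hz₀ : z₀ ∈ B := Metric.mem_ball_self hρ0
  have hyne : ∀ z ∈ B, y z ≠ 0 := fun z hz =>
    hεy z (Metric.ball_subset_ball (min_le_left _ _) hz)
  have hG : DifferentiableOn ℂ (fun z => (y z ^ 2)⁻¹) B := fun z hz =>
    (((hy z (hBr hz)).differentiableAt.pow 2).inv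
      (pow_ne_zero 2 (hyne z hz))).differentiableWithinAt
  obtain ⟨F, hF0, hF⟩ := hG.isExactOn_ball.with_val_at z₀ 0
  -- the basic functions and their Wirtinger derivatives
  have wL : ∀ z ∈ B, HasWirtingerAt (fun w => (L w : ℂ)) (l z) (conj (l z)) z := fun z hz =>
    hasWirtingerAt_ofReal ((hL.contDiffAt (hBo.mem_nhds (hBR hz))).differentiableAt (by simp))
  have hlsm : ContDiffOn ℝ ∞ l (Metric.ball z₀ R) := (contDiffOn_ofReal hL).dz hBo
  have wl : ∀ z ∈ B, HasWirtingerAt l (2 * q z + l z ^ 2 / 2) (Complex.exp (L z) / 2) z := by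
    intro z hz
    have := HasWirtingerAt.of_fderiv
      ((hlsm.contDiffAt (hBo.mem_nhds (hBR hz))).differentiableAt (by simp))
    refine this.congr_deriv ?_ (dzbar_dz_of_liouville hBo hL hΔ (hBR hz))
    rw [hqdef, metricSchwarzian]; ring
  set h : ℂ → ℂ := fun w => Complex.exp (-1 / 2 * (L w : ℂ)) with hh
  have wh : ∀ z ∈ B, HasWirtingerAt h (-1 / 2 * l z * h z) (-1 / 2 * conj (l z) * h z) z :=
    fun z hz => (HasWirtingerAt.comp_hasDerivAt (Complex.hasDerivAt_exp _)
      ((wL z hz).const_mul (-1 / 2))).congr_deriv (by simp only [hh]; ring)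
        (by simp only [hh]; ring)
  have hhre : ∀ z, h z = (Real.exp (-L z / 2) : ℂ) := fun z => by
    simp only [hh]; push_cast; congr 1; ring
  have hhc : ∀ z, conj (h z) = h z := fun z => by rw [hhre, Complex.conj_ofReal]
  have wy : ∀ z ∈ B, HasWirtingerAt y (y' z) 0 z := fun z hz => .of_hasDerivAt (hy z (hBr hz))
  have wy' : ∀ z ∈ B, HasWirtingerAt y' (-(q z * y z)) 0 z := fun z hz =>
    .of_hasDerivAt (hy' z (hBr hz))
  have hycne : ∀ z ∈ B, conj (y z) ≠ 0 := fun z hz => by simpa using hyne z hz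
  have wyc : ∀ z ∈ B, HasWirtingerAt (fun w => conj (y w)) 0 (conj (y' z)) z := fun z hz =>
    (wy z hz).star.congr_deriv (map_zero _) rfl
  -- Up to the antiholomorphic factor `1/ȳ` this is the Wronskian `∂h · y - h y'`. Since `h` and `y`
  -- solve the same second order equation in `z`, `∂P = 0`, so `f = P̄` is holomorphic.
  set P : ℂ → ℂ := fun w => -(h w * (1 / 2 * (l w * y w) + y' w)) * (conj (y w))⁻¹ with hP
  have wP : ∀ z ∈ B, HasWirtingerAt P 0
      (-(-1 / 2 * conj (l z) * h z * (1 / 2 * (l z * y z) + y' z)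
        + h z * (1 / 2 * (Complex.exp (L z) / 2 * y z))) * (conj (y z))⁻¹
        + h z * (1 / 2 * (l z * y z) + y' z) * (conj (y' z) / conj (y z) ^ 2)) z := by
    intro z hz
    have := (((wh z hz).mul ((((wl z hz).mul (wy z hz)).const_mul (1 / 2)).add
      (wy' z hz))).neg).mul ((wyc z hz).inv (hycne z hz))
    refine this.congr_deriv ?_ ?_
    · ring
    · ring
  set m : ℂ → ℂ := fun w => h w * ((y w)⁻¹ * (conj (y w))⁻¹) with hm
  have hmc : ∀ z, conj (m z) = m z := fun z => by
    simp only [hm, map_mul, map_inv₀, hhc, Complex.conj_conj]; ring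
  set f : ℂ → ℂ := fun w => conj (P w) with hf
  have hfd : DifferentiableOn ℂ f B := fun z hz => by
    have := (wP z hz).star.congr_deriv rfl (map_zero _)
    exact this.hasDerivAt.differentiableAt.differentiableWithinAt
  have wm : ∀ z ∈ B, HasWirtingerAt m (conj (f z) * (y z ^ 2)⁻¹) (f z * (conj (y z ^ 2))⁻¹) z := by
    intro z hz
    have h1 := hyne z hz
    have h2 := hycne z hz
    have := (wh z hz).mul (((wy z hz).inv h1).mul ((wyc z hz).inv h2))
    have h3 := this.congr_deriv (a' := conj (f z) * (y z ^ 2)⁻¹) (by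
      simp only [hf, hP, Complex.conj_conj]
      field_simp
      ring) rfl
    refine h3.congr_deriv rfl ((conj_dz_of_real (.of_forall hmc) h3).trans ?_)
    simp
  have hf' : ∀ z ∈ B, HasDerivAt f (deriv f z) z := fun z hz =>
    (hfd.differentiableAt (hBopen.mem_nhds hz)).hasDerivAt
  have wf : ∀ z ∈ B, HasWirtingerAt f (deriv f z) 0 z := fun z hz => .of_hasDerivAt (hf' z hz)
  have wG : ∀ z ∈ B, HasWirtingerAt (fun z => (y z ^ 2)⁻¹) (deriv (fun z => (y z ^ 2)⁻¹) z) 0 z :=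
    fun z hz => .of_hasDerivAt (hG.differentiableAt (hBopen.mem_nhds hz)).hasDerivAt
  have hmsm : ∀ z ∈ B, ContDiffAt ℝ 2 m z := by
    intro z hz
    have hL2 : ContDiffAt ℝ 2 (fun w => (L w : ℂ)) z :=
      ((contDiffOn_ofReal hL).contDiffAt (hBo.mem_nhds (hBR hz))).of_le (by norm_cast)
    have hh2 : ContDiffAt ℝ 2 h z := (contDiffAt_const.mul hL2).cexp
    have hyd : DifferentiableOn ℂ y B := fun z hz =>
      (hy z (hBr hz)).differentiableAt.differentiableWithinAt
    have hy2 : ContDiffAt ℝ 2 y z :=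
      ((hyd.contDiffOn hBopen (n := 2)).contDiffAt (hBopen.mem_nhds hz)).restrict_scalars ℝ
    have hyc2 : ContDiffAt ℝ 2 (fun w => conj (y w)) z :=
      Complex.conjCLE.contDiff.contDiffAt.comp z hy2
    exact hh2.mul ((hy2.inv (hyne z hz)).mul (hyc2.inv (hycne z hz)))
  -- Equality of the mixed derivatives `∂∂̄m` and `∂̄∂m` says that `f' y²` is real; being
  -- holomorphic, it is then a constant `κ`, so that `f = κF` and `m - κ|F|²` is constant.
  have hreal : ∀ z ∈ B, conj (deriv f z * y z ^ 2) = deriv f z * y z ^ 2 := by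
    intro z hz
    have c := (dz_dzbar_comm (hmsm z hz)).1
    have e1 : dzbar m =ᶠ[𝓝 z] fun w => f w * conj ((y w ^ 2)⁻¹) := by
      filter_upwards [hBopen.mem_nhds hz] with w hw
      rw [(wm w hw).dzbar_eq, map_inv₀]
    have e2 : dz m =ᶠ[𝓝 z] fun w => conj (f w) * (y w ^ 2)⁻¹ := by
      filter_upwards [hBopen.mem_nhds hz] with w hw
      rw [(wm w hw).dz_eq]
    rw [(((wf z hz).mul (wG z hz).star).congr_of_eventuallyEq e1).dz_eq,
      (((wf z hz).star.mul (wG z hz)).congr_of_eventuallyEq e2).dzbar_eq] at c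
    have h1 := hyne z hz
    have h2 := hycne z hz
    simp only [map_zero, mul_zero, add_zero, map_inv₀, map_pow] at c
    rw [map_mul, map_pow]
    field_simp at c
    linear_combination -c
  have hκd : DifferentiableOn ℂ (fun z => deriv f z * y z ^ 2) B := fun z hz =>
    (((hfd.deriv hBopen).differentiableAt (hBopen.mem_nhds hz)).mul
      ((hy z (hBr hz)).differentiableAt.pow 2)).differentiableWithinAt
  have wκ : ∀ z ∈ B, HasWirtingerAt (fun z => deriv f z * y z ^ 2) 0 0 z := by
    intro z hz
    have h1 := (hκd.differentiableAt (hBopen.mem_nhds hz)).hasDerivAt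
    have h2 := h1.eq_zero_of_real ((hBopen.mem_nhds hz : B ∈ 𝓝 z) |> fun h =>
      Filter.mem_of_superset h fun w hw => hreal w hw)
    rw [h2] at h1
    exact .of_hasDerivAt h1
  set κ := deriv f z₀ with hκ
  have hκz : ∀ z ∈ B, deriv f z = κ * (y z ^ 2)⁻¹ := by
    intro z hz
    have e := HasWirtingerAt.eqOn_ball_of_zero wκ hz
    simp only [hy0, one_pow, mul_one] at e
    rw [hκ, ← e]
    have h1 := hyne z hz
    field_simp
  have hP0 : P z₀ = 0 := by simp only [hP, hy0, hy'0]; ring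
  have hf0 : f z₀ = 0 := by simp [hf, hP0]
  -- At `z₀` the Wronskian factor vanishes, so only the term coming from `∂̄l = e^L/2` survives in
  -- `∂̄P`; the rest is `h² e^L = 1`.
  have hκ0 : κ = -(1 / (4 * h z₀)) := by
    have h1 := ((wf z₀ hz₀).unique (wP z₀ hz₀).star).1
    have h2 : h z₀ * h z₀ * Complex.exp (L z₀) = 1 := by
      simp only [hh]
      rw [← Complex.exp_add, ← Complex.exp_add]
      rw [show (-1 / 2 * (L z₀ : ℂ) + -1 / 2 * (L z₀ : ℂ) + (L z₀ : ℂ)) = 0 by ring,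
        Complex.exp_zero]
    have h3 : h z₀ ≠ 0 := Complex.exp_ne_zero _
    have h4 : conj (Complex.exp (L z₀)) = Complex.exp (L z₀) := by
      rw [← Complex.exp_conj, Complex.conj_ofReal]
    simp only [hy0, hy'0] at h1
    have h5 : κ = conj (-(h z₀ * Complex.exp (L z₀)) / 4) := by
      rw [hκ, h1, map_one]
      congr 1
      ring
    simp only [map_neg, map_mul, map_div₀, hhc, h4, map_ofNat] at h5
    rw [h5]
    field_simp
    linear_combination -h2
  have hfF : ∀ z ∈ B, f z = κ * F z := by
    intro z hz
    have hw : ∀ z ∈ B, HasWirtingerAt (fun w => f w - κ * F w) 0 0 z := fun z hz =>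
      ((wf z hz).sub ((HasWirtingerAt.of_hasDerivAt (hF z hz)).const_mul κ)).congr_deriv
        (by rw [hκz z hz]; ring) (by ring)
    have := HasWirtingerAt.eqOn_ball_of_zero hw hz
    simp only [hf0, hF0] at this
    linear_combination this
  have hκc : conj κ = κ := by
    rw [hκ0]
    simp only [map_neg, map_div₀, map_mul, map_one, map_ofNat, hhc]
  refine ⟨ρ, hρ0, hρr.trans hrR, y, F, fun z hz => ⟨hyne z hz, hF z hz, ?_⟩⟩
  have hw : ∀ z ∈ B, HasWirtingerAt (fun w => m w - κ * (F w * conj (F w))) 0 0 z := fun z hz => by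
    have wF := HasWirtingerAt.of_hasDerivAt (hF z hz)
    refine ((wm z hz).sub ((wF.mul wF.star).const_mul κ)).congr_deriv ?_ ?_
    · rw [hfF z hz, map_mul, hκc]; simp; ring
    · rw [hfF z hz]; simp; ring
  have := HasWirtingerAt.eqOn_ball_of_zero hw hz
  simp only [hF0, zero_mul, mul_zero, sub_zero] at this
  have hm0 : m z₀ = h z₀ := by simp [hm, hy0]
  rw [hm0, hκ0] at this
  rw [← hhre z, ← hhre z₀]
  have e : h z / (y z * conj (y z)) = m z := by simp only [hm]; rw [← mul_inv, div_eq_mul_inv]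
  rw [e]
  linear_combination this

/-- Liouville's theorem: a hyperbolic metric is locally the pull-back of the metric of the upper
half-plane by a holomorphic map. -/
theorem exists_developing_map {z₀ : ℂ} {R : ℝ} (hR : 0 < R)
    (hL : ContDiffOn ℝ ∞ L (Metric.ball z₀ R))
    (hΔ : ∀ z ∈ Metric.ball z₀ R, Laplacian.laplacian L z = 2 * Real.exp (L z)) :
    ∃ r, 0 < r ∧ r ≤ R ∧ ∃ τ τ' : ℂ → ℂ, ∀ z ∈ Metric.ball z₀ r,
      HasDerivAt τ (τ' z) z ∧ 0 < (τ z).im ∧ Real.exp (L z) = ‖τ' z‖ ^ 2 / (τ z).im ^ 2 := by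
  obtain ⟨r, hr, hrR, y, F, hyF⟩ := exists_liouville_representation hR hL hΔ
  set h₀ := Real.exp (-L z₀ / 2) with hh₀
  have hh₀pos : 0 < h₀ := Real.exp_pos _
  -- In terms of `D` the representation reads `e^(-L/2) = |y|² h₀ (1 - |D|²)`: positivity puts `D`
  -- in the unit disc, `e^L |dz|²` is the pull-back of the Poincaré metric by `D`, and the Cayley
  -- transform carries the disc to the upper half-plane.
  set D : ℂ → ℂ := fun z => F z / (2 * h₀) with hD
  refine ⟨r, hr, hrR, fun z => I * (1 + D z) / (1 - D z),
    fun z => 2 * I * ((y z ^ 2)⁻¹ / (2 * h₀)) / (1 - D z) ^ 2, fun z hz => ?_⟩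
  obtain ⟨hy, hF, e⟩ := hyF z hz
  have hyn : 0 < ‖y z‖ := norm_pos_iff.2 hy
  have e' : Real.exp (-L z / 2) = ‖y z‖ ^ 2 * h₀ * (1 - ‖D z‖ ^ 2) := by
    have e1 : Real.exp (-L z / 2) / ‖y z‖ ^ 2 = h₀ - ‖F z‖ ^ 2 / (4 * h₀) := by
      rw [Complex.mul_conj', Complex.mul_conj'] at e
      exact_mod_cast e
    have e2 : ‖D z‖ ^ 2 = ‖F z‖ ^ 2 / (4 * h₀ ^ 2) := by
      simp only [hD, norm_div, norm_mul, Complex.norm_real, Real.norm_eq_abs, abs_of_pos hh₀pos]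
      norm_num
      ring
    rw [e2]
    field_simp at e1 ⊢
    linear_combination e1
  have hpos := Real.exp_pos (-L z / 2)
  have hD1 : 0 < 1 - ‖D z‖ ^ 2 := by
    rw [e'] at hpos
    exact pos_of_mul_pos_right hpos (by positivity)
  have hne : 1 - D z ≠ 0 := fun h0 => by
    have : D z = 1 := (sub_eq_zero.1 h0).symm
    rw [this] at hD1; simp at hD1
  have hDd : HasDerivAt D ((y z ^ 2)⁻¹ / (2 * h₀)) z := hF.div_const _
  have him : (I * (1 + D z) / (1 - D z)).im = (1 - ‖D z‖ ^ 2) / ‖1 - D z‖ ^ 2 := by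
    rw [Complex.div_im, ← Complex.normSq_eq_norm_sq, ← Complex.normSq_eq_norm_sq]
    have : Complex.normSq (1 - D z) ≠ 0 := by simpa [Complex.normSq_eq_zero] using hne
    field_simp
    simp [Complex.normSq_apply]
    ring
  have hnn : 0 < ‖1 - D z‖ := norm_pos_iff.2 hne
  refine ⟨?_, ?_, ?_⟩
  · refine (((hDd.const_add 1).const_mul I).div (hDd.const_sub 1) hne).congr_deriv ?_
    field_simp
    ring
  · rw [him]; positivity
  · have e3 : Real.exp (L z) = 1 / Real.exp (-L z / 2) ^ 2 := by
      rw [eq_div_iff (by positivity), ← Real.exp_nat_mul, ← Real.exp_add, ← Real.exp_zero]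
      exact congrArg Real.exp (by push_cast; ring)
    rw [him, e3, e']
    simp only [norm_div, norm_mul, norm_pow, norm_inv, Complex.norm_real, Real.norm_eq_abs,
      abs_of_pos hh₀pos, Complex.norm_I]
    norm_num
    field_simp

end Liouville

/-! ### Second derivatives and the Laplacian -/

theorem hasDerivAt_line {f : ℂ → ℝ} {z v : ℂ} {t : ℝ} (hf : DifferentiableAt ℝ f (z + t * v)) :
    HasDerivAt (fun s : ℝ => f (z + s * v)) (fderiv ℝ f (z + t * v) v) t := by
  have h1 : HasDerivAt (fun s : ℝ => z + s * v) v t := by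
    simpa using ((hasDerivAt_id t).ofReal_comp.mul_const v).const_add z
  exact hf.hasFDerivAt.comp_hasDerivAt t h1

theorem iteratedFDeriv_two_eq_deriv_deriv {f : ℂ → ℝ} {z : ℂ} (hf : ContDiffAt ℝ 2 f z) (v : ℂ) :
    iteratedFDeriv ℝ 2 f z ![v, v] = deriv (deriv fun t : ℝ => f (z + t * v)) 0 := by
  have hc : Tendsto (fun t : ℝ => z + t * v) (𝓝 0) (𝓝 z) := by
    have : Continuous fun t : ℝ => z + t * v := by fun_prop
    simpa using this.tendsto 0
  have h1 : deriv (fun t : ℝ => f (z + t * v)) =ᶠ[𝓝 0] fun t => fderiv ℝ f (z + t * v) v := by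
    filter_upwards [hc.eventually (hf.eventually (by simp))] with t ht
    exact (hasDerivAt_line (ht.differentiableAt (by simp))).deriv
  have h2 : HasFDerivAt (fun y => fderiv ℝ f y v) ((fderiv ℝ (fderiv ℝ f) z).flip v)
      (z + (0 : ℝ) * v) := by
    have e : z + (0 : ℝ) * v = z := by simp
    rw [e]
    exact fderiv_fderiv_apply hf v
  have h3 : HasDerivAt (fun s : ℝ => z + s * v) v 0 := by
    simpa using ((hasDerivAt_id (0 : ℝ)).ofReal_comp.mul_const v).const_add z
  have h4 : HasDerivAt (fun t : ℝ => fderiv ℝ f (z + t * v) v)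
      ((fderiv ℝ (fderiv ℝ f) z).flip v v) 0 := (h2.comp_hasDerivAt (0 : ℝ) h3 :)
  rw [h1.deriv_eq, h4.deriv, iteratedFDeriv_two_apply]
  rfl

theorem laplacian_eq_deriv_deriv {f : ℂ → ℝ} {z : ℂ} (hf : ContDiffAt ℝ 2 f z) :
    Laplacian.laplacian f z = deriv (deriv fun t : ℝ => f (z + t * 1)) 0 +
      deriv (deriv fun t : ℝ => f (z + t * I)) 0 := by
  rw [InnerProductSpace.laplacian_eq_iteratedFDeriv_complexPlane]
  simp only [iteratedFDeriv_two_eq_deriv_deriv hf]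

/-- If the second derivative were positive, the point would also be a local minimum, so the function
would be locally constant and its second derivative zero. No differentiability is assumed. -/
theorem deriv_deriv_nonpos_of_isLocalMax {φ : ℝ → ℝ} {t : ℝ} (hc : ContinuousAt φ t)
    (h : IsLocalMax φ t) : deriv (deriv φ) t ≤ 0 := by
  by_contra! hpos
  have hmin := isLocalMin_of_deriv_deriv_pos hpos h.deriv_eq_zero hc
  have hconst : φ =ᶠ[𝓝 t] fun _ => φ t := by
    filter_upwards [h, hmin] with s h1 h2 using le_antisymm h1 h2
  have : deriv (deriv φ) t = 0 := by
    rw [hconst.deriv.deriv_eq]; simp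
  exact hpos.ne' this

theorem laplacian_nonpos_of_isLocalMax {f : ℂ → ℝ} {z : ℂ} (hf : ContDiffAt ℝ 2 f z)
    (h : IsLocalMax f z) : Laplacian.laplacian f z ≤ 0 := by
  rw [laplacian_eq_deriv_deriv hf]
  have key : ∀ v : ℂ, deriv (deriv fun t : ℝ => f (z + t * v)) 0 ≤ 0 := by
    intro v
    have hc : ContinuousAt (fun t : ℝ => z + t * v) 0 := by fun_prop
    have e : z + ((0 : ℝ) : ℂ) * v = z := by simp
    refine deriv_deriv_nonpos_of_isLocalMax ?_ ?_
    · exact ContinuousAt.comp (by rw [e]; exact hf.continuousAt) hc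
    · have h' : ∀ᶠ w in 𝓝 (z + ((0 : ℝ) : ℂ) * v), f w ≤ f (z + ((0 : ℝ) : ℂ) * v) := by
        rw [e]; exact h
      exact hc.eventually h'
  linarith [key 1, key I]

/-- A strict maximum principle. -/
theorem nonpos_of_laplacian_pos {f : ℂ → ℝ} {K V : Set ℂ} (hK : IsCompact K) (hV : IsOpen V)
    (hVK : V ⊆ K) (hc : ContinuousOn f K) (hf : ∀ z ∈ V, ContDiffAt ℝ 2 f z)
    (hΔ : ∀ z ∈ V, 0 < Laplacian.laplacian f z) (hb : ∀ z ∈ K \ V, f z ≤ 0) {z : ℂ} (hz : z ∈ K) :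
    f z ≤ 0 := by
  obtain ⟨x, hx, hmax⟩ := hK.exists_isMaxOn ⟨z, hz⟩ hc
  refine (hmax hz).trans ?_
  by_cases hxV : x ∈ V
  · have hloc : IsLocalMax f x := (hmax.isLocalMax (Filter.mem_of_superset (hV.mem_nhds hxV) hVK))
    exact absurd (laplacian_nonpos_of_isLocalMax (hf x hxV) hloc) (not_le.2 (hΔ x hxV))
  · exact hb x ⟨hx, hxV⟩

/-- A real quadratic polynomial without mixed term. -/
def quadPoly (a b c d e : ℝ) (z : ℂ) : ℝ := a * z.re ^ 2 + b * z.im ^ 2 + c * z.re + d * z.im + e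

theorem contDiff_quadPoly (a b c d e : ℝ) : ContDiff ℝ 2 (quadPoly a b c d e) := by
  have h1 : ContDiff ℝ 2 Complex.re := Complex.reCLM.contDiff
  have h2 : ContDiff ℝ 2 Complex.im := Complex.imCLM.contDiff
  unfold quadPoly
  fun_prop

theorem deriv_deriv_quadratic (a b c : ℝ) :
    deriv (deriv fun t : ℝ => a * t ^ 2 + b * t + c) 0 = 2 * a := by
  have h1 : deriv (fun t : ℝ => a * t ^ 2 + b * t + c) = fun t => a * (2 * t) + b := by
    ext t
    have h : HasDerivAt (fun t : ℝ => a * t ^ 2 + b * t + c) (a * (2 * t) + b * 1) t := by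
      simpa using (((hasDerivAt_pow 2 t).const_mul a).add ((hasDerivAt_id t).const_mul b)).add_const c
    rw [h.deriv, mul_one]
  rw [h1]
  have h : HasDerivAt (fun t : ℝ => a * (2 * t) + b) (a * (2 * 1)) 0 :=
    (((hasDerivAt_id (0 : ℝ)).const_mul 2).const_mul a).add_const b
  rw [h.deriv]; ring

theorem laplacian_quadPoly (a b c d e : ℝ) (z : ℂ) :
    Laplacian.laplacian (quadPoly a b c d e) z = 2 * (a + b) := by
  rw [laplacian_eq_deriv_deriv (contDiff_quadPoly a b c d e).contDiffAt]
  have h1 : (fun t : ℝ => quadPoly a b c d e (z + t * 1)) = fun t =>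
      a * t ^ 2 + (2 * a * z.re + c) * t + quadPoly a b c d e z := by
    ext t; simp [quadPoly]; ring
  have h2 : (fun t : ℝ => quadPoly a b c d e (z + t * I)) = fun t =>
      b * t ^ 2 + (2 * b * z.im + d) * t + quadPoly a b c d e z := by
    ext t; simp [quadPoly]; ring
  rw [h1, h2, deriv_deriv_quadratic, deriv_deriv_quadratic]; ring

theorem laplacian_sub_quadPoly {u : ℂ → ℝ} {z : ℂ} (hu : ContDiffAt ℝ 2 u z) (a b c d e : ℝ) :
    Laplacian.laplacian (fun w => u w - quadPoly a b c d e w) z =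
      Laplacian.laplacian u z - 2 * (a + b) := by
  have := hu.laplacian_sub (contDiff_quadPoly a b c d e).contDiffAt
  rw [laplacian_quadPoly] at this
  exact this

/-- A function with Laplacian at least `ε` on a ball of radius `R` exceeds its central value by at
least `ε R ^ 2 / 4` somewhere. -/
theorem add_le_of_lt_laplacian {u : ℂ → ℝ} {z₀ : ℂ} {R ε M : ℝ} (hR : 0 < R)
    (hu : ∀ z ∈ Metric.closedBall z₀ R, ContDiffAt ℝ 2 u z)
    (hΔ : ∀ z ∈ Metric.closedBall z₀ R, ε < Laplacian.laplacian u z)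
    (hM : ∀ z ∈ Metric.closedBall z₀ R, u z ≤ M) : u z₀ + ε * R ^ 2 / 4 ≤ M := by
  -- The comparison function has Laplacian exactly `ε` and equals `M` on the boundary circle, so the
  -- maximum principle at the centre gives the claim.
  have hq : ∀ w, quadPoly (ε / 4) (ε / 4) (-(ε / 2 * z₀.re)) (-(ε / 2 * z₀.im))
      (ε / 4 * (z₀.re ^ 2 + z₀.im ^ 2) + (M - ε * R ^ 2 / 4)) w
      = ε / 4 * dist w z₀ ^ 2 + (M - ε * R ^ 2 / 4) := by
    intro w
    rw [Complex.dist_eq, ← Complex.normSq_eq_norm_sq, Complex.normSq_apply, quadPoly]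
    simp; ring
  have key := nonpos_of_laplacian_pos (isCompact_closedBall z₀ R) Metric.isOpen_ball
    Metric.ball_subset_closedBall
    (f := fun w => u w - quadPoly (ε / 4) (ε / 4) (-(ε / 2 * z₀.re)) (-(ε / 2 * z₀.im))
      (ε / 4 * (z₀.re ^ 2 + z₀.im ^ 2) + (M - ε * R ^ 2 / 4)) w)
    (fun z hz => ((hu z hz).sub (contDiff_quadPoly _ _ _ _ _).contDiffAt).continuousAt.continuousWithinAt)
    (fun z hz => (hu z (Metric.ball_subset_closedBall hz)).sub
      (contDiff_quadPoly _ _ _ _ _).contDiffAt)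
    (fun z hz => by
      rw [laplacian_sub_quadPoly (hu z (Metric.ball_subset_closedBall hz))]
      linarith [hΔ z (Metric.ball_subset_closedBall hz)])
    (fun z hz => by
      have h1 : dist z z₀ = R := le_antisymm hz.1 (not_lt.1 hz.2)
      have := hM z hz.1
      rw [hq, h1]; linarith)
    (Metric.mem_closedBall_self hR.le)
  rw [hq, dist_self] at key
  linarith

theorem HasWirtingerAt.comp_conj {f : ℂ → ℂ} {a b z : ℂ} (h : HasWirtingerAt f a b (conj z)) :
    HasWirtingerAt (fun w => f (conj w)) b a z := by
  have := HasFDerivAt.comp z h (Complex.conjCLE : ℂ →L[ℝ] ℂ).hasFDerivAt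
  exact this.hasWirtingerAt fun v => by simp; ring

theorem contDiffAt_ofReal {u : ℂ → ℝ} {z : ℂ} {n : WithTop ℕ∞} (hu : ContDiffAt ℝ n u z) :
    ContDiffAt ℝ n (fun w => (u w : ℂ)) z :=
  Complex.ofRealCLM.contDiff.contDiffAt.comp z hu

theorem _root_.ContDiffAt.differentiableAt_dz {f : ℂ → ℂ} {z : ℂ} (hf : ContDiffAt ℝ 2 f z) :
    DifferentiableAt ℝ (dz f) z ∧ DifferentiableAt ℝ (dzbar f) z := by
  have h1 := (fderiv_fderiv_apply hf 1).differentiableAt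
  have h2 := (fderiv_fderiv_apply hf I).differentiableAt
  exact ⟨(h1.sub (h2.const_mul I)).mul_const (2⁻¹ : ℂ),
    (h1.add (h2.const_mul I)).mul_const (2⁻¹ : ℂ)⟩

theorem eventually_hasWirtingerAt {f : ℂ → ℂ} {z : ℂ} (hf : ContDiffAt ℝ 2 f z) :
    ∀ᶠ w in 𝓝 z, HasWirtingerAt f (dz f w) (dzbar f w) w :=
  (hf.eventually (by simp)).mono fun _ h => .of_fderiv (h.differentiableAt (by simp))

theorem laplacian_comp_conj {u : ℂ → ℝ} {z : ℂ} (hu : ContDiffAt ℝ 2 u (conj z)) :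
    Laplacian.laplacian (fun w => u (conj w)) z = Laplacian.laplacian u (conj z) := by
  have hc : ContDiffAt ℝ 2 (fun w : ℂ => conj w) z := Complex.conjCLE.contDiff.contDiffAt
  have hU := contDiffAt_ofReal hu
  have e : dz (fun w => ((u (conj w) : ℝ) : ℂ)) =ᶠ[𝓝 z]
      fun w => dzbar (fun w => (u w : ℂ)) (conj w) := by
    filter_upwards [hc.continuousAt.eventually (eventually_hasWirtingerAt hU)] with w hw
    exact hw.comp_conj.dz_eq
  have h := ((HasWirtingerAt.of_fderiv hU.differentiableAt_dz.2).comp_conj.congr_of_eventuallyEq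
    e).dzbar_eq
  have h1 := laplacian_eq_dzbar_dz (hu.comp z hc)
  have h2 := laplacian_eq_dzbar_dz hu
  rw [(dz_dzbar_comm hU).1, ← mul_right_inj' (by norm_num : (4 : ℂ) ≠ 0), ← h2] at h
  exact_mod_cast h1.trans h

theorem laplacian_comp_holomorphic {u : ℂ → ℝ} {F F' : ℂ → ℂ} {z : ℂ}
    (hF : ∀ᶠ w in 𝓝 z, HasDerivAt F (F' w) w) (hF' : DifferentiableAt ℂ F' z)
    (hu : ContDiffAt ℝ 2 u (F z)) :
    ContDiffAt ℝ 2 (fun w => u (F w)) z ∧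
    Laplacian.laplacian (fun w => u (F w)) z = Laplacian.laplacian u (F z) * ‖F' z‖ ^ 2 := by
  have hc : ContDiffAt ℝ 2 F z := by
    obtain ⟨s, hs, hso, hzs⟩ := eventually_nhds_iff.1 hF
    have hd : DifferentiableOn ℂ F s := fun w hw => (hs w hw).differentiableAt.differentiableWithinAt
    exact ((hd.contDiffOn hso (n := 2)).contDiffAt (hso.mem_nhds hzs)).restrict_scalars ℝ
  have hU := contDiffAt_ofReal hu
  have e : dz (fun w => ((u (F w) : ℝ) : ℂ)) =ᶠ[𝓝 z]
      fun w => dz (fun w => (u w : ℂ)) (F w) * F' w := by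
    filter_upwards [hc.continuousAt.eventually (eventually_hasWirtingerAt hU), hF] with w hw hFw
    exact (hw.comp_holomorphic hFw).dz_eq
  have h := ((((HasWirtingerAt.of_fderiv hU.differentiableAt_dz.1).comp_holomorphic
    hF.self_of_nhds).mul (.of_hasDerivAt hF'.hasDerivAt)).congr_of_eventuallyEq e).dzbar_eq
  have hcomp : ContDiffAt ℝ 2 (fun w => u (F w)) z := hu.comp z hc
  refine ⟨hcomp, ?_⟩
  have h1 := laplacian_eq_dzbar_dz hcomp
  have h2 := laplacian_eq_dzbar_dz hu
  have h3 : F' z * conj (F' z) = ((‖F' z‖ ^ 2 : ℝ) : ℂ) := by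
    rw [Complex.mul_conj']; push_cast; rfl
  rw [h] at h1
  have : ((Laplacian.laplacian (fun w => u (F w)) z : ℝ) : ℂ) =
      ((Laplacian.laplacian u (F z) * ‖F' z‖ ^ 2 : ℝ) : ℂ) := by
    rw [Complex.ofReal_mul, ← h3, h1, h2]; ring
  exact_mod_cast this

theorem _root_.HasDerivAt.le_of_le_mul {g : ℝ → ℝ} {g' c δ : ℝ} (hg : HasDerivAt g g' 0)
    (h0 : g 0 = 0) (hδ : 0 < δ) (h : ∀ t ∈ Set.Ioo 0 δ, g t ≤ c * t) : g' ≤ c := by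
  have h1 : Tendsto (slope g 0) (𝓝[>] 0) (𝓝 g') :=
    (hasDerivAt_iff_tendsto_slope.1 hg).mono_left (nhdsWithin_mono _ fun x hx => ne_of_gt hx)
  refine le_of_tendsto h1 ?_
  filter_upwards [Ioo_mem_nhdsGT hδ] with t ht
  rw [slope_def_field, h0, sub_zero, sub_zero, div_le_iff₀ ht.1]
  exact h t ht

/-- Interior gradient estimate in a half square, by comparison with a quadratic polynomial. -/
theorem fderiv_I_le {u : ℂ → ℝ} {d M N : ℝ} (hd : 0 < d)
    (hu : ∀ z : ℂ, |z.re| ≤ d → |z.im| ≤ d → ContDiffAt ℝ 2 u z)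
    (hM : ∀ z : ℂ, |z.re| ≤ d → |z.im| ≤ d → |u z| ≤ M)
    (hN : ∀ z : ℂ, |z.re| ≤ d → |z.im| ≤ d → |Laplacian.laplacian u z| < N) :
    fderiv ℝ u 0 I ≤ 2 * M / d + N * d / 2 := by
  have hM0 : 0 ≤ M := (abs_nonneg _).trans (hM 0 (by simpa using hd.le) (by simpa using hd.le))
  have hN0 : 0 < N := (abs_nonneg _).trans_lt (hN 0 (by simpa using hd.le) (by simpa using hd.le))
  set K : Set ℂ := Set.Icc (-d) d ×ℂ Set.Icc 0 d with hK
  set V : Set ℂ := Set.Ioo (-d) d ×ℂ Set.Ioo 0 d with hV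
  have hVK : V ⊆ K := fun z hz => ⟨Set.Ioo_subset_Icc_self hz.1, Set.Ioo_subset_Icc_self hz.2⟩
  have hre : ∀ z ∈ K, |z.re| ≤ d := fun z hz => abs_le.2 hz.1
  have him : ∀ z ∈ K, |z.im| ≤ d := fun z hz => abs_le.2 ⟨by linarith [hz.2.1], hz.2.2⟩
  -- Odd reflection across the real axis: `w` vanishes there, and its derivative at 0 in the
  -- direction `I` is twice that of `u`, which explains the final halving.
  set w : ℂ → ℝ := fun z => u z - u (conj z) with hw
  have hcj : ∀ z ∈ K, ContDiffAt ℝ 2 u (conj z) := fun z hz =>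
    hu _ (by simpa using hre z hz) (by simpa using him z hz)
  have hcj' : ∀ z ∈ K, ContDiffAt ℝ 2 (fun w => u (conj w)) z := fun z hz =>
    (hcj z hz).comp z Complex.conjCLE.contDiff.contDiffAt
  have hws : ∀ z ∈ K, ContDiffAt ℝ 2 w z := fun z hz =>
    (hu z (hre z hz) (him z hz)).sub (hcj' z hz)
  have hwl : ∀ z ∈ K, -(2 * N) < Laplacian.laplacian w z := by
    intro z hz
    have h1 := (hu z (hre z hz) (him z hz)).laplacian_sub (hcj' z hz)
    rw [laplacian_comp_conj (hcj z hz)] at h1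
    have h2 := abs_lt.1 (hN z (hre z hz) (him z hz))
    have h3 := abs_lt.1 (hN (conj z) (by simpa using hre z hz) (by simpa using him z hz))
    have h4 : Laplacian.laplacian w z = Laplacian.laplacian u z - Laplacian.laplacian u (conj z) :=
      h1
    rw [h4]
    linarith
  -- The barrier is a harmonic polynomial plus `N y (d - y)`. The second summand has Laplacian `-2N`
  -- and absorbs `Δw > -2N`, strictly. The first is at least `2M ≥ w` on the top and the two
  -- vertical sides, and both are nonnegative on the bottom side, where `w = 0`.
  have hq : ∀ z, quadPoly (2 * M / d ^ 2) (-(2 * M / d ^ 2) - N) 0 (4 * M / d + N * d) 0 z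
      = 2 * M / d ^ 2 * (z.re ^ 2 + z.im * (2 * d - z.im)) + N * (z.im * (d - z.im)) := by
    intro z
    rw [quadPoly]; field_simp; ring
  have key : ∀ z ∈ K, w z - quadPoly (2 * M / d ^ 2) (-(2 * M / d ^ 2) - N) 0
      (4 * M / d + N * d) 0 z ≤ 0 := by
    intro z hz
    refine nonpos_of_laplacian_pos (isCompact_Icc.reProdIm isCompact_Icc)
      (isOpen_Ioo.reProdIm isOpen_Ioo) hVK
      (f := fun z => w z - quadPoly (2 * M / d ^ 2) (-(2 * M / d ^ 2) - N) 0
      (4 * M / d + N * d) 0 z)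
      (fun z hz => ((hws z hz).sub
        (contDiff_quadPoly _ _ _ _ _).contDiffAt).continuousAt.continuousWithinAt)
      (fun z hz => (hws z (hVK hz)).sub (contDiff_quadPoly _ _ _ _ _).contDiffAt)
      (fun z hz => ?_) (fun z hz => ?_) hz
    · rw [laplacian_sub_quadPoly (hws z (hVK hz))]
      linarith [hwl z (hVK hz)]
    · obtain ⟨hzK, hzV⟩ := hz
      have hw2 : w z ≤ 2 * M := by
        have h1 := abs_le.1 (hM z (hre z hzK) (him z hzK))
        have h2 := abs_le.1 (hM (conj z) (by simpa using hre z hzK) (by simpa using him z hzK))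
        simp only [hw]; linarith
      obtain ⟨⟨hx1, hx2⟩, hy1, hy2⟩ := hzK
      have hA : 0 ≤ 2 * M / d ^ 2 := by positivity
      have hB : 0 ≤ N * (z.im * (d - z.im)) :=
        mul_nonneg hN0.le (mul_nonneg hy1 (by linarith))
      have hC : 2 * M / d ^ 2 * d ^ 2 = 2 * M := by field_simp
      simp only [hq, sub_nonpos]
      rcases hy1.eq_or_lt with h0 | hy1'
      · have : conj z = z := Complex.conj_eq_iff_im.2 h0.symm
        simp only [hw, this, sub_self, ← h0, zero_mul, mul_zero, add_zero]
        positivity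
      · by_cases hd2 : d ^ 2 ≤ z.re ^ 2 + z.im * (2 * d - z.im)
        · have := mul_le_mul_of_nonneg_left hd2 hA
          linarith
        · exfalso
          refine hzV ⟨⟨?_, ?_⟩, hy1', ?_⟩
          · refine lt_of_le_of_ne hx1 fun h => hd2 ?_
            rw [← h]; nlinarith
          · refine lt_of_le_of_ne hx2 fun h => hd2 ?_
            rw [h]; nlinarith
          · refine lt_of_le_of_ne hy2 fun h => hd2 ?_
            rw [h]; nlinarith [sq_nonneg z.re]
  have hg1 : HasDerivAt (fun t : ℝ => u (0 + t * I)) (fderiv ℝ u 0 I) 0 := by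
    have := hasDerivAt_line (f := u) (z := 0) (v := I) (t := 0)
      (by simpa using (hu 0 (by simpa using hd.le) (by simpa using hd.le)).differentiableAt (by simp))
    simpa using this
  have hg2 : HasDerivAt (fun t : ℝ => u (0 + t * (-I))) (fderiv ℝ u 0 (-I)) 0 := by
    have := hasDerivAt_line (f := u) (z := 0) (v := -I) (t := 0)
      (by simpa using (hu 0 (by simpa using hd.le) (by simpa using hd.le)).differentiableAt (by simp))
    simpa using this
  have hg := (hg1.sub hg2).le_of_le_mul (c := 4 * M / d + N * d) (by simp) hd fun t ht => by
    have hmem : (t : ℂ) * I ∈ K := by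
      refine ⟨?_, ?_⟩ <;> simp [hd.le, ht.1.le, ht.2.le]
    have := key _ hmem
    rw [hq] at this
    simp only [hw, map_mul, Complex.conj_ofReal, Complex.conj_I] at this
    have e1 : ((t : ℂ) * I).re = 0 := by simp
    have e2 : ((t : ℂ) * I).im = t := by simp
    rw [e1, e2] at this
    simp only [Pi.sub_apply, zero_add]
    have e3 : 2 * M / d ^ 2 * (0 ^ 2 + t * (2 * d - t)) + N * (t * (d - t)) =
        (4 * M / d + N * d) * t - (2 * M / d ^ 2 + N) * t ^ 2 := by field_simp; ring
    have e4 : 0 ≤ (2 * M / d ^ 2 + N) * t ^ 2 := by positivity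
    linarith
  rw [map_neg] at hg
  have : 2 * M / d + N * d / 2 = (4 * M / d + N * d) / 2 := by ring
  rw [this]
  linarith

/-- A rotation by the unit number `-(I v)` turns the direction `I` into `v` and preserves the
Laplacian. The square of half-side `R/2` fits into the disc of radius `R`, hence the constants. -/
theorem fderiv_apply_le {u : ℂ → ℝ} {z₀ v : ℂ} {R M N : ℝ} (hR : 0 < R) (hv : ‖v‖ = 1)
    (hu : ∀ z ∈ Metric.closedBall z₀ R, ContDiffAt ℝ 2 u z)
    (hM : ∀ z ∈ Metric.closedBall z₀ R, |u z| ≤ M)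
    (hN : ∀ z ∈ Metric.closedBall z₀ R, |Laplacian.laplacian u z| < N) :
    fderiv ℝ u z₀ v ≤ 4 * M / R + N * R / 4 := by
  have hF : ∀ w : ℂ, HasDerivAt (fun w => z₀ + -(I * v) * w) (-(I * v)) w := fun w => by
    simpa using ((hasDerivAt_id w).const_mul (-(I * v))).const_add z₀
  have hmem : ∀ z : ℂ, |z.re| ≤ R / 2 → |z.im| ≤ R / 2 →
      z₀ + -(I * v) * z ∈ Metric.closedBall z₀ R := by
    intro z h1 h2
    rw [Metric.mem_closedBall, dist_eq_norm, add_sub_cancel_left, norm_mul, norm_neg, norm_mul, hv,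
      Complex.norm_I, one_mul, one_mul]
    exact (Complex.norm_le_abs_re_add_abs_im z).trans (by linarith)
  have hn : ‖-(I * v)‖ = 1 := by rw [norm_neg, norm_mul, hv, Complex.norm_I, one_mul]
  have hcomp : ∀ z : ℂ, |z.re| ≤ R / 2 → |z.im| ≤ R / 2 → _ := fun z h1 h2 =>
    laplacian_comp_holomorphic (u := u) (F := fun w => z₀ + -(I * v) * w) (z := z)
      (F' := fun _ => -(I * v)) (.of_forall hF) (differentiableAt_const _) (hu _ (hmem z h1 h2))
  have key := fderiv_I_le (u := fun w => u (z₀ + -(I * v) * w)) (d := R / 2) (M := M) (N := N)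
    (by linarith) (fun z h1 h2 => (hcomp z h1 h2).1) (fun z h1 h2 => hM _ (hmem z h1 h2))
    (fun z h1 h2 => by
      rw [(hcomp z h1 h2).2, hn, one_pow, mul_one]
      exact hN _ (hmem z h1 h2))
  have hd : DifferentiableAt ℝ u (z₀ + -(I * v) * 0) := by
    simpa using (hu z₀ (Metric.mem_closedBall_self hR.le)).differentiableAt (by simp)
  have hd' : HasFDerivAt (fun w => u (z₀ + -(I * v) * w)) _ 0 :=
    hd.hasFDerivAt.comp (0 : ℂ) (hF 0).complexToReal_fderiv
  rw [hd'.fderiv] at key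
  have e : -(I * v) * I = v := by linear_combination -v * Complex.I_mul_I
  simp only [ContinuousLinearMap.comp_apply, mul_zero, add_zero] at key
  have e2 : (-(I * v) • (1 : ℂ →L[ℝ] ℂ)) I = v := by simpa using e
  rw [e2] at key
  refine key.trans (le_of_eq ?_)
  field_simp
  ring

/-- Interior gradient estimate. -/
theorem norm_dz_le {u : ℂ → ℝ} {z₀ : ℂ} {R M N : ℝ} (hR : 0 < R)
    (hu : ∀ z ∈ Metric.closedBall z₀ R, ContDiffAt ℝ 2 u z)
    (hM : ∀ z ∈ Metric.closedBall z₀ R, |u z| ≤ M)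
    (hN : ∀ z ∈ Metric.closedBall z₀ R, |Laplacian.laplacian u z| < N) :
    ‖dz (fun w => (u w : ℂ)) z₀‖ ≤ 4 * M / R + N * R / 4 := by
  have key : ∀ v : ℂ, ‖v‖ = 1 → |fderiv ℝ u z₀ v| ≤ 4 * M / R + N * R / 4 := fun v hv =>
    abs_le'.2 ⟨fderiv_apply_le hR hv hu hM hN, by
      rw [← map_neg]; exact fderiv_apply_le hR (by rwa [norm_neg]) hu hM hN⟩
  have hd := (hu z₀ (Metric.mem_closedBall_self hR.le)).differentiableAt (by simp)
  have e : ∀ v, fderiv ℝ (fun w => (u w : ℂ)) z₀ v = (fderiv ℝ u z₀ v : ℂ) := fun v => by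
    have : HasFDerivAt (fun w => (u w : ℂ)) _ z₀ := Complex.ofRealCLM.hasFDerivAt.comp z₀ hd.hasFDerivAt
    rw [this.fderiv]; rfl
  rw [dz, e, e, norm_div, Complex.norm_ofNat, div_le_iff₀ two_pos]
  refine (norm_sub_le _ _).trans ?_
  rw [norm_mul, Complex.norm_I, one_mul, Complex.norm_real, Complex.norm_real]
  have h1 := key 1 (by simp)
  have h2 := key I (by simp)
  simp only [Real.norm_eq_abs]
  linarith

/-! ### Gradient asymptotics in a half plane -/

/-- This filter is `Re s → -∞` with `Im s` unrestricted; limits along it are uniform in the argument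
`θ = Im s`. -/
theorem eventually_comap_re_atBot {p : ℂ → Prop} :
    (∀ᶠ s in comap Complex.re atBot, p s) ↔ ∃ T : ℝ, ∀ s : ℂ, s.re ≤ T → p s := by
  rw [(atBot_basis.comap Complex.re).eventually_iff]
  simp

theorem laplacian_sub_const {u : ℂ → ℝ} {z : ℂ} (hu : ContDiffAt ℝ 2 u z) (e : ℝ) :
    ContDiffAt ℝ 2 (fun w => u w - e) z ∧
    Laplacian.laplacian (fun w => u w - e) z = Laplacian.laplacian u z := by
  refine ⟨hu.sub contDiffAt_const, ?_⟩
  have := laplacian_sub_quadPoly hu 0 0 0 0 e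
  simpa [quadPoly] using this

theorem dz_sub_const {u : ℂ → ℝ} {z : ℂ} (hu : DifferentiableAt ℝ u z) (e : ℝ) :
    dz (fun w => ((u w - e : ℝ) : ℂ)) z = dz (fun w => (u w : ℂ)) z := by
  have h := ((hasWirtingerAt_ofReal hu).sub (.const (e : ℂ) z)).dz_eq
  push_cast
  rw [h, sub_zero]

theorem abs_re_sub_le_of_mem_closedBall {s t : ℂ} {r : ℝ} (h : t ∈ Metric.closedBall s r) :
    |t.re - s.re| ≤ r := by
  rw [← Complex.sub_re]
  exact (Complex.abs_re_le_norm _).trans (by simpa [dist_eq_norm] using h)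

/-- The gradient estimate is applied to `u - A` on unit discs, which stay in the half plane and on
which both `u - A` and `Δu` are uniformly small. -/
theorem tendsto_dz_of_tendsto_laplacian {u : ℂ → ℝ} {A : ℝ}
    (hs : ∀ᶠ s in comap Complex.re atBot, ContDiffAt ℝ 2 u s)
    (hu : Tendsto u (comap Complex.re atBot) (𝓝 A))
    (hΔ : Tendsto (Laplacian.laplacian u) (comap Complex.re atBot) (𝓝 0)) :
    Tendsto (dz fun w => (u w : ℂ)) (comap Complex.re atBot) (𝓝 0) := by
  rw [Metric.tendsto_nhds] at hu hΔ ⊢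
  intro ε hε
  obtain ⟨T, hT⟩ := eventually_comap_re_atBot.1
    ((hs.and (hu (ε / 8) (by positivity))).and (hΔ (ε / 8) (by positivity)))
  refine eventually_comap_re_atBot.2 ⟨T - 1, fun s hsT => ?_⟩
  have hball : ∀ t ∈ Metric.closedBall s 1, t.re ≤ T := fun t ht => by
    have := (abs_le.1 (abs_re_sub_le_of_mem_closedBall ht)).2
    linarith
  have hd := fun t ht => laplacian_sub_const (hT t (hball t ht)).1.1 A
  have h := norm_dz_le (u := fun w => u w - A) (z₀ := s) (M := ε / 8) (N := ε / 8) one_pos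
    (fun t ht => (hd t ht).1)
    (fun t ht => by simpa [Real.dist_eq] using (hT t (hball t ht)).1.2.le)
    (fun t ht => by
      rw [(hd t ht).2]
      simpa [Real.dist_eq] using (hT t (hball t ht)).2)
  rw [dz_sub_const ((hT s (by linarith)).1.1.differentiableAt (by simp))] at h
  rw [dist_zero_right]
  linarith

/-- Scale-invariant version: the gradient estimate is used on discs whose radius is proportional to
the distance to the imaginary axis, which gains the factor `Re s`. -/
theorem tendsto_re_mul_dz_of_tendsto_laplacian {u : ℂ → ℝ} {A : ℝ}
    (hs : ∀ᶠ s in comap Complex.re atBot, ContDiffAt ℝ 2 u s)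
    (hu : Tendsto u (comap Complex.re atBot) (𝓝 A))
    (hΔ : Tendsto (fun s => s.re ^ 2 * Laplacian.laplacian u s) (comap Complex.re atBot) (𝓝 0)) :
    Tendsto (fun s => (s.re : ℂ) * dz (fun w => (u w : ℂ)) s) (comap Complex.re atBot) (𝓝 0) := by
  rw [Metric.tendsto_nhds] at hu hΔ ⊢
  intro ε hε
  obtain ⟨T, hT⟩ := eventually_comap_re_atBot.1
    ((hs.and (hu (ε / 16) (by positivity))).and (hΔ (ε / 16) (by positivity)))
  refine eventually_comap_re_atBot.2 ⟨min (2 * T) (-1), fun s hsT => ?_⟩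
  have hs1 : s.re ≤ 2 * T := hsT.trans (min_le_left _ _)
  have hs2 : s.re ≤ -1 := hsT.trans (min_le_right _ _)
  -- With half the distance as radius, `|Re t| ≥ R` on the whole disc, so the hypothesis on `(Re t)²
  -- Δu` bounds `|Δu|` by a small multiple of `R⁻²`.
  set R := -s.re / 2 with hR
  have hR0 : 0 < R := by rw [hR]; linarith
  have hre : s.re = -(2 * R) := by rw [hR]; ring
  have hball : ∀ t ∈ Metric.closedBall s R, t.re ≤ -R := fun t ht => by
    have := (abs_le.1 (abs_re_sub_le_of_mem_closedBall ht)).2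
    linarith
  have hballT : ∀ t ∈ Metric.closedBall s R, t.re ≤ T := fun t ht =>
    (hball t ht).trans (by linarith)
  have hd := fun t ht => laplacian_sub_const (hT t (hballT t ht)).1.1 A
  have h := norm_dz_le (u := fun w => u w - A) (z₀ := s) (M := ε / 16) (N := ε / 16 / R ^ 2) hR0
    (fun t ht => (hd t ht).1)
    (fun t ht => by simpa [Real.dist_eq] using (hT t (hballT t ht)).1.2.le)
    (fun t ht => by
      rw [(hd t ht).2, lt_div_iff₀ (by positivity)]
      have h1 := (hT t (hballT t ht)).2
      rw [Real.dist_eq, sub_zero, abs_mul, abs_of_nonneg (sq_nonneg _)] at h1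
      have h2 : R ^ 2 ≤ t.re ^ 2 := by nlinarith [hball t ht]
      nlinarith [abs_nonneg (Laplacian.laplacian u t)])
  have hs0 : ContDiffAt ℝ 2 u s := (hT s (hballT s (Metric.mem_closedBall_self hR0.le))).1.1
  rw [dz_sub_const (hs0.differentiableAt (by simp))] at h
  rw [dist_zero_right, norm_mul, Complex.norm_real, Real.norm_eq_abs, hre, abs_neg,
    abs_of_pos (by positivity)]
  calc 2 * R * ‖dz (fun w => (u w : ℂ)) s‖
      ≤ 2 * R * (4 * (ε / 16) / R + ε / 16 / R ^ 2 * R / 4) := by gcongr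
    _ = ε / 2 + ε / 32 := by field_simp; ring
    _ < ε := by linarith

/-- If `κ > 0`, then `Δu ≥ κ/(18R²)` on the disc of radius `R` about `-2R`, where `|Re t| ≤ 3R`.
Then `u` would have to rise by `κ/72` above its central value, but far out it oscillates by less
than `κ/100`. -/
theorem nonpos_of_tendsto_laplacian {u : ℂ → ℝ} {A κ : ℝ}
    (hs : ∀ᶠ s in comap Complex.re atBot, ContDiffAt ℝ 2 u s)
    (hu : Tendsto u (comap Complex.re atBot) (𝓝 A))
    (hΔ : Tendsto (fun s => s.re ^ 2 * Laplacian.laplacian u s) (comap Complex.re atBot) (𝓝 κ)) :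
    κ ≤ 0 := by
  by_contra! hκ
  rw [Metric.tendsto_nhds] at hu
  obtain ⟨T, hT⟩ := eventually_comap_re_atBot.1
    ((hs.and (hu (κ / 200) (by positivity))).and (hΔ.eventually (lt_mem_nhds (half_lt_self hκ))))
  set R := max (-T) 1 with hR
  have hR0 : 0 < R := lt_max_of_lt_right one_pos
  have hRT : -R ≤ T := by linarith [le_max_left (-T) 1]
  set s : ℂ := ((-(2 * R) : ℝ) : ℂ) with hsdef
  have hre : s.re = -(2 * R) := Complex.ofReal_re _
  have hball : ∀ t ∈ Metric.closedBall s R, -(3 * R) ≤ t.re ∧ t.re ≤ -R := fun t ht => by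
    have := abs_le.1 (abs_re_sub_le_of_mem_closedBall ht)
    rw [hre] at this
    constructor <;> linarith
  have hballT : ∀ t ∈ Metric.closedBall s R, t.re ≤ T := fun t ht =>
    (hball t ht).2.trans hRT
  have h := add_le_of_lt_laplacian (u := u) (z₀ := s) (ε := κ / 2 / (9 * R ^ 2)) (M := A + κ / 200)
    hR0 (fun t ht => (hT t (hballT t ht)).1.1)
    (fun t ht => by
      have h1 := (hT t (hballT t ht)).2
      rw [div_lt_iff₀ (by positivity)]
      have h2 : t.re ^ 2 ≤ 9 * R ^ 2 := by nlinarith [hball t ht]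
      have h3 : 0 < t.re ^ 2 := by
        have : t.re ≠ 0 := fun h => by linarith [hball t ht]
        positivity
      have h4 : 0 < Laplacian.laplacian u t := by
        by_contra! hneg
        nlinarith
      nlinarith)
    (fun t ht => by
      have := (hT t (hballT t ht)).1.2
      rw [Real.dist_eq, abs_lt] at this
      linarith)
  have h2 := (hT s (hballT s (Metric.mem_closedBall_self hR0.le))).1.2
  rw [Real.dist_eq, abs_lt] at h2
  have e : κ / 2 / (9 * R ^ 2) * R ^ 2 / 4 = κ / 72 := by field_simp; norm_num
  rw [e] at h
  linarith

theorem eq_zero_of_tendsto_laplacian {u : ℂ → ℝ} {A κ : ℝ}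
    (hs : ∀ᶠ s in comap Complex.re atBot, ContDiffAt ℝ 2 u s)
    (hu : Tendsto u (comap Complex.re atBot) (𝓝 A))
    (hΔ : Tendsto (fun s => s.re ^ 2 * Laplacian.laplacian u s) (comap Complex.re atBot) (𝓝 κ)) :
    κ = 0 := by
  refine le_antisymm (nonpos_of_tendsto_laplacian hs hu hΔ) ?_
  have h : Laplacian.laplacian (-u) = -Laplacian.laplacian u := InnerProductSpace.laplacian_neg
  have := nonpos_of_tendsto_laplacian (u := -u) (κ := -κ) (hs.mono fun s h => h.neg) hu.neg (by
    rw [h]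
    simpa using hΔ.neg)
  linarith

/-! ### Logarithmic coordinates -/

theorem hasWirtingerAt_comp_re {φ : ℝ → ℝ} {φ' : ℝ} {s : ℂ} (h : HasDerivAt φ φ' s.re) :
    HasWirtingerAt (fun s => (φ s.re : ℂ)) (φ' / 2) (φ' / 2) s := by
  have h1 : HasFDerivAt (fun s : ℂ => φ s.re) _ s :=
    h.comp_hasFDerivAt s Complex.reCLM.hasFDerivAt
  have h2 : HasFDerivAt (fun s : ℂ => (φ s.re : ℂ)) _ s :=
    Complex.ofRealCLM.hasFDerivAt.comp s h1
  refine h2.hasWirtingerAt fun v => ?_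
  have : (v.re : ℂ) = (v + conj v) / 2 := by
    rw [Complex.add_conj]; push_cast; ring
  simp [this]; ring

theorem laplacian_comp_re {φ φ' : ℝ → ℝ} {φ'' : ℝ} {s : ℂ} (hφ : ContDiffAt ℝ 2 φ s.re)
    (h : ∀ᶠ x in 𝓝 s.re, HasDerivAt φ (φ' x) x) (h' : HasDerivAt φ' φ'' s.re) :
    ContDiffAt ℝ 2 (fun s : ℂ => φ s.re) s ∧
      Laplacian.laplacian (fun s : ℂ => φ s.re) s = φ'' := by
  have hc : ContDiffAt ℝ 2 (fun s : ℂ => φ s.re) s :=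
    ContDiffAt.comp s hφ Complex.reCLM.contDiff.contDiffAt
  refine ⟨hc, ?_⟩
  have e : dz (fun s : ℂ => (φ s.re : ℂ)) =ᶠ[𝓝 s] fun s => 1 / 2 * (φ' s.re : ℂ) := by
    filter_upwards [Complex.continuous_re.continuousAt.eventually h] with t ht
    rw [(hasWirtingerAt_comp_re ht).dz_eq]; ring
  have h1 := laplacian_eq_dzbar_dz hc
  rw [(((hasWirtingerAt_comp_re h').const_mul (1 / 2)).congr_of_eventuallyEq e).dzbar_eq] at h1
  have : ((Laplacian.laplacian (fun s : ℂ => φ s.re) s : ℝ) : ℂ) = (φ'' : ℂ) := by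
    rw [h1]; ring
  exact_mod_cast this

theorem tendsto_add_exp_comap_re (c : ℂ) :
    Tendsto (fun s => c + Complex.exp s) (comap Complex.re atBot) (𝓝[≠] c) := by
  refine tendsto_nhdsWithin_iff.2 ⟨?_, .of_forall fun s => by simp⟩
  simpa using (Complex.tendsto_exp_comap_re_atBot).const_add c

/-- Only `Re log(z - c) = log|z - c|` enters the filter, so the branch cut of the logarithm does no
harm. -/
theorem tendsto_log_sub_comap_re (c : ℂ) :
    Tendsto (fun z => Complex.log (z - c)) (𝓝[≠] c) (comap Complex.re atBot) := by
  rw [tendsto_comap_iff]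
  have h1 : Tendsto (fun z : ℂ => ‖z - c‖) (𝓝[≠] c) (𝓝[≠] 0) := by
    refine tendsto_nhdsWithin_iff.2 ⟨?_, ?_⟩
    · have : Continuous fun z : ℂ => ‖z - c‖ := by fun_prop
      simpa using (this.tendsto c).mono_left nhdsWithin_le_nhds
    · filter_upwards [self_mem_nhdsWithin] with z hz
      simpa [sub_eq_zero] using hz
  have h2 := Real.tendsto_log_nhdsNE_zero.comp h1
  refine h2.congr fun z => ?_
  simp [Complex.log_re]

/-- A property of the function in the logarithmic coordinate translates back. -/
theorem tendsto_of_tendsto_add_exp {E : Type*} {f : ℂ → E} {g : ℂ → E} {c : ℂ} {l : Filter E}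
    (h : Tendsto g (comap Complex.re atBot) l)
    (hfg : ∀ z, z ≠ c → g (Complex.log (z - c)) = f z) : Tendsto f (𝓝[≠] c) l := by
  refine (h.comp (tendsto_log_sub_comap_re c)).congr' ?_
  filter_upwards [self_mem_nhdsWithin] with z hz using hfg z hz

section Asymptotics

variable {L : ℂ → ℝ} {c : ℂ}

theorem laplacian_comp_add_exp (hL : ∀ᶠ z in 𝓝[≠] c, ContDiffAt ℝ 2 L z)
    (hΔ : ∀ᶠ z in 𝓝[≠] c, Laplacian.laplacian L z = 2 * Real.exp (L z)) :
    ∀ᶠ s in comap Complex.re atBot, ContDiffAt ℝ 2 L (c + Complex.exp s) ∧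
      ContDiffAt ℝ 2 (fun s => L (c + Complex.exp s)) s ∧
      Laplacian.laplacian (fun s => L (c + Complex.exp s)) s =
        2 * Real.exp (L (c + Complex.exp s)) * Real.exp s.re ^ 2 := by
  filter_upwards [(tendsto_add_exp_comap_re c).eventually (hL.and hΔ)] with s hs
  have hF : ∀ w, HasDerivAt (fun w => c + Complex.exp w) (Complex.exp w) w := fun w =>
    (Complex.hasDerivAt_exp w).const_add c
  have h := laplacian_comp_holomorphic (z := s) (.of_forall hF)
    Complex.differentiableAt_exp hs.1
  exact ⟨hs.1, h.1, by rw [h.2, hs.2, Complex.norm_exp]⟩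

theorem hasWirtingerAt_comp_add_exp_sub {φ : ℝ → ℝ} {φ' : ℝ} {s : ℂ}
    (hL : ContDiffAt ℝ 2 L (c + Complex.exp s)) (hφ : HasDerivAt φ φ' s.re) :
    dz (fun s => ((L (c + Complex.exp s) - φ s.re : ℝ) : ℂ)) s =
      dz (fun z => (L z : ℂ)) (c + Complex.exp s) * Complex.exp s - φ' / 2 := by
  have h1 := (hasWirtingerAt_ofReal (hL.differentiableAt (by simp))).comp_holomorphic
    (F := fun s => c + Complex.exp s) ((Complex.hasDerivAt_exp s).const_add c)
  push_cast
  exact (h1.sub (hasWirtingerAt_comp_re hφ)).dz_eq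

/-- The logarithmic gradient of a hyperbolic metric at a conical singularity. -/
theorem tendsto_mul_dz_of_conical (hL : ∀ᶠ z in 𝓝[≠] c, ContDiffAt ℝ 2 L z)
    (hΔ : ∀ᶠ z in 𝓝[≠] c, Laplacian.laplacian L z = 2 * Real.exp (L z)) {α C : ℝ} (hα : -1 < α)
    (hC : 0 < C) (h : Tendsto (fun z => Real.exp (L z) / ‖z - c‖ ^ (2 * α)) (𝓝[≠] c) (𝓝 C)) :
    Tendsto (fun z => (z - c) * dz (fun z => (L z : ℂ)) z) (𝓝[≠] c) (𝓝 α) := by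
  -- The model `2α Re s` is harmonic, so `Δu = 2 e^u e^((2α+2) Re s)`; this tends to 0 because `e^u`
  -- converges and `α > -1`.
  set u : ℂ → ℝ := fun s => L (c + Complex.exp s) - 2 * α * s.re with hu
  have hue : Tendsto (fun s => Real.exp (u s)) (comap Complex.re atBot) (𝓝 C) := by
    refine (h.comp (tendsto_add_exp_comap_re c)).congr fun s => ?_
    simp only [Function.comp_apply, add_sub_cancel_left, Complex.norm_exp, hu]
    rw [Real.exp_sub, ← Real.exp_mul, mul_comm s.re]
  have hut : Tendsto u (comap Complex.re atBot) (𝓝 (Real.log C)) :=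
    (hue.log hC.ne').congr fun s => Real.log_exp _
  have hlin : ∀ x : ℝ, HasDerivAt (fun x : ℝ => 2 * α * x) (2 * α) x := fun x => by
    simpa using (hasDerivAt_id x).const_mul (2 * α)
  have hcs := laplacian_comp_add_exp hL hΔ
  have hmodel : ∀ s : ℂ, _ := fun s => laplacian_comp_re (s := s) (φ := fun x => 2 * α * x)
    (contDiffAt_const.mul contDiffAt_id) (.of_forall hlin) (hasDerivAt_const _ _)
  have hus : ∀ᶠ s in comap Complex.re atBot, ContDiffAt ℝ 2 u s :=
    hcs.mono fun s hs => hs.2.1.sub (hmodel s).1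
  have hul : ∀ᶠ s in comap Complex.re atBot,
      Laplacian.laplacian u s = 2 * (Real.exp (u s) * Real.exp ((2 * α + 2) * s.re)) := by
    filter_upwards [hcs] with s hs
    have h1 := hs.2.1.laplacian_sub (hmodel s).1
    rw [hs.2.2, (hmodel s).2, sub_zero] at h1
    refine Eq.trans h1 ?_
    rw [mul_assoc, ← Real.exp_nat_mul, ← Real.exp_add, ← Real.exp_add]
    simp only [hu]
    congr 2
    push_cast
    ring
  have hlim : Tendsto (Laplacian.laplacian u) (comap Complex.re atBot) (𝓝 0) := by
    have h0 : Tendsto (fun s : ℂ => Real.exp ((2 * α + 2) * s.re)) (comap Complex.re atBot) (𝓝 0) :=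
      Real.tendsto_exp_atBot.comp (tendsto_comap.const_mul_atBot (by linarith))
    have := (hue.mul h0).const_mul 2
    rw [mul_zero, mul_zero] at this
    exact this.congr' (hul.mono fun s hs => hs.symm)
  have hdz := tendsto_dz_of_tendsto_laplacian hus hut hlim
  have hdz' : Tendsto (fun s => dz (fun z => (L z : ℂ)) (c + Complex.exp s) * Complex.exp s)
      (comap Complex.re atBot) (𝓝 α) := by
    have := hdz.add_const (α : ℂ)
    rw [zero_add] at this
    refine this.congr' ?_
    filter_upwards [hcs] with s hs
    have := hasWirtingerAt_comp_add_exp_sub hs.1 (hlin s.re)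
    simp only [hu]
    rw [this]; push_cast; ring
  refine tendsto_of_tendsto_add_exp hdz' fun z hz => ?_
  rw [Complex.exp_log (sub_ne_zero.2 hz), add_sub_cancel, mul_comm]

/-- The logarithmic gradient of a hyperbolic metric at a cusp, and the value of its leading
coefficient. -/
theorem tendsto_mul_dz_of_cusp (hL : ∀ᶠ z in 𝓝[≠] c, ContDiffAt ℝ 2 L z)
    (hΔ : ∀ᶠ z in 𝓝[≠] c, Laplacian.laplacian L z = 2 * Real.exp (L z)) {C : ℝ} (hC : 0 < C)
    (h : Tendsto (fun z => Real.exp (L z) * (‖z - c‖ * Real.log ‖z - c‖) ^ 2) (𝓝[≠] c) (𝓝 C)) :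
    C = 1 ∧ Tendsto (fun z => (Real.log ‖z - c‖ : ℂ) * ((z - c) * dz (fun z => (L z : ℂ)) z + 1
      + (Real.log ‖z - c‖ : ℂ)⁻¹)) (𝓝[≠] c) (𝓝 0) := by
  -- This is `log` of the model `(r log r)^(-2)` at `r = e^x`; its second derivative is `2/x²`.
  set φ : ℝ → ℝ := fun x => -2 * x - 2 * Real.log (-x) with hφ
  set u : ℂ → ℝ := fun s => L (c + Complex.exp s) - φ s.re with hu
  have hneg : ∀ᶠ s in comap Complex.re atBot, s.re < 0 :=
    tendsto_comap.eventually (eventually_lt_atBot 0)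
  have he : ∀ᶠ s in comap Complex.re atBot,
      Real.exp (u s) = Real.exp (L (c + Complex.exp s)) * (Real.exp s.re * s.re) ^ 2 := by
    filter_upwards [hneg] with s hs
    have h1 : Real.exp (-2 * s.re) = (Real.exp s.re ^ 2)⁻¹ := by
      rw [← Real.exp_nat_mul, ← Real.exp_neg]; congr 1; push_cast; ring
    have h2 : Real.exp (2 * Real.log (-s.re)) = s.re ^ 2 := by
      rw [mul_comm, Real.exp_mul, Real.exp_log (by linarith)]
      norm_num
    simp only [hu, hφ]
    rw [Real.exp_sub, Real.exp_sub, h1, h2]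
    have := hs.ne
    field_simp
  have hue : Tendsto (fun s => Real.exp (u s)) (comap Complex.re atBot) (𝓝 C) := by
    refine (h.comp (tendsto_add_exp_comap_re c)).congr' ?_
    filter_upwards [he] with s hs
    rw [hs]
    simp only [Function.comp_apply, add_sub_cancel_left, Complex.norm_exp, Real.log_exp]
  have hut : Tendsto u (comap Complex.re atBot) (𝓝 (Real.log C)) :=
    (hue.log hC.ne').congr fun s => Real.log_exp _
  have hφd : ∀ x < 0, HasDerivAt φ (-2 - 2 * x⁻¹) x := fun x hx => by
    have h1 := ((hasDerivAt_neg x).log (neg_pos.2 hx).ne')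
    refine (((hasDerivAt_id x).const_mul (-2)).sub (h1.const_mul 2)).congr_deriv ?_
    have := hx.ne
    field_simp
  have hφd2 : ∀ x < 0, HasDerivAt (fun x : ℝ => -2 - 2 * x⁻¹) (2 / x ^ 2) x := fun x hx => by
    refine (((hasDerivAt_inv hx.ne).const_mul 2).const_sub (-2)).congr_deriv ?_
    ring
  have hφs : ∀ x < 0, ContDiffAt ℝ 2 φ x := fun x hx =>
    (contDiffAt_const.mul contDiffAt_id).sub
      (contDiffAt_const.mul (contDiffAt_id.neg.log (neg_pos.2 hx).ne'))
  have hcs := laplacian_comp_add_exp hL hΔ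
  have hmodel : ∀ s : ℂ, s.re < 0 → _ := fun s hs => laplacian_comp_re (s := s) (φ := φ)
    (hφs _ hs) ((gt_mem_nhds hs).mono hφd) (hφd2 _ hs)
  have hus : ∀ᶠ s in comap Complex.re atBot, ContDiffAt ℝ 2 u s := by
    filter_upwards [hcs, hneg] with s hs hs0 using hs.2.1.sub (hmodel s hs0).1
  have hul : ∀ᶠ s in comap Complex.re atBot,
      2 * Real.exp (u s) - 2 = s.re ^ 2 * Laplacian.laplacian u s := by
    filter_upwards [hcs, hneg, he] with s hs hs0 hse
    have h1 := hs.2.1.laplacian_sub (hmodel s hs0).1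
    rw [hs.2.2, (hmodel s hs0).2] at h1
    have h2 : Laplacian.laplacian u s = _ := h1
    rw [h2, hse]
    have := hs0.ne
    field_simp
  have hlim := ((hue.const_mul 2).sub_const 2).congr' hul
  -- Here `(Re s)² Δu = 2e^u - 2` tends to `2C - 2`, and a nonzero limit is incompatible with the
  -- convergence of `u`.
  have hC1 : C = 1 := by
    have := eq_zero_of_tendsto_laplacian hus hut hlim
    linarith
  refine ⟨hC1, ?_⟩
  rw [hC1, show (2 : ℝ) * 1 - 2 = 0 by norm_num] at hlim
  have hdz := tendsto_re_mul_dz_of_tendsto_laplacian hus hut hlim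
  have hdz' : Tendsto (fun s => (s.re : ℂ) * (dz (fun z => (L z : ℂ)) (c + Complex.exp s)
      * Complex.exp s + 1 + (s.re : ℂ)⁻¹)) (comap Complex.re atBot) (𝓝 0) := by
    refine hdz.congr' ?_
    filter_upwards [hcs, hneg] with s hs hs0
    have := hasWirtingerAt_comp_add_exp_sub hs.1 (hφd _ hs0)
    simp only [hu]
    rw [this]; push_cast; ring
  refine tendsto_of_tendsto_add_exp hdz' fun z hz => ?_
  rw [Complex.exp_log (sub_ne_zero.2 hz), add_sub_cancel, mul_comm (z - c), Complex.log_re]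

end Asymptotics

/-! ### Connections of the form `a v w + d v̄ w̄` -/

/-- The `ℝ`-linear map sending `a` to the bilinear map `(v, w) ↦ a v w`. -/
def linearConnection : ℂ →L[ℝ] (ℂ →L[ℝ] ℂ →L[ℝ] ℂ) :=
  LinearMap.toContinuousLinearMap
    { toFun := fun a => a • ContinuousLinearMap.mul ℝ ℂ
      map_add' := fun a b => ContinuousLinearMap.ext fun v => ContinuousLinearMap.ext fun w => by
        simp; ring
      map_smul' := fun r a => ContinuousLinearMap.ext fun v => ContinuousLinearMap.ext fun w => by
        simp; ring }

/-- The `ℝ`-linear map sending `d` to the bilinear map `(v, w) ↦ d v̄ w̄`. -/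
def antilinearConnection : ℂ →L[ℝ] (ℂ →L[ℝ] ℂ →L[ℝ] ℂ) :=
  LinearMap.toContinuousLinearMap
    { toFun := fun d => d • (ContinuousLinearMap.mul ℝ ℂ).bilinearComp
        (Complex.conjCLE : ℂ →L[ℝ] ℂ) (Complex.conjCLE : ℂ →L[ℝ] ℂ)
      map_add' := fun a b => ContinuousLinearMap.ext fun v => ContinuousLinearMap.ext fun w => by
        simp; ring
      map_smul' := fun r a => ContinuousLinearMap.ext fun v => ContinuousLinearMap.ext fun w => by
        simp; ring }

theorem contDiff_linearConnection : ContDiff ℝ ∞ (fun a => linearConnection a) :=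
  ContinuousLinearMap.contDiff (𝕜 := ℝ) (E := ℂ) (F := ℂ →L[ℝ] ℂ →L[ℝ] ℂ) linearConnection

theorem contDiff_antilinearConnection : ContDiff ℝ ∞ (fun a => antilinearConnection a) :=
  ContinuousLinearMap.contDiff (𝕜 := ℝ) (E := ℂ) (F := ℂ →L[ℝ] ℂ →L[ℝ] ℂ) antilinearConnection

theorem hasFDerivAt_linearConnection (a : ℂ) :
    HasFDerivAt (fun a => linearConnection a) linearConnection a :=
  ContinuousLinearMap.hasFDerivAt (F := ℂ →L[ℝ] ℂ →L[ℝ] ℂ) linearConnection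

theorem hasFDerivAt_antilinearConnection (a : ℂ) :
    HasFDerivAt (fun a => antilinearConnection a) antilinearConnection a :=
  ContinuousLinearMap.hasFDerivAt (F := ℂ →L[ℝ] ℂ →L[ℝ] ℂ) antilinearConnection

/-- The bilinear map `(v, w) ↦ a v w + d v̄ w̄`. -/
def bilin (a d : ℂ) : ℂ →L[ℝ] ℂ →L[ℝ] ℂ := linearConnection a + antilinearConnection d

@[simp] theorem bilin_apply (a d v w : ℂ) : bilin a d v w = a * (v * w) + d * (conj v * conj w) := by
  simp [bilin, linearConnection, antilinearConnection]

/-- A symmetric real bilinear map has a part in `v w`, one in `v̄ w̄` and a mixed one in `v w̄ + v̄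
w`. The special condition at `(1, I)` yields `G I I = -G 1 1`, which removes the mixed part. -/
theorem exists_eq_bilin {G : ℂ →L[ℝ] ℂ →L[ℝ] ℂ} (hsymm : ∀ v w, G v w = G w v)
    (hspecial : ∀ v w, G v (I * w) - I * G v w = G w (I * v) - I * G w v) :
    ∃ a d, G = bilin a d := by
  refine ⟨(G 1 1 - I * G 1 I) / 2, (G 1 1 + I * G 1 I) / 2, ?_⟩
  have h1 : G I I = -G 1 1 := by
    have := hspecial 1 I
    rw [Complex.I_mul_I, map_neg, mul_one, hsymm I 1] at this
    linear_combination -this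
  refine ContinuousLinearMap.ext fun v => ContinuousLinearMap.ext fun w => ?_
  have hdec : ∀ v : ℂ, v = v.re • (1 : ℂ) + v.im • I := fun v => by simp [Complex.re_add_im]
  have e : G v w = (v.re * w.re - v.im * w.im) * G 1 1 + (v.re * w.im + v.im * w.re) * G 1 I := by
    conv_lhs => rw [hdec v, hdec w]
    simp only [map_add, map_smul, add_apply, smul_apply, h1, hsymm I 1]
    simp only [Complex.real_smul]
    ring
  have hc : ∀ v : ℂ, conj v = (v.re : ℂ) - v.im * I := fun v => by
    apply Complex.ext <;> simp
  rw [e, bilin_apply, hc v, hc w]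
  have hv : v * w = (v.re + v.im * I) * (w.re + w.im * I) := by
    rw [Complex.re_add_im, Complex.re_add_im]
  rw [hv]
  have hI := Complex.I_sq
  ring_nf
  simp only [hI]
  ring

/-- Complexified, `∇_{∂_z} ∂_z = a ∂_z + d̄ ∂_z̄`; the form `ω` kills the first term and `ω(∂_z,
∂_z̄) = iλ/2`. -/
theorem cubicCoeff_bilin (lam : ℝ) (a d : ℂ) :
    cubicCoeff lam (bilin a d) = -(I / 2) * lam * conj d := by
  apply Complex.ext <;>
  · simp [cubicCoeff, Fin.sum_univ_two, kahlerForm, pow_succ]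
    ring

/-- The sum is the trace of `w ↦ ∇_u w` times `ω`. The antilinear part has trace zero, so `∇ω = 0`
constrains `a` alone and means `a = ∂ log λ`. -/
theorem kahlerForm_bilin (lam : ℝ) (a d u v w : ℂ) :
    kahlerForm lam (bilin a d u v) w + kahlerForm lam v (bilin a d u w) =
      kahlerForm (2 * lam * (a * u).re) v w := by
  simp [kahlerForm]
  ring

theorem kahlerForm_one_I (lam : ℝ) : kahlerForm lam 1 I = lam := by simp [kahlerForm]

theorem eq_of_forall_re_mul_eq {a b : ℂ} (h : ∀ u : ℂ, (a * u).re = (b * u).re) : a = b := by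
  have h1 := h 1
  have h2 := h I
  simp at h1 h2
  exact Complex.ext h1 h2

/-- Conjugation inside the real part turns the antilinear term into one that is bilinear in `u`,
`v`, so the condition for the real 1-form `Re(p dz)` to be parallel becomes one complex equation. -/
theorem parallel_bilin_iff {p p' a d : ℂ} :
    (∀ u v : ℂ, (p' * u * v).re - (p * bilin a d u v).re = 0) ↔
      p' = a * p + conj d * conj p := by
  have key : ∀ u v : ℂ, (p' * u * v).re - (p * bilin a d u v).re =
      ((p' - (a * p + conj d * conj p)) * (u * v)).re := by
    intro u v
    have : (p * (d * (conj u * conj v))).re = (conj d * conj p * (u * v)).re := by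
      rw [← Complex.conj_re]
      congr 1
      simp only [map_mul, Complex.conj_conj]
      ring
    rw [bilin_apply, mul_add, Complex.add_re, this]
    rw [← Complex.add_re, ← Complex.sub_re]
    congr 1
    ring
  simp only [key]
  constructor
  · intro h
    refine sub_eq_zero.1 (eq_of_forall_re_mul_eq fun u => ?_)
    simpa using h 1 u
  · intro h u v
    rw [h, sub_self, zero_mul, Complex.zero_re]

/-! ### The special Kähler structure on an open subset of the plane -/

/-- A nowhere vanishing holomorphic cubic form `xi dz ^ 3` and a hyperbolic metric `h |dz| ^ 2` on an
open subset of the plane. -/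
structure IsPlanarData (O : Set ℂ) (xi : ℂ → ℂ) (h : ℂ → ℝ) : Prop where
  isOpen : IsOpen O
  holo : DifferentiableOn ℂ xi O
  ne_zero : ∀ z ∈ O, xi z ≠ 0
  smooth : ContDiffOn ℝ ∞ h O
  pos : ∀ z ∈ O, 0 < h z
  curvature : ∀ z ∈ O, gaussCurvature h z = -1

/-- The conformal factor `4 |xi| h ^ (-1 / 2)` of the special Kähler metric. -/
def skFactor (xi : ℂ → ℂ) (h : ℂ → ℝ) (z : ℂ) : ℝ := 4 * ‖xi z‖ / √(h z)

/-- The `(1, 0)`-part of the special Kähler connection. -/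
def skLinear (xi : ℂ → ℂ) (h : ℂ → ℝ) (z : ℂ) : ℂ :=
  dz (fun w => (Real.log (skFactor xi h w) : ℂ)) z

/-- The complex antilinear part of the special Kähler connection. -/
def skAntilinear (xi : ℂ → ℂ) (h : ℂ → ℝ) (z : ℂ) : ℂ := -2 * I * conj (xi z) / skFactor xi h z

/-- The special Kähler connection. -/
def skConnection (xi : ℂ → ℂ) (h : ℂ → ℝ) (z : ℂ) : ℂ →L[ℝ] ℂ →L[ℝ] ℂ :=
  bilin (skLinear xi h z) (skAntilinear xi h z)

namespace IsPlanarData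

variable {O : Set ℂ} {xi : ℂ → ℂ} {h : ℂ → ℝ} (H : IsPlanarData O xi h) {z : ℂ}
include H

theorem factor_pos (hz : z ∈ O) : 0 < skFactor xi h z := by
  have h1 := norm_pos_iff.2 (H.ne_zero z hz)
  have h2 := Real.sqrt_pos.2 (H.pos z hz)
  unfold skFactor
  positivity

theorem contDiffOn_log : ContDiffOn ℝ ∞ (fun z => Real.log (h z)) O :=
  H.smooth.log fun _ hz => (H.pos _ hz).ne'

theorem laplacian_log (hz : z ∈ O) :
    Laplacian.laplacian (fun z => Real.log (h z)) z = 2 * Real.exp (Real.log (h z)) := by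
  have h1 := H.curvature z hz
  have h2 := H.pos z hz
  rw [Real.exp_log h2]
  rw [gaussCurvature, div_eq_iff (by positivity)] at h1
  linarith

theorem log_factor (hz : z ∈ O) :
    Real.log (skFactor xi h z) = (Real.log 4 + Real.log ‖xi z‖) - 2⁻¹ * Real.log (h z) := by
  have h1 := norm_pos_iff.2 (H.ne_zero z hz)
  have h2 := Real.sqrt_pos.2 (H.pos z hz)
  rw [skFactor, Real.log_div (by positivity) h2.ne', Real.log_mul (by norm_num) h1.ne',
    Real.log_sqrt (H.pos z hz).le]
  ring

theorem contDiffOn_holo : ContDiffOn ℝ ∞ xi O := fun _ hz =>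
  (((H.holo.contDiffOn H.isOpen (n := ∞)).contDiffAt
    (H.isOpen.mem_nhds hz)).restrict_scalars ℝ).contDiffWithinAt

theorem contDiffOn_factor : ContDiffOn ℝ ∞ (skFactor xi h) O :=
  (contDiffOn_const.mul (H.contDiffOn_holo.norm ℝ H.ne_zero)).div
    (H.smooth.sqrt fun z hz => (H.pos z hz).ne') fun z hz => (Real.sqrt_pos.2 (H.pos z hz)).ne'

theorem contDiffOn_log_factor : ContDiffOn ℝ ∞ (fun z => Real.log (skFactor xi h z)) O :=
  H.contDiffOn_factor.log fun _ hz => (H.factor_pos hz).ne'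

theorem contDiffOn_linear : ContDiffOn ℝ ∞ (skLinear xi h) O :=
  (contDiffOn_ofReal H.contDiffOn_log_factor).dz H.isOpen

theorem contDiffOn_antilinear : ContDiffOn ℝ ∞ (skAntilinear xi h) O := by
  have h1 : ContDiffOn ℝ ∞ (fun z => conj (xi z)) O :=
    Complex.conjCLE.contDiff.comp_contDiffOn H.contDiffOn_holo
  have h2 : ContDiffOn ℝ ∞ (fun z => (skFactor xi h z : ℂ)⁻¹) O :=
    (contDiffOn_ofReal H.contDiffOn_factor).inv fun z hz =>
      Complex.ofReal_ne_zero.2 (H.factor_pos hz).ne'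
  exact ((contDiffOn_const (c := -2 * I)).mul h1).mul h2

theorem contDiffOn_connection : ContDiffOn ℝ ∞ (skConnection xi h) O := by
  have h1 : ContDiffOn ℝ ∞ (fun z => linearConnection (skLinear xi h z)) O :=
    contDiff_linearConnection.comp_contDiffOn H.contDiffOn_linear
  have h2 : ContDiffOn ℝ ∞ (fun z => antilinearConnection (skAntilinear xi h z)) O :=
    contDiff_antilinearConnection.comp_contDiffOn H.contDiffOn_antilinear
  exact h1.add h2

theorem hasWirtingerAt_log_factor (hz : z ∈ O) :
    HasWirtingerAt (fun w => (Real.log (skFactor xi h w) : ℂ)) (skLinear xi h z)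
      (conj (skLinear xi h z)) z :=
  hasWirtingerAt_ofReal
    ((H.contDiffOn_log_factor.contDiffAt (H.isOpen.mem_nhds hz)).differentiableAt (by simp))

theorem hasWirtingerAt_factor (hz : z ∈ O) :
    HasWirtingerAt (fun w => (skFactor xi h w : ℂ)) (skFactor xi h z * skLinear xi h z)
      (skFactor xi h z * conj (skLinear xi h z)) z := by
  have h1 := HasWirtingerAt.comp_hasDerivAt (Complex.hasDerivAt_exp _)
    (H.hasWirtingerAt_log_factor hz)
  have e : ∀ w ∈ O, Complex.exp (Real.log (skFactor xi h w) : ℂ) = skFactor xi h w := fun w hw => by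
    rw [← Complex.ofReal_exp, Real.exp_log (H.factor_pos hw)]
  rw [e z hz] at h1
  exact h1.congr_of_eventuallyEq ((Filter.eventually_of_mem (H.isOpen.mem_nhds hz) e).mono
    fun _ h => h.symm)

/-- The exponent and the constant in `4|xi| h^(-1/2)` are made for this identity, which ties the
size of the antilinear part to the hyperbolic metric alone. -/
theorem antilinear_mul_conj (hz : z ∈ O) :
    skAntilinear xi h z * conj (skAntilinear xi h z) = (h z : ℂ) / 4 := by
  have h1 := norm_pos_iff.2 (H.ne_zero z hz)
  have h2 := Real.sqrt_pos.2 (H.pos z hz)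
  have h3 : ‖skAntilinear xi h z‖ = √(h z) / 2 := by
    rw [skAntilinear, norm_div, norm_mul, Complex.norm_conj, Complex.norm_real, Real.norm_eq_abs,
      abs_of_pos (H.factor_pos hz), skFactor]
    simp
    field_simp
    norm_num
  rw [Complex.mul_conj', h3]
  norm_cast
  rw [div_pow, Real.sq_sqrt (H.pos z hz).le]
  norm_num

/-- The half of flatness that uses curvature: `log|xi|` is harmonic, so `∂̄∂ log λ` is `-1/8` times
`Δ log h = 2h`. -/
theorem dzbar_linear (hz : z ∈ O) :
    dzbar (skLinear xi h) z = -(skAntilinear xi h z * conj (skAntilinear xi h z)) := by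
  rw [H.antilinear_mul_conj hz]
  have hU := H.isOpen.mem_nhds hz
  have e := laplacian_eq_dzbar_dz
    ((H.contDiffOn_log_factor.contDiffAt hU).of_le (m := 2) (by norm_cast))
  have harm := (H.holo.analyticAt hU).harmonicAt_log_norm (H.ne_zero z hz)
  have h1 : ContDiffAt ℝ 2 (fun z => Real.log 4 + Real.log ‖xi z‖) z :=
    contDiffAt_const.add harm.1
  have h2 : ContDiffAt ℝ 2 (fun z => Real.log (h z)) z :=
    (H.contDiffOn_log.contDiffAt hU).of_le (by norm_cast)
  have e1 : Laplacian.laplacian (fun z => Real.log 4 + Real.log ‖xi z‖) z = 0 := by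
    have := (contDiffAt_const (c := Real.log 4) (x := z)).laplacian_add harm.1
    rw [harm.2.self_of_nhds] at this
    refine Eq.trans this ?_
    rw [InnerProductSpace.laplacian_const]
    simp
  have e2 : Laplacian.laplacian (fun z => 2⁻¹ * Real.log (h z)) z = h z := by
    have := InnerProductSpace.laplacian_smul (2⁻¹ : ℝ) h2
    rw [H.laplacian_log hz, Real.exp_log (H.pos z hz)] at this
    refine Eq.trans this ?_
    simp
  have e3 := h1.laplacian_sub (contDiffAt_const.mul h2 : ContDiffAt ℝ 2 (fun z => 2⁻¹ * Real.log (h z)) z)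
  rw [e1, e2] at e3
  have e4 : Laplacian.laplacian (fun z => Real.log (skFactor xi h z)) z = 0 - h z := by
    rw [← e3]
    exact (InnerProductSpace.laplacian_congr_nhds
      (Filter.eventually_of_mem hU fun w hw => H.log_factor hw)).self_of_nhds
  rw [e4] at e
  push_cast at e
  have e5 : dzbar (skLinear xi h) z = -(h z : ℂ) / 4 := by
    change dzbar (dz _) z = _
    linear_combination -e / 4
  rw [e5]; ring

/-- The half of flatness that uses holomorphy: `λd` is a multiple of the conjugate of `xi`, hence
killed by `∂`, and `∂λ = λa`. -/
theorem dz_antilinear (hz : z ∈ O) :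
    dz (skAntilinear xi h) z = -(skLinear xi h z * skAntilinear xi h z) := by
  have h1 := (HasWirtingerAt.of_hasDerivAt
    (H.holo.differentiableAt (H.isOpen.mem_nhds hz)).hasDerivAt).star
  have hne : (skFactor xi h z : ℂ) ≠ 0 := Complex.ofReal_ne_zero.2 (H.factor_pos hz).ne'
  have h2 := (h1.const_mul (-2 * I)).mul ((H.hasWirtingerAt_factor hz).inv hne)
  have h3 := h2.dz_eq
  simp only [← div_eq_mul_inv] at h3
  refine h3.trans ?_
  rw [skAntilinear, map_zero]
  field_simp
  ring

/-- In the curvature of `a v w + d v̄ w̄` everything cancels except `∂̄a + |d|²` and `∂d + a d` with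
their coefficients, and both vanish. -/
theorem flat (hz : z ∈ O) (u v w : ℂ) :
    fderiv ℝ (skConnection xi h) z u v w - fderiv ℝ (skConnection xi h) z v u w
      + skConnection xi h z u (skConnection xi h z v w)
      - skConnection xi h z v (skConnection xi h z u w) = 0 := by
  have hU := H.isOpen.mem_nhds hz
  have ha := HasWirtingerAt.of_fderiv
    ((H.contDiffOn_linear.contDiffAt hU).differentiableAt (by simp))
  have hd := HasWirtingerAt.of_fderiv
    ((H.contDiffOn_antilinear.contDiffAt hU).differentiableAt (by simp))
  rw [H.dzbar_linear hz] at ha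
  rw [H.dz_antilinear hz] at hd
  have h1 := HasFDerivAt.comp (G := ℂ →L[ℝ] ℂ →L[ℝ] ℂ) z
    (hasFDerivAt_linearConnection (skLinear xi h z)) ha
  have h2 := HasFDerivAt.comp (G := ℂ →L[ℝ] ℂ →L[ℝ] ℂ) z
    (hasFDerivAt_antilinearConnection (skAntilinear xi h z)) hd
  have hΓ := h1.add h2
  have hf : fderiv ℝ (skConnection xi h) z = _ := hΓ.fderiv
  rw [hf]
  simp [linearConnection, antilinearConnection, skConnection]
  ring

theorem symplectic (hz : z ∈ O) (u v w : ℂ) :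
    kahlerForm (fderiv ℝ (skFactor xi h) z u) v w =
      kahlerForm (skFactor xi h z) (skConnection xi h z u v) w +
        kahlerForm (skFactor xi h z) v (skConnection xi h z u w) := by
  rw [skConnection, kahlerForm_bilin]
  congr 1
  have h1 : DifferentiableAt ℝ (skFactor xi h) z :=
    (H.contDiffOn_factor.contDiffAt (H.isOpen.mem_nhds hz)).differentiableAt (by simp)
  have h2 : HasFDerivAt (fun w => (skFactor xi h w : ℂ)) _ z :=
    Complex.ofRealCLM.hasFDerivAt.comp z h1.hasFDerivAt
  have h3 := congrArg (fun T => (T u).re) (h2.unique (H.hasWirtingerAt_factor hz))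
  simp only [ContinuousLinearMap.comp_apply, Complex.ofRealCLM_apply, Complex.ofReal_re,
    wirtingerMap_apply] at h3
  rw [h3]
  simp
  ring

theorem cubicCoeff_eq (hz : z ∈ O) : cubicCoeff (skFactor xi h z) (skConnection xi h z) = xi z := by
  rw [skConnection, cubicCoeff_bilin, skAntilinear]
  have hne : (skFactor xi h z : ℂ) ≠ 0 := Complex.ofReal_ne_zero.2 (H.factor_pos hz).ne'
  simp only [map_div₀, map_mul, map_neg, Complex.conj_I, Complex.conj_conj, Complex.conj_ofReal,
    map_ofNat]
  field_simp
  linear_combination -(xi z) * Complex.I_sq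

end IsPlanarData

/-- After division by `f z₀` the values near `z₀` stay in the slit plane, so the principal logarithm
applies; the constant `c` restores a square root of `f z₀`. -/
theorem exists_holomorphic_sqrt {f : ℂ → ℂ} {z₀ : ℂ} {r : ℝ} (hr : 0 < r)
    (hf : DifferentiableOn ℂ f (Metric.ball z₀ r)) (h0 : f z₀ ≠ 0) :
    ∃ r', 0 < r' ∧ r' ≤ r ∧ ∃ p : ℂ → ℂ, DifferentiableOn ℂ p (Metric.ball z₀ r') ∧
      ∀ z ∈ Metric.ball z₀ r', p z ^ 2 = f z := by
  obtain ⟨c, hc⟩ := IsAlgClosed.exists_pow_nat_eq (f z₀) two_pos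
  have hcont : ContinuousAt (fun z => f z / f z₀) z₀ :=
    ((hf.differentiableAt (Metric.ball_mem_nhds z₀ hr)).div_const _).continuousAt
  obtain ⟨δ, hδ, hδs⟩ := Metric.eventually_nhds_iff_ball.1 (hcont.eventually
    (Complex.isOpen_slitPlane.mem_nhds (by
      simp only [div_self h0]; exact Complex.one_mem_slitPlane)))
  refine ⟨min δ r, by positivity, min_le_right _ _,
    fun z => c * Complex.exp (Complex.log (f z / f z₀) / 2), ?_, ?_⟩
  · intro z hz
    have h1 := (hf.differentiableAt (Metric.isOpen_ball.mem_nhds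
      (Metric.ball_subset_ball (min_le_right _ _) hz))).div_const (f z₀)
    have h2 := hδs z (Metric.ball_subset_ball (min_le_left _ _) hz)
    exact (((h1.clog h2).div_const 2).cexp.const_mul c).differentiableWithinAt
  · intro z hz
    have h2 := hδs z (Metric.ball_subset_ball (min_le_left _ _) hz)
    rw [mul_pow, hc, ← Complex.exp_nat_mul]
    push_cast
    rw [mul_div_cancel₀ _ two_ne_zero, Complex.exp_log (Complex.slitPlane_ne_zero h2)]
    field_simp

namespace IsPlanarData

variable {O : Set ℂ} {xi : ℂ → ℂ} {h : ℂ → ℝ} (H : IsPlanarData O xi h) {z₀ : ℂ}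
include H

/-- The function `p` is to become `dZ/dz`. The relation `p² τ' = 4 xi` is imposed because every
conjugate pair with period map `τ` and cubic form `xi` satisfies it. -/
theorem exists_local_square_root (hz₀ : z₀ ∈ O) :
    ∃ r, 0 < r ∧ Metric.ball z₀ r ⊆ O ∧ ∃ τ τ' p : ℂ → ℂ,
      DifferentiableOn ℂ p (Metric.ball z₀ r) ∧ ∀ z ∈ Metric.ball z₀ r,
        HasDerivAt τ (τ' z) z ∧ 0 < (τ z).im ∧ h z = ‖τ' z‖ ^ 2 / (τ z).im ^ 2 ∧
          p z ^ 2 * τ' z = 4 * xi z := by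
  obtain ⟨R, hR, hRO⟩ := Metric.isOpen_iff.1 H.isOpen z₀ hz₀
  obtain ⟨r, hr, hrR, τ, τ', hτ⟩ := exists_developing_map hR (H.contDiffOn_log.mono hRO)
    fun z hz => H.laplacian_log (hRO hz)
  have hBO : Metric.ball z₀ r ⊆ O := (Metric.ball_subset_ball hrR).trans hRO
  have hτ' : ∀ z ∈ Metric.ball z₀ r, τ' z ≠ 0 := fun z hz h0 => by
    have h1 := (hτ z hz).2.2
    rw [h0] at h1
    have := Real.exp_pos (Real.log (h z))
    rw [h1] at this
    simp at this
  have hd : DifferentiableOn ℂ τ' (Metric.ball z₀ r) := by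
    have h1 : DifferentiableOn ℂ τ (Metric.ball z₀ r) := fun z hz =>
      (hτ z hz).1.differentiableAt.differentiableWithinAt
    exact (h1.deriv Metric.isOpen_ball).congr fun z hz => (hτ z hz).1.deriv.symm
  have hf : DifferentiableOn ℂ (fun z => 4 * xi z / τ' z) (Metric.ball z₀ r) :=
    ((H.holo.mono hBO).const_mul 4).div hd hτ'
  obtain ⟨r', hr', hrr', p, hp, hp2⟩ := exists_holomorphic_sqrt hr hf
    (div_ne_zero (mul_ne_zero (by norm_num) (H.ne_zero z₀ hz₀))
      (hτ' z₀ (Metric.mem_ball_self hr)))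
  have hsub := Metric.ball_subset_ball hrr' (x := z₀)
  refine ⟨r', hr', hsub.trans hBO, τ, τ', p, hp, fun z hz => ?_⟩
  obtain ⟨h1, h2, h3⟩ := hτ z (hsub hz)
  rw [Real.exp_log (H.pos z (hBO (hsub hz)))] at h3
  refine ⟨h1, h2, h3, ?_⟩
  rw [hp2 z hz, div_mul_cancel₀ _ (hτ' z (hsub hz))]

/-- The coordinates are primitives of `p` and `τp`, so their period map is `τ` by construction. What
has to be proved is that `λ = Im τ |p|²`, which is the Darboux condition, and that both
differentials are parallel. -/
theorem exists_conjugatePair (hz₀ : z₀ ∈ O) : ∃ N : Set ℂ, IsOpen N ∧ z₀ ∈ N ∧ N ⊆ O ∧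
    ∃ Z W : ℂ → ℂ, IsConjugatePair (skFactor xi h) (skConnection xi h) N Z W ∧
      ∀ z ∈ N, 0 < (periodMap Z W z).im ∧
        h z = ‖deriv (periodMap Z W) z‖ ^ 2 / (periodMap Z W z).im ^ 2 := by
  obtain ⟨r, hr, hrO, τ, τ', p, hp, hall⟩ := H.exists_local_square_root hz₀
  set N := Metric.ball z₀ r with hN
  have hNo : IsOpen N := Metric.isOpen_ball
  have hτd : DifferentiableOn ℂ τ N := fun z hz =>
    (hall z hz).1.differentiableAt.differentiableWithinAt
  obtain ⟨Z, hZ⟩ := hp.isExactOn_ball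
  obtain ⟨W, hW⟩ := (hτd.mul hp).isExactOn_ball
  have hpne : ∀ z ∈ N, p z ≠ 0 := fun z hz h0 => by
    have := (hall z hz).2.2.2
    rw [h0] at this
    exact H.ne_zero z (hrO hz) (by simpa using this.symm)
  have hdZ : ∀ z ∈ N, deriv Z z = p z := fun z hz => (hZ z hz).deriv
  have hdW : ∀ z ∈ N, deriv W z = τ z * p z := fun z hz => (hW z hz).deriv
  have hpd : ∀ z ∈ N, HasDerivAt p (deriv p z) z := fun z hz =>
    (hp.differentiableAt (hNo.mem_nhds hz)).hasDerivAt
  have hddZ : ∀ z ∈ N, deriv (deriv Z) z = deriv p z := fun z hz =>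
    Filter.EventuallyEq.deriv_eq (Filter.eventually_of_mem (hNo.mem_nhds hz) hdZ)
  have hddW : ∀ z ∈ N, deriv (deriv W) z = τ' z * p z + τ z * deriv p z := fun z hz => by
    rw [Filter.EventuallyEq.deriv_eq (Filter.eventually_of_mem (hNo.mem_nhds hz) hdW)]
    exact ((hall z hz).1.mul (hpd z hz)).deriv
  have hper : ∀ z ∈ N, periodMap Z W z = τ z := fun z hz => by
    rw [periodMap, hdZ z hz, hdW z hz, mul_div_cancel_right₀ _ (hpne z hz)]
  have hperd : ∀ z ∈ N, deriv (periodMap Z W) z = τ' z := fun z hz => by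
    rw [Filter.EventuallyEq.deriv_eq (Filter.eventually_of_mem (hNo.mem_nhds hz) hper),
      (hall z hz).1.deriv]
  have hlam : ∀ z ∈ N, skFactor xi h z = (τ z).im * ‖p z‖ ^ 2 := fun z hz => by
    obtain ⟨-, h2, h3, h4⟩ := hall z hz
    have hτ0 : τ' z ≠ 0 := fun h0 => by
      rw [h0, mul_zero] at h4
      exact H.ne_zero z (hrO hz) (by simpa using h4.symm)
    have h5 : √(h z) = ‖τ' z‖ / (τ z).im := by
      rw [h3, ← div_pow, Real.sqrt_sq (by positivity)]
    have h6 : 4 * ‖xi z‖ = ‖p z‖ ^ 2 * ‖τ' z‖ := by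
      have := congrArg norm h4
      rw [norm_mul, norm_mul, norm_pow, Complex.norm_ofNat] at this
      exact this.symm
    have := norm_pos_iff.2 hτ0
    rw [skFactor, h5, h6]
    field_simp
  have hlamC : ∀ z ∈ N, (skFactor xi h z : ℂ) = (τ z - conj (τ z)) * (-I / 2) * (p z * conj (p z)) :=
    fun z hz => by
      rw [hlam z hz, Complex.sub_conj, Complex.mul_conj']
      push_cast
      linear_combination ((τ z).im * (‖p z‖ : ℂ) ^ 2) * Complex.I_sq
  -- This is `∂` of the preceding identity for `λ`, since `∂λ = λa`.
  have hlin : ∀ z ∈ N, skFactor xi h z * skLinear xi h z =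
      τ' z * (-I / 2) * (p z * conj (p z)) + (τ z - conj (τ z)) * (-I / 2) *
        (deriv p z * conj (p z)) := fun z hz => by
    have w1 := HasWirtingerAt.of_hasDerivAt (hall z hz).1
    have w2 := HasWirtingerAt.of_hasDerivAt (hpd z hz)
    have w3 := ((w1.sub w1.star).mul (.const (-I / 2) z)).mul (w2.mul w2.star)
    have w4 := ((H.hasWirtingerAt_factor (hrO hz)).unique (w3.congr_of_eventuallyEq
      (Filter.eventually_of_mem (hNo.mem_nhds hz) hlamC))).1
    rw [w4]
    simp only [map_zero]
    ring
  have hcd : ∀ z ∈ N, skFactor xi h z * conj (skAntilinear xi h z) =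
      I / 2 * (p z ^ 2 * τ' z) := fun z hz => by
    have hne : (skFactor xi h z : ℂ) ≠ 0 := Complex.ofReal_ne_zero.2 (H.factor_pos (hrO hz)).ne'
    rw [skAntilinear, (hall z hz).2.2.2]
    simp only [map_div₀, map_mul, map_neg, Complex.conj_I, Complex.conj_conj, Complex.conj_ofReal,
      map_ofNat]
    field_simp
    ring
  -- After multiplication by `λ`, the terms with `p'` match and those with `τ'` cancel between `λa`
  -- and `λ d̄`.
  have hpar : ∀ z ∈ N, deriv p z = skLinear xi h z * p z + conj (skAntilinear xi h z) * conj (p z) := by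
    intro z hz
    have hne : (skFactor xi h z : ℂ) ≠ 0 := Complex.ofReal_ne_zero.2 (H.factor_pos (hrO hz)).ne'
    refine mul_left_cancel₀ hne ?_
    linear_combination (deriv p z) * hlamC z hz - (p z) * hlin z hz - conj (p z) * hcd z hz
  have hpar' : ∀ z ∈ N, τ' z * p z + τ z * deriv p z = skLinear xi h z * (τ z * p z) +
      conj (skAntilinear xi h z) * conj (τ z * p z) := by
    intro z hz
    have hne : (skFactor xi h z : ℂ) ≠ 0 := Complex.ofReal_ne_zero.2 (H.factor_pos (hrO hz)).ne'
    refine mul_left_cancel₀ hne ?_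
    rw [map_mul]
    linear_combination (τ' z * p z + τ z * deriv p z) * hlamC z hz - (τ z * p z) * hlin z hz
      - conj (τ z) * conj (p z) * hcd z hz
  refine ⟨N, hNo, Metric.mem_ball_self hr, hrO, Z, W, ⟨?_, ?_, ?_, ?_, ?_⟩, ?_⟩
  · exact fun z hz => (hZ z hz).differentiableAt.differentiableWithinAt
  · exact fun z hz => (hW z hz).differentiableAt.differentiableWithinAt
  · intro z hz
    rw [hddZ z hz, hdZ z hz]
    exact parallel_bilin_iff.2 (hpar z hz)
  · intro z hz
    rw [hddW z hz, hdW z hz]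
    exact parallel_bilin_iff.2 (hpar' z hz)
  · intro z hz u v
    rw [hdZ z hz, hdW z hz, hlam z hz, ← Complex.normSq_eq_norm_sq, Complex.normSq_apply]
    simp [kahlerForm]
    ring
  · intro z hz
    rw [hper z hz, hperd z hz]
    exact ⟨(hall z hz).2.1, (hall z hz).2.2.1⟩

/-- The connection coefficient in terms of the cubic form and the hyperbolic metric. -/
theorem linear_eq {z : ℂ} (hz : z ∈ O) : skLinear xi h z =
    deriv xi z / (2 * xi z) - dz (fun w => (Real.log (h w) : ℂ)) z / 2 := by
  have hU := H.isOpen.mem_nhds hz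
  have hx := H.ne_zero z hz
  have wx := HasWirtingerAt.of_hasDerivAt (H.holo.differentiableAt hU).hasDerivAt
  have harm := (H.holo.analyticAt hU).harmonicAt_log_norm hx
  have w1 := hasWirtingerAt_ofReal (harm.1.differentiableAt (by simp))
  have w2 := hasWirtingerAt_ofReal
    ((H.contDiffOn_log.contDiffAt hU).differentiableAt (by simp))
  have e : ∀ w ∈ O, (Real.log (skFactor xi h w) : ℂ) =
      ((Real.log 4 : ℝ) : ℂ) + (Real.log ‖xi w‖ : ℂ) - 2⁻¹ * (Real.log (h w) : ℂ) := fun w hw => by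
    rw [H.log_factor hw]; push_cast; ring
  have w3 := (((HasWirtingerAt.const ((Real.log 4 : ℝ) : ℂ) z).add w1).sub
    (w2.const_mul 2⁻¹)).congr_of_eventuallyEq (Filter.eventually_of_mem hU e)
  have w4 : HasWirtingerAt (fun w => xi w * conj (xi w)) _ _ z := wx.mul wx.star
  -- The derivative of `log|xi|` is read off from `exp(2 log|xi|) = xi · conj xi`, so no branch of
  -- the complex logarithm of `xi` is chosen.
  have w5 := HasWirtingerAt.comp_hasDerivAt (Complex.hasDerivAt_exp _) (w1.const_mul 2)
  have e5 : (fun w => Complex.exp (2 * (Real.log ‖xi w‖ : ℂ))) =ᶠ[𝓝 z]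
      fun w => xi w * conj (xi w) := by
    filter_upwards [hU] with w hw
    have := norm_pos_iff.2 (H.ne_zero w hw)
    rw [Complex.mul_conj', ← Complex.ofReal_ofNat, ← Complex.ofReal_mul, ← Complex.ofReal_exp,
      mul_comm, Real.exp_mul, Real.exp_log this]
    norm_cast
  have e6 := (w5.unique (w4.congr_of_eventuallyEq e5)).1
  have e5z : Complex.exp (2 * (Real.log ‖xi z‖ : ℂ)) = xi z * conj (xi z) := e5.self_of_nhds
  rw [e5z] at e6
  have hxc : conj (xi z) ≠ 0 := by simpa using hx
  have e7 : dz (fun w => (Real.log ‖xi w‖ : ℂ)) z = deriv xi z / (2 * xi z) := by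
    rw [eq_div_iff (by simpa using hx)]
    refine mul_right_cancel₀ hxc ?_
    rw [map_zero, mul_zero, add_zero] at e6
    linear_combination e6
  rw [skLinear, w3.dz_eq, e7]
  ring

end IsPlanarData

/-- A pair of conjugate special coordinates determines the conformal factor in terms of the
associated cubic form and the associated hyperbolic metric. -/
theorem IsConjugatePair.factor_eq {lam h : ℂ → ℝ} {G : ℂ → (ℂ →L[ℝ] ℂ →L[ℝ] ℂ)} {N : Set ℂ}
    {Z W xi : ℂ → ℂ} {z a d : ℂ} (hN : IsOpen N) (hz : z ∈ N) (hP : IsConjugatePair lam G N Z W)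
    (hG : G z = bilin a d) (hpos : 0 < lam z) (hxi : xi z = cubicCoeff (lam z) (G z))
    (hxi0 : xi z ≠ 0)
    (hh : h z = ‖deriv (periodMap Z W) z‖ ^ 2 / (periodMap Z W z).im ^ 2) :
    lam z = skFactor xi h z := by
  set p := deriv Z z with hp
  set q := deriv W z with hq
  have hdZ := ((hP.holomorphic_fst.deriv hN).differentiableAt (hN.mem_nhds hz)).hasDerivAt
  have hdW := ((hP.holomorphic_snd.deriv hN).differentiableAt (hN.mem_nhds hz)).hasDerivAt
  have h1 := hP.parallel_fst z hz
  have h2 := hP.parallel_snd z hz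
  rw [hG, parallel_bilin_iff, ← hp] at h1
  rw [hG, parallel_bilin_iff, ← hq] at h2
  have h3 := hP.darboux z hz 1 I
  rw [kahlerForm_one_I] at h3
  have h4 : (lam z : ℂ) = -(I / 2) * (q * conj p - conj q * p) := by
    rw [h3, ← hp, ← hq]
    apply Complex.ext
    · simp; ring
    · simp
  have hp0 : p ≠ 0 := fun h0 => by
    rw [h0] at h4
    simp at h4
    exact hpos.ne' h4
  -- By the quotient rule and the two parallel equations `a` drops out, leaving `d̄ (p q̄ - q
  -- p̄)/p²`, and the bracket is a multiple of `λ` by the Darboux condition.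
  have hper : deriv (periodMap Z W) z = conj d * (-2 * I * lam z) / p ^ 2 := by
    have := (hdW.div hdZ hp0).deriv
    rw [h1, h2, ← hp, ← hq] at this
    refine Eq.trans this ?_
    rw [h4]
    congr 1
    linear_combination -(conj d * (q * conj p - conj q * p)) * Complex.I_sq
  have hτ : (periodMap Z W z).im = lam z / ‖p‖ ^ 2 := by
    rw [periodMap, ← hp, ← hq, Complex.div_im, ← Complex.normSq_eq_norm_sq, h3, ← hp, ← hq]
    simp
    ring
  have hpn := norm_pos_iff.2 hp0
  have hxin : ‖xi z‖ = lam z * ‖d‖ / 2 := by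
    rw [hxi, hG, cubicCoeff_bilin]
    simp [abs_of_pos hpos]
    ring
  have hdn : ‖deriv (periodMap Z W) z‖ = 2 * ‖d‖ * lam z / ‖p‖ ^ 2 := by
    rw [hper]
    simp [abs_of_pos hpos]
    ring
  -- The choice of conjugate pair disappears here: the factors `|p|` cancel and `h = 4|d|²`.
  have hs : √(h z) = 2 * ‖d‖ := by
    rw [hh, hdn, hτ, ← div_pow, Real.sqrt_sq (by positivity)]
    field_simp
  rw [skFactor, hs, hxin]
  have hd : d ≠ 0 := fun h0 => norm_ne_zero_iff.2 hxi0 (by rw [hxin, h0]; simp)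
  have := norm_pos_iff.2 hd
  field_simp
  norm_num

/-! ### Changes of holomorphic coordinate -/

section Charts

variable {X : Type*} [TopologicalSpace X] [ChartedSpace ℂ X] {φ ψ : HolChart X} {U V : Set X}
  {z : ℂ}

theorem isOpen_chartDomain (φ : HolChart X) (hU : IsOpen U) : IsOpen (chartDomain φ U) :=
  φ.1.isOpen_inter_preimage_symm hU

theorem chartDomain_mono (φ : HolChart X) (h : U ⊆ V) : chartDomain φ U ⊆ chartDomain φ V :=
  fun _ hz => ⟨hz.1, h hz.2⟩

theorem apply_mem_chartDomain {p : X} (hp : p ∈ φ.1.source) (hU : p ∈ U) :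
    φ.1 p ∈ chartDomain φ U :=
  ⟨φ.1.map_source hp, by rwa [Set.mem_preimage, φ.1.left_inv hp]⟩

theorem transition_mem_chartDomain (hz : z ∈ chartDomain φ (U ∩ ψ.1.source)) :
    transition φ ψ z ∈ chartDomain ψ (U ∩ φ.1.source) :=
  apply_mem_chartDomain hz.2.2 ⟨hz.2.1, φ.1.map_target hz.1⟩

theorem transition_transition (hz : z ∈ chartDomain φ (U ∩ ψ.1.source)) :
    transition ψ φ (transition φ ψ z) = z := by
  rw [transition, transition, ψ.1.left_inv hz.2.2, φ.1.right_inv hz.1]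

theorem IsCubicFormOn.mono {Ξ : HolChart X → ℂ → ℂ} (h : IsCubicFormOn V Ξ) (hUV : U ⊆ V) :
    IsCubicFormOn U Ξ := fun φ ψ z hz =>
  h φ ψ z (chartDomain_mono φ (Set.inter_subset_inter_left _ hUV) hz)

theorem IsHolomorphicCubicFormOn.mono {Ξ : HolChart X → ℂ → ℂ}
    (h : IsHolomorphicCubicFormOn V Ξ) (hUV : U ⊆ V) : IsHolomorphicCubicFormOn U Ξ :=
  ⟨h.1.mono hUV, fun φ => (h.2 φ).mono (chartDomain_mono φ hUV)⟩

theorem IsHyperbolicMetricOn.mono {g : HolChart X → ℂ → ℝ} (h : IsHyperbolicMetricOn V g)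
    (hUV : U ⊆ V) : IsHyperbolicMetricOn U g :=
  ⟨⟨fun φ => (h.1.1 φ).mono (chartDomain_mono φ hUV),
    fun φ z hz => h.1.2 φ z (chartDomain_mono φ hUV hz),
    fun φ ψ z hz => h.1.3 φ ψ z (chartDomain_mono φ (Set.inter_subset_inter_left _ hUV) hz)⟩,
    fun φ z hz => h.2 φ z (chartDomain_mono φ hUV hz)⟩

theorem analyticAt_transition (hz : z ∈ chartDomain φ (U ∩ ψ.1.source)) :
    AnalyticAt ℂ (transition φ ψ) z := by
  have h1 : ContMDiffAt 𝓘(ℂ) 𝓘(ℂ) ω φ.1.symm z := contMDiffAt_symm_of_mem_maximalAtlas φ.2 hz.1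
  have h2 : ContMDiffAt 𝓘(ℂ) 𝓘(ℂ) ω ψ.1 (φ.1.symm z) :=
    contMDiffAt_of_mem_maximalAtlas ψ.2 hz.2.2
  exact (contMDiffAt_iff_contDiffAt.1 (h2.comp z h1)).analyticAt

/-- The inverse transition map is differentiable as well, so a zero derivative would contradict the
chain rule for the identity. -/
theorem deriv_transition_ne_zero (hz : z ∈ chartDomain φ (U ∩ ψ.1.source)) :
    deriv (transition φ ψ) z ≠ 0 := by
  intro h0
  have hz' : z ∈ chartDomain φ (Set.univ ∩ ψ.1.source) := ⟨hz.1, trivial, hz.2.2⟩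
  have hU : IsOpen (chartDomain φ (Set.univ ∩ ψ.1.source)) :=
    isOpen_chartDomain φ (isOpen_univ.inter ψ.1.open_source)
  have h1 := (analyticAt_transition hz').differentiableAt.hasDerivAt
  have h2 := (analyticAt_transition (transition_mem_chartDomain hz')).differentiableAt.hasDerivAt
  have e : (fun w => w) =ᶠ[𝓝 z] (transition ψ φ ∘ transition φ ψ) :=
    Filter.eventually_of_mem (hU.mem_nhds hz') fun w hw => (transition_transition hw).symm
  have h3 := (h2.comp z h1).congr_of_eventuallyEq e
  rw [h0, mul_zero] at h3
  exact zero_ne_one (h3.unique (hasDerivAt_id' z))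

theorem IsCubicFormOn.eq_zero_iff {Ξ : HolChart X → ℂ → ℂ} (h : IsCubicFormOn U Ξ)
    (hz : z ∈ chartDomain φ (U ∩ ψ.1.source)) : Ξ φ z = 0 ↔ Ξ ψ (transition φ ψ z) = 0 := by
  rw [h φ ψ z hz, mul_eq_zero, pow_eq_zero_iff three_ne_zero]
  exact or_iff_left (deriv_transition_ne_zero hz)

variable [IsManifold 𝓘(ℂ) ω X]

theorem IsCubicFormOn.mem_zeroSet_iff {Ξ : HolChart X → ℂ → ℂ} (h : IsCubicFormOn U Ξ)
    (hz : z ∈ chartDomain φ U) : φ.1.symm z ∈ zeroSet Ξ ↔ Ξ φ z = 0 := by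
  rw [h.eq_zero_iff (ψ := chartOf (φ.1.symm z)) ⟨hz.1, hz.2, mem_chart_source ℂ _⟩]
  rfl

theorem isOpen_diff_zeroSet {Ξ : HolChart X → ℂ → ℂ} (hU : IsOpen U)
    (h : IsHolomorphicCubicFormOn U Ξ) : IsOpen (U \ zeroSet Ξ) := by
  rw [isOpen_iff_mem_nhds]
  rintro p ⟨hpU, hp⟩
  set φ : HolChart X := chartOf p
  have hpφ : p ∈ φ.1.source := mem_chart_source ℂ p
  have hz := apply_mem_chartDomain hpφ hpU
  have h1 : ContinuousAt (fun q => Ξ φ (φ.1 q)) p :=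
    ContinuousAt.comp (((h.holomorphic φ).differentiableAt
      ((isOpen_chartDomain φ hU).mem_nhds hz)).continuousAt) (φ.1.continuousAt hpφ)
  filter_upwards [hU.mem_nhds hpU, φ.1.open_source.mem_nhds hpφ, h1.eventually_ne hp] with q h2 h3 h4
  refine ⟨h2, fun h5 => h4 ?_⟩
  have := h.isCubicForm.mem_zeroSet_iff (apply_mem_chartDomain h3 h2)
  rw [φ.1.left_inv h3] at this
  exact this.1 h5

end Charts

theorem skFactor_eq_of_metric_eq {xi : ℂ → ℂ} {h : ℂ → ℝ} {z : ℂ} {v : ℝ}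
    (hv : h z = Real.exp (2 * v)) : skFactor xi h z = 4 * ‖xi z‖ * Real.exp (-v) := by
  rw [skFactor, hv, mul_comm 2 v, Real.exp_mul, Real.exp_neg, div_eq_mul_inv]
  congr 2
  rw [Real.rpow_ofNat, Real.sqrt_sq (Real.exp_pos v).le]

/-! ### The special Kähler structure of a cubic form and a hyperbolic metric -/

/-- A nowhere vanishing holomorphic cubic form and a hyperbolic metric on an open set. -/
structure IsSurfaceData {X : Type*} [TopologicalSpace X] [ChartedSpace ℂ X] (V : Set X)
    (Ξ : HolChart X → ℂ → ℂ) (gt : HolChart X → ℂ → ℝ) : Prop where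
  isOpen : IsOpen V
  cubic : IsHolomorphicCubicFormOn V Ξ
  ne_zero : ∀ φ, ∀ z ∈ chartDomain φ V, Ξ φ z ≠ 0
  hyperbolic : IsHyperbolicMetricOn V gt

namespace IsSurfaceData

variable {X : Type*} [TopologicalSpace X] [ChartedSpace ℂ X] {φ ψ : HolChart X} {V : Set X}
  {Ξ : HolChart X → ℂ → ℂ} {gt : HolChart X → ℂ → ℝ} (H : IsSurfaceData V Ξ gt) {z : ℂ}
include H

theorem planar (φ : HolChart X) : IsPlanarData (chartDomain φ V) (Ξ φ) (gt φ) where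
  isOpen := isOpen_chartDomain φ H.isOpen
  holo := H.cubic.holomorphic φ
  ne_zero := H.ne_zero φ
  smooth := H.hyperbolic.isConformalMetric.smooth φ
  pos := H.hyperbolic.isConformalMetric.pos φ
  curvature := H.hyperbolic.curvature φ

/-- The weight 3 of the cubic form and the weight -1 of the inverse square root of the metric add up
to the weight 2 of a metric. -/
theorem factor_transform (hz : z ∈ chartDomain φ (V ∩ ψ.1.source)) :
    skFactor (Ξ φ) (gt φ) z = skFactor (Ξ ψ) (gt ψ) (transition φ ψ z) *
      ‖deriv (transition φ ψ) z‖ ^ 2 := by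
  have hn := norm_pos_iff.2 (deriv_transition_ne_zero hz)
  have hp := H.hyperbolic.isConformalMetric.pos ψ _
    (chartDomain_mono ψ Set.inter_subset_left (transition_mem_chartDomain hz))
  have hs := Real.sqrt_pos.2 hp
  rw [skFactor, skFactor, H.cubic.isCubicForm φ ψ z hz,
    H.hyperbolic.isConformalMetric.transform φ ψ z hz, Real.sqrt_mul hp.le, Real.sqrt_sq hn.le,
    norm_mul, norm_pow]
  field_simp

/-- The logarithmic derivative `∂` of `factor_transform`; the inhomogeneous term of a connection
comes from `∂ log|f'|² = f''/f'`. -/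
theorem linear_transform (hz : z ∈ chartDomain φ (V ∩ ψ.1.source)) :
    deriv (transition φ ψ) z * skLinear (Ξ φ) (gt φ) z =
      skLinear (Ξ ψ) (gt ψ) (transition φ ψ z) * deriv (transition φ ψ) z ^ 2 +
        deriv (deriv (transition φ ψ)) z := by
  have hzV := chartDomain_mono φ Set.inter_subset_left hz
  have hfz := chartDomain_mono ψ Set.inter_subset_left (transition_mem_chartDomain hz)
  have hO : IsOpen (chartDomain φ (V ∩ ψ.1.source)) :=
    isOpen_chartDomain φ (H.isOpen.inter ψ.1.open_source)
  have hf := (analyticAt_transition hz).differentiableAt.hasDerivAt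
  have hf' := HasWirtingerAt.of_hasDerivAt
    (analyticAt_transition hz).deriv.differentiableAt.hasDerivAt
  have w := (((H.planar ψ).hasWirtingerAt_factor hfz).comp_holomorphic hf).mul (hf'.mul hf'.star)
  have e : ∀ w ∈ chartDomain φ (V ∩ ψ.1.source), (skFactor (Ξ φ) (gt φ) w : ℂ) =
      skFactor (Ξ ψ) (gt ψ) (transition φ ψ w) *
        (deriv (transition φ ψ) w * conj (deriv (transition φ ψ) w)) := fun w hw => by
    rw [H.factor_transform hw, Complex.mul_conj']
    push_cast
    rfl
  have key := (((H.planar φ).hasWirtingerAt_factor hzV).unique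
    (w.congr_of_eventuallyEq (Filter.eventually_of_mem (hO.mem_nhds hz) e))).1
  rw [e z hz] at key
  have h1 := deriv_transition_ne_zero hz
  have h2 : conj (deriv (transition φ ψ) z) ≠ 0 := by simpa using h1
  have h3 : (skFactor (Ξ ψ) (gt ψ) (transition φ ψ z) : ℂ) ≠ 0 :=
    Complex.ofReal_ne_zero.2 ((H.planar ψ).factor_pos hfz).ne'
  rw [map_zero] at key
  refine mul_left_cancel₀ (mul_ne_zero h3 h2) ?_
  linear_combination key

theorem antilinear_transform (hz : z ∈ chartDomain φ (V ∩ ψ.1.source)) :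
    deriv (transition φ ψ) z * skAntilinear (Ξ φ) (gt φ) z =
      skAntilinear (Ξ ψ) (gt ψ) (transition φ ψ z) * conj (deriv (transition φ ψ) z) ^ 2 := by
  have hfz := chartDomain_mono ψ Set.inter_subset_left (transition_mem_chartDomain hz)
  have h1 := deriv_transition_ne_zero hz
  have h2 : conj (deriv (transition φ ψ) z) ≠ 0 := by simpa using h1
  have h3 : (skFactor (Ξ ψ) (gt ψ) (transition φ ψ z) : ℂ) ≠ 0 :=
    Complex.ofReal_ne_zero.2 ((H.planar ψ).factor_pos hfz).ne'
  have h4 : ((‖deriv (transition φ ψ) z‖ : ℂ)) ^ 2 =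
      deriv (transition φ ψ) z * conj (deriv (transition φ ψ) z) := by
    rw [Complex.mul_conj']
  rw [skAntilinear, skAntilinear, H.cubic.isCubicForm φ ψ z hz, H.factor_transform hz, map_mul,
    map_pow, Complex.ofReal_mul, Complex.ofReal_pow, h4]
  field_simp

theorem isSpecialKahlerOn : IsSpecialKahlerOn V (fun φ => skFactor (Ξ φ) (gt φ))
    (fun φ => skConnection (Ξ φ) (gt φ)) where
  isKahlerMetric := ⟨fun φ => (H.planar φ).contDiffOn_factor,
    fun φ _ hz => (H.planar φ).factor_pos hz, fun _ _ _ hz => H.factor_transform hz⟩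
  isConnection := ⟨fun φ => (H.planar φ).contDiffOn_connection, fun φ ψ z hz v w => by
    simp only [skConnection, bilin_apply, map_mul]
    linear_combination (v * w) * H.linear_transform hz +
      (conj v * conj w) * H.antilinear_transform hz⟩
  torsion_free φ z _ v w := by
    simp only [skConnection, bilin_apply]; ring
  flat φ z hz u v w := (H.planar φ).flat hz u v w
  symplectic φ z hz u v w := (H.planar φ).symplectic hz u v w
  special φ z _ v w := by
    simp only [skConnection, bilin_apply, map_mul, Complex.conj_I]; ring

theorem isSpecialKahlerWith : IsSpecialKahlerWith V gt Ξ (fun φ => skFactor (Ξ φ) (gt φ))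
    (fun φ => skConnection (Ξ φ) (gt φ)) where
  isSpecialKahler := H.isSpecialKahlerOn
  hyperbolicMetric φ _ hz := (H.planar φ).exists_conjugatePair hz
  cubicForm φ _ hz := ((H.planar φ).cubicCoeff_eq hz).symm

/-- The conformal factor is determined by any conjugate pair; after that the cubic form fixes `d`,
and `∇ω = 0` fixes `a` because both metrics have the same derivative on the open set. -/
theorem agreeOn {g : HolChart X → ℂ → ℝ} {Γ : HolChart X → ℂ → (ℂ →L[ℝ] ℂ →L[ℝ] ℂ)}
    (h : IsSpecialKahlerWith V gt Ξ g Γ) :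
    AgreeOn V g Γ (fun φ => skFactor (Ξ φ) (gt φ)) (fun φ => skConnection (Ξ φ) (gt φ)) := by
  have hS := h.isSpecialKahler
  have hG : ∀ φ, ∀ z ∈ chartDomain φ V, ∃ a d, Γ φ z = bilin a d := fun φ z hz =>
    exists_eq_bilin (hS.torsion_free φ z hz) (hS.special φ z hz)
  have hg : ∀ φ, ∀ z ∈ chartDomain φ V, g φ z = skFactor (Ξ φ) (gt φ) z := by
    intro φ z hz
    obtain ⟨a, d, had⟩ := hG φ z hz
    obtain ⟨N, hN, hzN, hNV, Z, W, hP, hper⟩ := h.hyperbolicMetric φ z hz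
    exact hP.factor_eq hN hzN had (hS.isKahlerMetric.pos φ z hz) (h.cubicForm φ z hz)
      (H.ne_zero φ z hz) (hper z hzN).2
  intro φ z hz
  refine ⟨hg φ z hz, ?_⟩
  obtain ⟨a, d, had⟩ := hG φ z hz
  have hpos := (H.planar φ).factor_pos hz
  have hne : (skFactor (Ξ φ) (gt φ) z : ℂ) ≠ 0 := Complex.ofReal_ne_zero.2 hpos.ne'
  have hd : d = skAntilinear (Ξ φ) (gt φ) z := by
    have h1 := h.cubicForm φ z hz
    rw [had, hg φ z hz, cubicCoeff_bilin] at h1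
    rw [skAntilinear, h1]
    simp only [map_mul, map_neg, map_div₀, Complex.conj_I, Complex.conj_conj, Complex.conj_ofReal,
      map_ofNat]
    field_simp
    linear_combination d * Complex.I_sq
  have ha : a = skLinear (Ξ φ) (gt φ) z := by
    refine eq_of_forall_re_mul_eq fun u => ?_
    have h1 := hS.symplectic φ z hz u 1 I
    have h2 := (H.planar φ).symplectic hz u 1 I
    have h3 : fderiv ℝ (g φ) z = fderiv ℝ (skFactor (Ξ φ) (gt φ)) z :=
      Filter.EventuallyEq.fderiv_eq (Filter.eventually_of_mem
        ((isOpen_chartDomain φ H.isOpen).mem_nhds hz) (hg φ))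
    rw [had, kahlerForm_bilin, hg φ z hz, h3] at h1
    rw [skConnection, kahlerForm_bilin, h1, kahlerForm_one_I, kahlerForm_one_I] at h2
    exact mul_left_cancel₀ (by positivity) h2
  rw [had, hd, ha]
  rfl

end IsSurfaceData

/-! ### Meromorphic cubic forms and their divisors -/

section MeromorphicCubicForms

variable {X : Type*} [TopologicalSpace X] [ChartedSpace ℂ X] {φ ψ : HolChart X}
  {U : Set X} {Ξ : HolChart X → ℂ → ℂ} {gt : HolChart X → ℂ → ℝ} {z : ℂ} {p : X}

theorem isOpen_compl_setOf_ne_zero {Y : Type*} [TopologicalSpace Y] [T1Space Y] (D : Y →₀ ℝ) :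
    IsOpen {p | D p ≠ 0}ᶜ := by
  rw [isOpen_compl_iff]
  exact (D.support.finite_toSet.subset fun p hp => by simpa using hp).isClosed

/-- A regular point counts as a cone of order 0, which makes assertion (iii) the case `α = 0` of
assertion (ii). -/
theorem RepresentsDivisor.hasConicalPoint_zero [T2Space X] {D : X →₀ ℝ}
    (hg : RepresentsDivisor gt D) (hp : D p = 0) : HasConicalPoint gt p 0 := by
  refine ⟨by norm_num, fun φ hφ => ⟨gt φ (φ.1 p), ?_, ?_⟩⟩
  · exact hg.isHyperbolic.isConformalMetric.pos φ _ (apply_mem_chartDomain hφ (by simpa using hp))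
  · have h1 := ((hg.isHyperbolic.isConformalMetric.smooth φ).contDiffAt
      ((isOpen_chartDomain φ (isOpen_compl_setOf_ne_zero D)).mem_nhds
        (apply_mem_chartDomain hφ (by simpa using hp)))).continuousAt
    simpa using h1.tendsto.mono_left nhdsWithin_le_nhds

theorem IsMeromorphicCubicForm.meromorphicOrderAt_transition (h : IsMeromorphicCubicForm Ξ)
    (hz : z ∈ chartDomain φ (Set.univ ∩ ψ.1.source)) :
    meromorphicOrderAt (Ξ φ) z = meromorphicOrderAt (Ξ ψ) (transition φ ψ z) := by
  have hO : IsOpen (chartDomain φ (Set.univ ∩ ψ.1.source)) :=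
    isOpen_chartDomain φ (isOpen_univ.inter ψ.1.open_source)
  have h1 := analyticAt_transition hz
  have h2 := deriv_transition_ne_zero hz
  have e : Ξ φ =ᶠ[𝓝[≠] z]
      deriv (transition φ ψ) ^ 3 * (Ξ ψ ∘ transition φ ψ) :=
    nhdsWithin_le_nhds (Filter.eventually_of_mem (hO.mem_nhds hz) fun w hw => by
      rw [h.isCubicForm φ ψ w hw, mul_comm]; rfl)
  rw [meromorphicOrderAt_congr e,
    meromorphicOrderAt_mul_of_ne_zero (h1.deriv.pow 3) (pow_ne_zero 3 h2),
    meromorphicOrderAt_comp_of_deriv_ne_zero h1 h2]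

variable [IsManifold 𝓘(ℂ) ω X]

theorem IsHolomorphicCubicFormOn.isSurfaceData (hΞ : IsHolomorphicCubicFormOn U Ξ) (hU : IsOpen U)
    (hg : IsHyperbolicMetricOn U gt) : IsSurfaceData (U \ zeroSet Ξ) Ξ gt where
  isOpen := isOpen_diff_zeroSet hU hΞ
  cubic := hΞ.mono Set.sdiff_subset
  ne_zero _ _ hz h0 := hz.2.2 ((hΞ.isCubicForm.mem_zeroSet_iff
    (chartDomain_mono _ Set.sdiff_subset hz)).2 h0)
  hyperbolic := hg.mono Set.sdiff_subset

/-! ### The order of a meromorphic cubic form -/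

theorem eventually_eventually_nhdsNE {Y : Type*} [TopologicalSpace Y] [T1Space Y] {c : Y}
    {P : Y → Prop} (h : ∀ᶠ y in 𝓝[≠] c, P y) : ∀ᶠ y in 𝓝 c, ∀ᶠ x in 𝓝[≠] y, P x := by
  filter_upwards [eventually_eventually_nhds.2 (eventually_nhdsWithin_iff.1 h)] with y hy
  by_cases hyc : y = c
  · rwa [hyc]
  · filter_upwards [nhdsWithin_le_nhds hy,
      nhdsWithin_le_nhds (isOpen_compl_singleton.mem_nhds hyc)] with x hx hxc
    exact hx hxc

namespace IsMeromorphicCubicForm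

theorem meromorphicOrderAt_apply (h : IsMeromorphicCubicForm Ξ) (hp : p ∈ φ.1.source) :
    meromorphicOrderAt (Ξ φ) (φ.1 p) = meromorphicOrderAt (Ξ (chartOf p)) (chartAt ℂ p p) := by
  rw [h.meromorphicOrderAt_transition (ψ := chartOf p)
    (apply_mem_chartDomain hp ⟨trivial, mem_chart_source ℂ p⟩), transition, φ.1.left_inv hp]
  rfl

/-- Near each point a meromorphic function either vanishes identically on a punctured neighbourhood
or is nonzero on one. So the set of points of infinite order is clopen, and connectedness excludes
it once the form is nonzero somewhere. -/
theorem meromorphicOrderAt_ne_top [ConnectedSpace X] (h : IsMeromorphicCubicForm Ξ)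
    (h0 : ∃ φ : HolChart X, ∃ z ∈ φ.1.target, Ξ φ z ≠ 0) (p : X) :
    meromorphicOrderAt (Ξ (chartOf p)) (chartAt ℂ p p) ≠ ⊤ := by
  set S : Set X := {p | meromorphicOrderAt (Ξ (chartOf p)) (chartAt ℂ p p) = ⊤} with hS
  have key : ∀ p : X, (∀ᶠ q in 𝓝 p, (q ∈ S ↔ p ∈ S)) := by
    intro p
    have hp : p ∈ (chartOf p).1.source := mem_chart_source ℂ p
    have hm := (h.meromorphic (chartOf p) ((chartOf p).1.map_source hp)).meromorphicAt
    have hc : Tendsto (chartOf p).1 (𝓝 p) (𝓝 ((chartOf p).1 p)) := (chartOf p).1.continuousAt hp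
    have hq : ∀ᶠ q in 𝓝 p, q ∈ (chartOf p).1.source := (chartOf p).1.open_source.mem_nhds hp
    by_cases hpS : p ∈ S
    · filter_upwards [hq, hc.eventually (eventually_eventually_nhdsNE
        (meromorphicOrderAt_eq_top_iff.1 hpS))] with q hq hz
      refine iff_of_true ?_ hpS
      rw [hS, Set.mem_ofPred_eq, ← h.meromorphicOrderAt_apply hq]
      exact meromorphicOrderAt_eq_top_iff.2 hz
    · filter_upwards [hq, hc.eventually (eventually_eventually_nhdsNE
        ((meromorphicOrderAt_ne_top_iff_eventually_ne_zero hm).1 hpS))] with q hq hz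
      refine iff_of_false ?_ hpS
      rw [hS, Set.mem_ofPred_eq, ← h.meromorphicOrderAt_apply hq]
      exact (meromorphicOrderAt_ne_top_iff_eventually_ne_zero
        (h.meromorphic (chartOf p) ((chartOf p).1.map_source hq)).meromorphicAt).2 hz
  have hclopen : IsClopen S := by
    constructor
    · rw [← isOpen_compl_iff, isOpen_iff_mem_nhds]
      intro p hp
      filter_upwards [key p] with q hq
      exact fun hqS => hp (hq.1 hqS)
    · rw [isOpen_iff_mem_nhds]
      intro p hp
      filter_upwards [key p] with q hq
      exact hq.2 hp
  intro hpS
  obtain ⟨φ, z, hz, hne⟩ := h0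
  have h1 : φ.1.symm z ∈ S := by
    rw [hclopen.eq_univ ⟨p, hpS⟩]
    trivial
  rw [hS, Set.mem_ofPred_eq, ← h.meromorphicOrderAt_apply (φ.1.map_target hz),
    φ.1.right_inv hz, ((h.meromorphic φ hz).meromorphicOrderAt_eq_zero_iff).2 hne] at h1
  exact absurd h1 (by simp)

variable [ConnectedSpace X]

theorem meromorphicOrderAt_eq_ord (h : IsMeromorphicCubicForm Ξ)
    (h0 : ∃ φ : HolChart X, ∃ z ∈ φ.1.target, Ξ φ z ≠ 0) (hp : p ∈ φ.1.source) :
    meromorphicOrderAt (Ξ φ) (φ.1 p) = ord Ξ p := by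
  rw [h.meromorphicOrderAt_apply hp, ord, WithTop.coe_untop₀_of_ne_top]
  exact h.meromorphicOrderAt_ne_top h0 p

/-- Normal form assigns the value 0 to poles, so the vanishing of the coefficient detects poles as
well as zeros. -/
theorem divisorSupport_eq_zeroSet (h : IsMeromorphicCubicForm Ξ)
    (h0 : ∃ φ : HolChart X, ∃ z ∈ φ.1.target, Ξ φ z ≠ 0) : divisorSupport Ξ = zeroSet Ξ := by
  ext p
  have hp : p ∈ (chartOf p).1.source := mem_chart_source ℂ p
  have h1 := (h.meromorphic (chartOf p)
    ((chartOf p).1.map_source hp)).meromorphicOrderAt_eq_zero_iff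
  rw [h.meromorphicOrderAt_eq_ord h0 hp] at h1
  rw [divisorSupport, zeroSet, Set.mem_ofPred_eq, Set.mem_ofPred_eq, not_iff_comm]
  refine h1.symm.trans ?_
  norm_cast

theorem isSurfaceData [T2Space X] (h : IsMeromorphicCubicForm Ξ)
    (h0 : ∃ φ : HolChart X, ∃ z ∈ φ.1.target, Ξ φ z ≠ 0) {D : X →₀ ℝ}
    (hg : RepresentsDivisor gt D) : IsSurfaceData (divisorSupport Ξ ∪ {p | D p ≠ 0})ᶜ Ξ gt := by
  have hne : ∀ φ : HolChart X, ∀ z ∈ chartDomain φ (divisorSupport Ξ)ᶜ, Ξ φ z ≠ 0 := by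
    intro φ z hz h1
    refine hz.2 ?_
    rw [h.divisorSupport_eq_zeroSet h0]
    exact (h.isCubicForm.mem_zeroSet_iff ⟨hz.1, trivial⟩).2 h1
  -- A nonzero value of a function in normal form means order 0, and nonnegative order in normal
  -- form means analytic.
  have han : ∀ φ : HolChart X, ∀ z ∈ chartDomain φ (divisorSupport Ξ)ᶜ, AnalyticAt ℂ (Ξ φ) z := by
    intro φ z hz
    have h1 := h.meromorphic φ hz.1
    exact h1.meromorphicOrderAt_nonneg_iff_analyticAt.1
      (h1.meromorphicOrderAt_eq_zero_iff.2 (hne φ z hz)).ge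
  have hopen : IsOpen (divisorSupport Ξ)ᶜ := by
    rw [isOpen_iff_mem_nhds]
    intro p hp
    have hps : p ∈ (chartOf p).1.source := mem_chart_source ℂ p
    have hz := apply_mem_chartDomain hps hp
    have hc := (han _ _ hz).continuousAt.comp ((chartOf p).1.continuousAt hps)
    filter_upwards [hc.eventually_ne (hne _ _ hz), (chartOf p).1.open_source.mem_nhds hps]
      with q hq hqs
    rw [h.divisorSupport_eq_zeroSet h0]
    intro hq0
    refine hq ?_
    rw [← (chartOf p).1.left_inv hqs] at hq0
    exact (h.isCubicForm.mem_zeroSet_iff ⟨(chartOf p).1.map_source hqs, trivial⟩).1 hq0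
  have hsub : (divisorSupport Ξ ∪ {p | D p ≠ 0})ᶜ ⊆ (divisorSupport Ξ)ᶜ :=
    Set.compl_subset_compl.2 Set.subset_union_left
  refine ⟨?_, ⟨h.isCubicForm.mono (Set.subset_univ _), fun φ z hz => ?_⟩, fun φ z hz => ?_, ?_⟩
  · rw [Set.compl_union]
    exact hopen.inter (isOpen_compl_setOf_ne_zero D)
  · exact (han φ z (chartDomain_mono φ hsub hz)).differentiableAt.differentiableWithinAt
  · exact hne φ z (chartDomain_mono φ hsub hz)
  · exact hg.isHyperbolic.mono (Set.compl_subset_compl.2 Set.subset_union_right)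

/-- The set of regular points contains a punctured neighbourhood of every point. -/
theorem eventually_mem_chartDomain [T2Space X] (h : IsMeromorphicCubicForm Ξ)
    (h0 : ∃ φ : HolChart X, ∃ z ∈ φ.1.target, Ξ φ z ≠ 0) (D : X →₀ ℝ) (hp : p ∈ φ.1.source) :
    ∀ᶠ z in 𝓝[≠] (φ.1 p), z ∈ chartDomain φ (divisorSupport Ξ ∪ {p | D p ≠ 0})ᶜ := by
  have ht := φ.1.open_target.mem_nhds (φ.1.map_source hp)
  have h1 := (meromorphicOrderAt_ne_top_iff_eventually_ne_zero
    (h.meromorphic φ (φ.1.map_source hp)).meromorphicAt).1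
    (by rw [h.meromorphicOrderAt_eq_ord h0 hp]; simp)
  have h2 : ∀ᶠ q in 𝓝 p, q ∈ ((D.support : Set X) \ {p})ᶜ :=
    ((D.support.finite_toSet.subset Set.sdiff_subset).isClosed.isOpen_compl).mem_nhds (by simp)
  have h3 : Tendsto φ.1.symm (𝓝 (φ.1 p)) (𝓝 p) := by
    have := φ.1.symm.continuousAt (φ.1.map_source hp)
    rwa [ContinuousAt, φ.1.left_inv hp] at this
  filter_upwards [h1, nhdsWithin_le_nhds ht, nhdsWithin_le_nhds (h3.eventually h2),
    self_mem_nhdsWithin] with z hz hzt hzD hzc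
  refine ⟨hzt, ?_⟩
  rintro (hz' | hz')
  · rw [h.divisorSupport_eq_zeroSet h0] at hz'
    exact hz ((h.isCubicForm.mem_zeroSet_iff ⟨hzt, trivial⟩).1 hz')
  · refine hzD ⟨by simpa using hz', fun hzp => hzc ?_⟩
    rw [Set.mem_singleton_iff] at hzp ⊢
    rw [← hzp, φ.1.right_inv hzt]

theorem exists_eq_zpow_mul (h : IsMeromorphicCubicForm Ξ)
    (h0 : ∃ φ : HolChart X, ∃ z ∈ φ.1.target, Ξ φ z ≠ 0) (hp : p ∈ φ.1.source) :
    ∃ f : ℂ → ℂ, AnalyticAt ℂ f (φ.1 p) ∧ f (φ.1 p) ≠ 0 ∧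
      ∀ᶠ z in 𝓝[≠] (φ.1 p), Ξ φ z = (z - φ.1 p) ^ ord Ξ p * f z :=
  (meromorphicOrderAt_eq_int_iff (h.meromorphic φ (φ.1.map_source hp)).meromorphicAt).1
    (h.meromorphicOrderAt_eq_ord h0 hp)

end IsMeromorphicCubicForm

end MeromorphicCubicForms

/-! ### Connection matrices in polar coordinates -/

/-- The matrix of the `ℝ`-linear map `w ↦ α w + β w̄`. -/
def realMatrix (α β : ℂ) : Matrix (Fin 2) (Fin 2) ℝ :=
  !![(α + β).re, -α.im + β.im; (α + β).im, α.re - β.re]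

theorem connectionForm_bilin (a d v : ℂ) :
    connectionForm (bilin a d) v = realMatrix (v * a) (conj v * d) := by
  ext i j
  fin_cases i <;> fin_cases j <;> simp [connectionForm, realMatrix] <;> ring

theorem continuous_realMatrix : Continuous fun p : ℂ × ℂ => realMatrix p.1 p.2 := by
  refine continuous_matrix fun i j => ?_
  fin_cases i <;> fin_cases j <;> simp [realMatrix] <;> fun_prop

theorem smul_realMatrix_sub (r : ℝ) (α β α' β' : ℂ) :
    r • (realMatrix α β - realMatrix α' β') =
      realMatrix ((r : ℂ) * (α - α')) ((r : ℂ) * (β - β')) := by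
  ext i j
  fin_cases i <;> fin_cases j <;> simp [realMatrix] <;> ring

theorem tendsto_realMatrix {ι : Type*} {l : Filter ι} {u v : ι → ℂ} {α β : ℂ}
    (hu : Tendsto u l (𝓝 α)) (hv : Tendsto v l (𝓝 β)) :
    Tendsto (fun i => realMatrix (u i) (v i)) l (𝓝 (realMatrix α β)) :=
  Tendsto.comp (g := fun p : ℂ × ℂ => realMatrix p.1 p.2) (f := fun i => (u i, v i))
    (continuous_realMatrix.tendsto (α, β)) (hu.prodMk_nhds hv)

theorem realMatrix_zero_zero : realMatrix 0 0 = 0 := by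
  ext i j
  fin_cases i <;> fin_cases j <;> simp [realMatrix]

theorem realMatrix_ofReal_zero (s : ℝ) : realMatrix s 0 = s • 1 := by
  ext i j
  fin_cases i <;> fin_cases j <;> simp [realMatrix]

theorem realMatrix_I_mul_ofReal_zero (s : ℝ) : realMatrix (I * s) 0 = s • rotation := by
  ext i j
  fin_cases i <;> fin_cases j <;> simp [realMatrix, rotation]

theorem logModelRadial_eq (k : ℤ) (b ζ : ℂ) : logModelRadial k b ζ =
    realMatrix (2⁻¹ * (k + (Real.log ‖ζ‖ : ℂ)⁻¹))
      (-conj (logPhase k b ζ) * (2 * (Real.log ‖ζ‖ : ℂ))⁻¹) := by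
  rw [mul_inv, ← Complex.ofReal_inv]
  ext i j
  fin_cases i <;> fin_cases j <;> simp [logModelRadial, realMatrix] <;> ring

theorem logModelAngular_eq (k : ℤ) (b ζ : ℂ) : logModelAngular k b ζ =
    realMatrix (I * (2⁻¹ * (k + (Real.log ‖ζ‖ : ℂ)⁻¹)))
      (-I * (-conj (logPhase k b ζ) * (2 * (Real.log ‖ζ‖ : ℂ))⁻¹)) := by
  rw [mul_inv, ← Complex.ofReal_inv]
  ext i j
  fin_cases i <;> fin_cases j <;> simp [logModelAngular, realMatrix, rotation] <;> ring

theorem radialPart_skConnection (xi : ℂ → ℂ) (h : ℂ → ℝ) (c z : ℂ) :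
    radialPart (skConnection xi h) c z =
      realMatrix ((z - c) * skLinear xi h z) (conj (z - c) * skAntilinear xi h z) := by
  rw [radialPart, skConnection, connectionForm_bilin]

theorem angularPart_skConnection (xi : ℂ → ℂ) (h : ℂ → ℝ) (c z : ℂ) :
    angularPart (skConnection xi h) c z =
      realMatrix (I * ((z - c) * skLinear xi h z))
        (-I * (conj (z - c) * skAntilinear xi h z)) := by
  rw [angularPart, skConnection, connectionForm_bilin, map_mul, Complex.conj_I, mul_assoc,
    mul_assoc]

/-! ### Asymptotics of the special Kähler structure at an isolated singularity -/

theorem eventually_mul_logDeriv_eq {xi f : ℂ → ℂ} {c : ℂ} {n : ℤ} (hf : AnalyticAt ℂ f c)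
    (hf0 : f c ≠ 0) (hxi : ∀ᶠ z in 𝓝[≠] c, xi z = (z - c) ^ n * f z) :
    ∀ᶠ z in 𝓝[≠] c, (z - c) * (deriv xi z / xi z) = n + (z - c) * (deriv f z / f z) := by
  filter_upwards [eventually_eventually_nhdsWithin.2 hxi, hxi, self_mem_nhdsWithin,
    nhdsWithin_le_nhds hf.eventually_analyticAt,
    nhdsWithin_le_nhds (hf.continuousAt.eventually_ne hf0)] with z h1 h2 hz h3 h4
  rw [isOpen_compl_singleton.nhdsWithin_eq hz] at h1
  have hz' : z - c ≠ 0 := sub_ne_zero.2 hz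
  have h5 : HasDerivAt (fun w => (w - c) ^ n) (n * (z - c) ^ (n - 1) * 1) z :=
    HasDerivAt.comp (h₂ := fun w => w ^ n) (h := fun w => w - c) z
      (hasDerivAt_zpow n (z - c) (Or.inl hz')) ((hasDerivAt_id' z).sub_const c)
  have h6 := ((h5.mul h3.differentiableAt.hasDerivAt).congr_of_eventuallyEq h1).deriv
  have h7 := zpow_ne_zero n hz'
  rw [h6, h2, zpow_sub_one₀ hz']
  field_simp

theorem tendsto_norm_sub_nhdsNE (c : ℂ) : Tendsto (fun z => ‖z - c‖) (𝓝[≠] c) (𝓝[>] 0) := by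
  refine tendsto_nhdsWithin_iff.2 ⟨?_, ?_⟩
  · have : Continuous fun z : ℂ => ‖z - c‖ := by fun_prop
    simpa using (this.tendsto c).mono_left nhdsWithin_le_nhds
  · filter_upwards [self_mem_nhdsWithin] with z hz
    exact norm_pos_iff.2 (sub_ne_zero.2 hz)

namespace IsPlanarData

variable {O : Set ℂ} {xi f : ℂ → ℂ} {h : ℂ → ℝ} (H : IsPlanarData O xi h) {c z : ℂ} {n : ℤ}
include H

theorem eventually_log (hO : ∀ᶠ z in 𝓝[≠] c, z ∈ O) :
    (∀ᶠ z in 𝓝[≠] c, ContDiffAt ℝ 2 (fun z => Real.log (h z)) z) ∧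
      (∀ᶠ z in 𝓝[≠] c, Laplacian.laplacian (fun z => Real.log (h z)) z =
        2 * Real.exp (Real.log (h z))) ∧ ∀ᶠ z in 𝓝[≠] c, Real.exp (Real.log (h z)) = h z := by
  refine ⟨?_, ?_, ?_⟩
  · filter_upwards [hO] with z hz
    exact (H.contDiffOn_log.contDiffAt (H.isOpen.mem_nhds hz)).of_le (by norm_cast)
  · filter_upwards [hO] with z hz using H.laplacian_log hz
  · filter_upwards [hO] with z hz using Real.exp_log (H.pos z hz)

/-- Separates size from phase: the modulus is `r√h/2` and depends only on the hyperbolic metric,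
while the cubic form enters only through its phase. -/
theorem conj_sub_mul_antilinear (hz : z ∈ O) (c : ℂ) :
    conj (z - c) * skAntilinear xi h z =
      -(I / 2) * (√(h z) * conj ((z - c) * (xi z / (‖xi z‖ : ℂ)))) := by
  have h1 : (‖xi z‖ : ℂ) ≠ 0 := Complex.ofReal_ne_zero.2 (norm_ne_zero_iff.2 (H.ne_zero z hz))
  have h2 : (√(h z) : ℂ) ≠ 0 := Complex.ofReal_ne_zero.2 (Real.sqrt_pos.2 (H.pos z hz)).ne'
  rw [skAntilinear, skFactor, map_mul, map_div₀, Complex.conj_ofReal]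
  push_cast
  field_simp
  ring

theorem norm_conj_sub_mul_antilinear (hz : z ∈ O) (c : ℂ) :
    ‖conj (z - c) * skAntilinear xi h z‖ = 2⁻¹ * (‖z - c‖ * √(h z)) := by
  have h1 : ‖xi z‖ ≠ 0 := norm_ne_zero_iff.2 (H.ne_zero z hz)
  rw [H.conj_sub_mul_antilinear hz, norm_mul, norm_mul, Complex.norm_conj, norm_mul, norm_div,
    Complex.norm_real, Complex.norm_real, norm_norm, div_self h1, mul_one,
    Real.norm_of_nonneg (by positivity)]
  simp
  ring

/-- The form contributes `n/2` and the metric `-α/2` to the limit of `(z - c)a`. The antilinear part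
has size `r√h/2`, comparable to `r^(1+α)`, and disappears in the limit because `α > -1`. -/
theorem tendsto_conical (hO : ∀ᶠ z in 𝓝[≠] c, z ∈ O) (hf : AnalyticAt ℂ f c) (hf0 : f c ≠ 0)
    (hxi : ∀ᶠ z in 𝓝[≠] c, xi z = (z - c) ^ n * f z) {α C : ℝ} (hα : -1 < α) (hC : 0 < C)
    (hh : Tendsto (fun z => h z / ‖z - c‖ ^ (2 * α)) (𝓝[≠] c) (𝓝 C)) :
    Tendsto (fun z => skFactor xi h z / ‖z - c‖ ^ (2 * (((n : ℝ) - α) / 2))) (𝓝[≠] c)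
        (𝓝 (4 * ‖f c‖ / √C)) ∧
      Tendsto (fun z => radialPart (skConnection xi h) c z) (𝓝[≠] c)
        (𝓝 ((((n : ℝ) - α) / 2) • 1)) ∧
      Tendsto (fun z => angularPart (skConnection xi h) c z) (𝓝[≠] c)
        (𝓝 ((((n : ℝ) - α) / 2) • rotation)) := by
  obtain ⟨hL, hΔ, hexp⟩ := H.eventually_log hO
  have hsqrt : ∀ᶠ z in 𝓝[≠] c, √(h z) = √(h z / ‖z - c‖ ^ (2 * α)) * ‖z - c‖ ^ α := by
    filter_upwards [hO, self_mem_nhdsWithin] with z hz hzc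
    have hr : 0 < ‖z - c‖ := norm_pos_iff.2 (sub_ne_zero.2 hzc)
    have h1 : ‖z - c‖ ^ (2 * α) = (‖z - c‖ ^ α) ^ 2 := by
      rw [mul_comm, Real.rpow_mul hr.le, Real.rpow_ofNat]
    have h2 := Real.rpow_pos_of_pos hr α
    rw [h1, Real.sqrt_div (H.pos z hz).le, Real.sqrt_sq h2.le, div_mul_cancel₀ _ h2.ne']
  have hlim := tendsto_mul_dz_of_conical hL hΔ hα hC
    (hh.congr' (by filter_upwards [hexp] with z hz; rw [hz]))
  have hlin : Tendsto (fun z => (z - c) * skLinear xi h z) (𝓝[≠] c)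
      (𝓝 ((((n : ℝ) - α) / 2 : ℝ) : ℂ)) := by
    have h0 : Tendsto (fun z => (z - c) * (deriv f z / f z)) (𝓝[≠] c) (𝓝 0) := by
      have : ContinuousAt (fun z => (z - c) * (deriv f z / f z)) c :=
        (continuousAt_id.sub continuousAt_const).mul
          (hf.deriv.continuousAt.div hf.continuousAt hf0)
      simpa using this.tendsto.mono_left nhdsWithin_le_nhds
    have h1 := (((tendsto_const_nhds (x := (n : ℂ))).add h0).sub hlim).div_const 2
    have e : ((((n : ℝ) - α) / 2 : ℝ) : ℂ) = ((n : ℂ) + 0 - α) / 2 := by push_cast; ring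
    rw [e]
    refine h1.congr' ?_
    filter_upwards [hO, eventually_mul_logDeriv_eq hf hf0 hxi] with z hz h2
    rw [← h2, H.linear_eq hz]
    have := H.ne_zero z hz
    field_simp
  have hanti : Tendsto (fun z => conj (z - c) * skAntilinear xi h z) (𝓝[≠] c) (𝓝 0) := by
    rw [tendsto_zero_iff_norm_tendsto_zero]
    have h1 : Tendsto (fun z : ℂ => ‖z - c‖ ^ (1 + α)) (𝓝[≠] c) (𝓝 0) := by
      have h2 : ContinuousAt (fun r : ℝ => r ^ (1 + α)) 0 :=
        Real.continuousAt_rpow_const _ _ (Or.inr (by linarith))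
      have h3 := h2.tendsto
      simp only [Real.zero_rpow (by linarith : 1 + α ≠ 0)] at h3
      exact h3.comp ((tendsto_norm_sub_nhdsNE c).mono_right nhdsWithin_le_nhds)
    have h4 := (h1.mul hh.sqrt).const_mul (2⁻¹ : ℝ)
    rw [zero_mul, mul_zero] at h4
    refine h4.congr' ?_
    filter_upwards [hO, hsqrt, self_mem_nhdsWithin] with z hz hs hzc
    have hr : 0 < ‖z - c‖ := norm_pos_iff.2 (sub_ne_zero.2 hzc)
    rw [H.norm_conj_sub_mul_antilinear hz, hs, Real.rpow_add hr, Real.rpow_one]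
    ring
  refine ⟨?_, ?_, ?_⟩
  · have h1 : Tendsto (fun z => 4 * ‖f z‖) (𝓝[≠] c) (𝓝 (4 * ‖f c‖)) :=
      ((hf.continuousAt.norm.tendsto).mono_left nhdsWithin_le_nhds).const_mul 4
    refine (h1.div hh.sqrt (Real.sqrt_pos.2 hC).ne').congr' ?_
    filter_upwards [hsqrt, hxi, self_mem_nhdsWithin] with z hs h2 hzc
    have hr : 0 < ‖z - c‖ := norm_pos_iff.2 (sub_ne_zero.2 hzc)
    have h3 := Real.rpow_pos_of_pos hr α
    have h4 := zpow_pos hr n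
    have e : 2 * (((n : ℝ) - α) / 2) = n - α := by ring
    rw [skFactor, h2, e, Real.rpow_sub hr, Real.rpow_intCast, hs, norm_mul, norm_zpow]
    simp only [Pi.div_apply]
    field_simp
  · simp only [radialPart_skConnection]
    rw [← realMatrix_ofReal_zero]
    exact tendsto_realMatrix hlin hanti
  · simp only [angularPart_skConnection]
    rw [← realMatrix_I_mul_ofReal_zero]
    exact tendsto_realMatrix (hlin.const_mul I) (by simpa using hanti.const_mul (-I))

/-- With `ρ = log r`, the cusp gives `(z - c)∂L = -1 - 1/ρ + o(1/ρ)`, so `(z - c)a = (n + 1 + 1/ρ)/2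
+ o(1/ρ)`; this is the shift from `n` to `n + 1`. The antilinear part is now of order `1/ρ` and
belongs to the model. In `b = 4i f(c)` the modulus comes from the factor 4 in the metric and the
phase `i` from `d = -2i · conj xi / λ`. -/
theorem tendsto_cusp (hO : ∀ᶠ z in 𝓝[≠] c, z ∈ O) (hf : AnalyticAt ℂ f c) (hf0 : f c ≠ 0)
    (hxi : ∀ᶠ z in 𝓝[≠] c, xi z = (z - c) ^ n * f z) {C : ℝ} (hC : 0 < C)
    (hh : Tendsto (fun z => h z * (‖z - c‖ * Real.log ‖z - c‖) ^ 2) (𝓝[≠] c) (𝓝 C)) :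
    Tendsto (fun z => skFactor xi h z / logModelMetric (n + 1) (4 * I * f c) (z - c)) (𝓝[≠] c)
        (𝓝 1) ∧
      Tendsto (fun z => Real.log ‖z - c‖ • (radialPart (skConnection xi h) c z -
        logModelRadial (n + 1) (4 * I * f c) (z - c))) (𝓝[≠] c) (𝓝 0) ∧
      Tendsto (fun z => Real.log ‖z - c‖ • (angularPart (skConnection xi h) c z -
        logModelAngular (n + 1) (4 * I * f c) (z - c))) (𝓝[≠] c) (𝓝 0) := by
  obtain ⟨hL, hΔ, hexp⟩ := H.eventually_log hO
  obtain ⟨hC1, hlim⟩ := tendsto_mul_dz_of_cusp hL hΔ hC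
    (hh.congr' (by filter_upwards [hexp] with z hz; rw [hz]))
  subst hC1
  have hlog : ∀ᶠ z in 𝓝[≠] c, Real.log ‖z - c‖ < 0 :=
    (Real.tendsto_log_nhdsGT_zero.comp (tendsto_norm_sub_nhdsNE c)).eventually_lt_atBot 0
  -- The square root of the cusp condition with `C = 1`; the limit is `-1` because `log r < 0`.
  have hroot : Tendsto (fun z => Real.log ‖z - c‖ * (‖z - c‖ * √(h z))) (𝓝[≠] c) (𝓝 (-1)) := by
    have h1 := hh.sqrt.neg
    rw [Real.sqrt_one] at h1
    refine h1.congr' ?_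
    filter_upwards [hO, hlog] with z hz hl
    rw [Real.sqrt_mul (H.pos z hz).le, Real.sqrt_sq_eq_abs, abs_mul, abs_of_neg hl, abs_norm]
    ring
  have hlin : Tendsto (fun z => (Real.log ‖z - c‖ : ℂ) * ((z - c) * skLinear xi h z -
      2⁻¹ * (((n + 1 : ℤ) : ℂ) + (Real.log ‖z - c‖ : ℂ)⁻¹))) (𝓝[≠] c) (𝓝 0) := by
    have h0 : Tendsto (fun z => (Real.log ‖z - c‖ : ℂ) * (z - c)) (𝓝[≠] c) (𝓝 0) := by
      rw [tendsto_zero_iff_norm_tendsto_zero]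
      have h2 := (Real.continuous_mul_log.tendsto 0).comp
        ((tendsto_norm_sub_nhdsNE c).mono_right nhdsWithin_le_nhds)
      rw [zero_mul] at h2
      refine h2.norm.congr' ?_ |>.trans (by simp)
      filter_upwards with z
      simp [mul_comm]
    have h1 : Tendsto (fun z => deriv f z / f z) (𝓝[≠] c) (𝓝 (deriv f c / f c)) :=
      ((hf.deriv.continuousAt.div hf.continuousAt hf0).tendsto).mono_left nhdsWithin_le_nhds
    have h2 := ((h0.mul h1).sub hlim).div_const 2
    rw [zero_mul, sub_zero, zero_div] at h2
    refine h2.congr' ?_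
    filter_upwards [hO, eventually_mul_logDeriv_eq hf hf0 hxi] with z hz h3
    have h4 : (z - c) * skLinear xi h z = ((z - c) * (deriv xi z / xi z)) / 2 -
        (z - c) * dz (fun w => (Real.log (h w) : ℂ)) z / 2 := by
      rw [H.linear_eq hz]
      have := H.ne_zero z hz
      field_simp
    rw [h4, h3]
    push_cast
    ring
  have hanti : Tendsto (fun z => (Real.log ‖z - c‖ : ℂ) * (conj (z - c) * skAntilinear xi h z -
      -conj (logPhase (n + 1) (4 * I * f c) (z - c)) * (2 * (Real.log ‖z - c‖ : ℂ))⁻¹))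
      (𝓝[≠] c) (𝓝 0) := by
    have h1 : Tendsto (fun z => f z / (‖f z‖ : ℂ)) (𝓝[≠] c) (𝓝 (f c / (‖f c‖ : ℂ))) := by
      have : ContinuousAt (fun z => f z / (‖f z‖ : ℂ)) c :=
        hf.continuousAt.div (Complex.continuous_ofReal.continuousAt.comp hf.continuousAt.norm)
          (by simpa using hf0)
      exact this.tendsto.mono_left nhdsWithin_le_nhds
    have h2 := (((Complex.continuous_ofReal.tendsto _).comp hroot).mul
      ((Complex.continuous_conj.tendsto _).comp h1)).add_const (conj (f c / (‖f c‖ : ℂ)))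
    rw [Complex.ofReal_neg, Complex.ofReal_one, neg_one_mul, neg_add_cancel] at h2
    rw [tendsto_zero_iff_norm_tendsto_zero] at h2 ⊢
    have h3 := h2.const_mul (2⁻¹ : ℝ)
    rw [mul_zero] at h3
    refine h3.congr' ?_
    filter_upwards [hO, hlog, hxi, self_mem_nhdsWithin] with z hz hl hx hzc
    have hzc' : z - c ≠ 0 := sub_ne_zero.2 hzc
    have hr : (‖z - c‖ : ℂ) ≠ 0 := by simpa using hzc'
    have hl' : (Real.log ‖z - c‖ : ℂ) ≠ 0 := Complex.ofReal_ne_zero.2 hl.ne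
    have hph : (z - c) * (xi z / (‖xi z‖ : ℂ)) =
        ((z - c) / (‖z - c‖ : ℂ)) ^ (n + 1) * (‖z - c‖ * (f z / (‖f z‖ : ℂ))) := by
      rw [hx, norm_mul, norm_zpow, Complex.ofReal_mul, Complex.ofReal_zpow, div_zpow,
        zpow_add_one₀ hzc', zpow_add_one₀ hr]
      field_simp
    have hq : logPhase (n + 1) (4 * I * f c) (z - c) =
        ((z - c) / (‖z - c‖ : ℂ)) ^ (n + 1) * (I * (f c / (‖f c‖ : ℂ))) := by
      rw [logPhase]
      have : ‖4 * I * f c‖ = 4 * ‖f c‖ := by simp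
      rw [this]
      push_cast
      field_simp
    have hu : ‖conj (((z - c) / (‖z - c‖ : ℂ)) ^ (n + 1))‖ = 1 := by
      rw [Complex.norm_conj, norm_zpow, norm_div, Complex.norm_real, norm_norm,
        div_self (norm_ne_zero_iff.2 hzc'), one_zpow]
    -- The two angular factors agree and have modulus 1. What remains is the phase of `f z` times a
    -- quantity tending to `-1`, plus the phase of `f c`, which tends to 0.
    have key : (Real.log ‖z - c‖ : ℂ) * (conj (z - c) * skAntilinear xi h z -
        -conj (logPhase (n + 1) (4 * I * f c) (z - c)) * (2 * (Real.log ‖z - c‖ : ℂ))⁻¹) =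
        -(I / 2) * conj (((z - c) / (‖z - c‖ : ℂ)) ^ (n + 1)) *
          (((Real.log ‖z - c‖ * (‖z - c‖ * √(h z)) : ℝ) : ℂ) * conj (f z / (‖f z‖ : ℂ)) +
            conj (f c / (‖f c‖ : ℂ))) := by
      rw [H.conj_sub_mul_antilinear hz, hph, hq]
      simp only [map_mul, Complex.conj_I, Complex.conj_ofReal]
      push_cast
      field_simp
      ring
    rw [key, norm_mul, norm_mul, hu]
    simp
  refine ⟨?_, ?_, ?_⟩
  · have h1 : Tendsto (fun z => ‖f z‖ / ‖f c‖) (𝓝[≠] c) (𝓝 (‖f c‖ / ‖f c‖)) :=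
      ((hf.continuousAt.norm.tendsto).mono_left nhdsWithin_le_nhds).div_const _
    have h2 := h1.div hroot.neg (by norm_num)
    rw [div_self (norm_ne_zero_iff.2 hf0), neg_neg, div_one] at h2
    refine h2.congr' ?_
    filter_upwards [hO, hlog, hxi, self_mem_nhdsWithin] with z hz hl hx hzc
    have hr : 0 < ‖z - c‖ := norm_pos_iff.2 (sub_ne_zero.2 hzc)
    have h3 := zpow_pos hr n
    have h4 := Real.sqrt_pos.2 (H.pos z hz)
    have h5 := norm_pos_iff.2 hf0
    have h6 : ‖4 * I * f c‖ = 4 * ‖f c‖ := by simp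
    have h7 := hl.ne
    rw [skFactor, logModelMetric, h6, hx, norm_mul, norm_zpow, zpow_add_one₀ hr.ne']
    simp only [Pi.div_apply]
    field_simp
  · simp only [radialPart_skConnection, logModelRadial_eq, smul_realMatrix_sub]
    rw [← realMatrix_zero_zero]
    exact tendsto_realMatrix hlin hanti
  · simp only [angularPart_skConnection, logModelAngular_eq, smul_realMatrix_sub]
    rw [← realMatrix_zero_zero]
    have h1 := hlin.const_mul I
    have h2 := hanti.const_mul (-I)
    rw [mul_zero] at h1 h2
    exact tendsto_realMatrix (h1.congr fun z => by ring) (h2.congr fun z => by ring)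

end IsPlanarData

/-! ### Singularities on the surface -/

namespace IsMeromorphicCubicForm

variable {X : Type*} [TopologicalSpace X] [T2Space X] [ConnectedSpace X] [ChartedSpace ℂ X]
  [IsManifold 𝓘(ℂ) ω X] {Ξ : HolChart X → ℂ → ℂ} {gt : HolChart X → ℂ → ℝ} {D : X →₀ ℝ} {p : X}

theorem hasConicalSingularity (h : IsMeromorphicCubicForm Ξ)
    (h0 : ∃ φ : HolChart X, ∃ z ∈ φ.1.target, Ξ φ z ≠ 0) (hg : RepresentsDivisor gt D) {α : ℝ}
    (hp : HasConicalPoint gt p α) :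
    HasConicalSingularity (fun φ => skFactor (Ξ φ) (gt φ)) (fun φ => skConnection (Ξ φ) (gt φ)) p
      (((ord Ξ p : ℝ) - α) / 2) := by
  intro φ hφ
  obtain ⟨hα, hp⟩ := hp
  obtain ⟨C, hC, hlim⟩ := hp φ hφ
  obtain ⟨f, hf, hf0, hΞ⟩ := h.exists_eq_zpow_mul h0 hφ
  have key := ((h.isSurfaceData h0 hg).planar φ).tendsto_conical
    (h.eventually_mem_chartDomain h0 D hφ) hf hf0 hΞ hα hC hlim
  have hpos := norm_pos_iff.2 hf0
  exact ⟨⟨_, by positivity, key.1⟩, key.2⟩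

theorem hasLogSingularity (h : IsMeromorphicCubicForm Ξ)
    (h0 : ∃ φ : HolChart X, ∃ z ∈ φ.1.target, Ξ φ z ≠ 0) (hg : RepresentsDivisor gt D)
    (hp : HasCusp gt p) :
    HasLogSingularity (fun φ => skFactor (Ξ φ) (gt φ)) (fun φ => skConnection (Ξ φ) (gt φ)) p
      (((ord Ξ p : ℝ) + 1) / 2) := by
  refine ⟨ord Ξ p + 1, by push_cast; rfl, fun φ hφ => ?_⟩
  obtain ⟨C, hC, hlim⟩ := hp φ hφ
  obtain ⟨f, hf, hf0, hΞ⟩ := h.exists_eq_zpow_mul h0 hφ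
  exact ⟨4 * I * f (φ.1 p), by simpa using hf0,
    ((h.isSurfaceData h0 hg).planar φ).tendsto_cusp
      (h.eventually_mem_chartDomain h0 D hφ) hf hf0 hΞ hC hlim⟩

end IsMeromorphicCubicForm

end SpecialKahler

end

/-! ### The main theorem -/

theorem mainTheorem1 {X : Type*} [TopologicalSpace X] [T2Space X] [ConnectedSpace X]
    [ChartedSpace ℂ X] [IsManifold 𝓘(ℂ) ω X] :
    (∀ (U : Set X) (Ξ : SpecialKahler.HolChart X → ℂ → ℂ)
        (gt : SpecialKahler.HolChart X → ℂ → ℝ),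
      IsOpen U →
      SpecialKahler.IsHolomorphicCubicFormOn U Ξ →
      SpecialKahler.IsHyperbolicMetricOn U gt →
      ∃ (g : SpecialKahler.HolChart X → ℂ → ℝ)
        (Γ : SpecialKahler.HolChart X → ℂ → (ℂ →L[ℝ] ℂ →L[ℝ] ℂ)),
        SpecialKahler.IsSpecialKahlerWith (U \ SpecialKahler.zeroSet Ξ) gt Ξ g Γ ∧
        (∀ g' Γ', SpecialKahler.IsSpecialKahlerWith (U \ SpecialKahler.zeroSet Ξ) gt Ξ g' Γ' →
          SpecialKahler.AgreeOn (U \ SpecialKahler.zeroSet Ξ) g' Γ' g Γ) ∧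
        (∀ φ, ∀ z ∈ SpecialKahler.chartDomain φ (U \ SpecialKahler.zeroSet Ξ), ∀ v : ℝ,
          gt φ z = Real.exp (2 * v) → g φ z = 4 * ‖Ξ φ z‖ * Real.exp (-v))) ∧
    (∀ (Ξ : SpecialKahler.HolChart X → ℂ → ℂ) (gt : SpecialKahler.HolChart X → ℂ → ℝ)
        (D : X →₀ ℝ),
      SpecialKahler.IsMeromorphicCubicForm Ξ →
      (∃ φ : SpecialKahler.HolChart X, ∃ z ∈ φ.1.target, Ξ φ z ≠ 0) →
      SpecialKahler.RepresentsDivisor gt D →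
      ∃ (g : SpecialKahler.HolChart X → ℂ → ℝ)
        (Γ : SpecialKahler.HolChart X → ℂ → (ℂ →L[ℝ] ℂ →L[ℝ] ℂ)),
        SpecialKahler.IsSpecialKahlerWith
          (SpecialKahler.divisorSupport Ξ ∪ {p | D p ≠ 0})ᶜ gt Ξ g Γ ∧
        (∀ g' Γ', SpecialKahler.IsSpecialKahlerWith
            (SpecialKahler.divisorSupport Ξ ∪ {p | D p ≠ 0})ᶜ gt Ξ g' Γ' →
          SpecialKahler.AgreeOn
            (SpecialKahler.divisorSupport Ξ ∪ {p | D p ≠ 0})ᶜ g' Γ' g Γ) ∧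
        (∀ φ, ∀ z ∈ SpecialKahler.chartDomain φ
            (SpecialKahler.divisorSupport Ξ ∪ {p | D p ≠ 0})ᶜ, ∀ v : ℝ,
          gt φ z = Real.exp (2 * v) → g φ z = 4 * ‖Ξ φ z‖ * Real.exp (-v)) ∧
        (∀ p, SpecialKahler.HasCusp gt p →
          SpecialKahler.HasLogSingularity g Γ p (((SpecialKahler.ord Ξ p : ℝ) + 1) / 2)) ∧
        (∀ p (α : ℝ), SpecialKahler.HasConicalPoint gt p α →
          SpecialKahler.HasConicalSingularity g Γ p (((SpecialKahler.ord Ξ p : ℝ) - α) / 2)) ∧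
        (∀ p ∈ SpecialKahler.divisorSupport Ξ, D p = 0 →
          SpecialKahler.HasConicalSingularity g Γ p ((SpecialKahler.ord Ξ p : ℝ) / 2))) := by
  refine ⟨fun U Ξ gt hU hΞ hg => ?_, fun Ξ gt D hΞ h0 hg => ?_⟩
  · have H := hΞ.isSurfaceData hU hg
    exact ⟨_, _, H.isSpecialKahlerWith, fun _ _ h => H.agreeOn h,
      fun _ _ _ _ hv => SpecialKahler.skFactor_eq_of_metric_eq hv⟩
  · have H := hΞ.isSurfaceData h0 hg
    refine ⟨_, _, H.isSpecialKahlerWith, fun _ _ h => H.agreeOn h,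
      fun _ _ _ _ hv => SpecialKahler.skFactor_eq_of_metric_eq hv,
      fun p hp => hΞ.hasLogSingularity h0 hg hp,
      fun p α hp => hΞ.hasConicalSingularity h0 hg hp, fun p _ hp => ?_⟩
    simpa using hΞ.hasConicalSingularity h0 hg (hg.hasConicalPoint_zero hp)
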